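/- Let $\mathbb N=\{1,2,\dots\}$. For $L>0$ let $Q_L=[0,L]^2$ and, for real $V\in L^2(Q_L)$, let $\lambda_1(Q_L,V)\ge\lambda_2(Q_L,V)\ge\cdots$ be the eigenvalues, counted with multiplicity, of the operator $\Delta+V$ on $L^2(Q_L)$ with Dirichlet boundary conditions (domain: those $f\in H^1_0(Q_L)$ for which the distribution $\Delta f+Vf$ lies in $L^2(Q_L)$). For $n\in\mathbb N$ and $x\in\mathbb R$ put $$I_{L,n}(x)=\inf\bigl\{\tfrac12\|V\|_{L^2}^2 : V\in L^2(Q_L),\ \lambda_n(Q_L,V)=x\bigr\}\in[0,\infty],\qquad \varrho_n=\inf_{L>0}\ \inf_{x\ge 1} I_{L,n}(x).$$ Let $C_c^\infty(\mathbb R^2)$ denote the real-valued smooth compactly supported functions on $\mathbb R^2$. **Theorem.** There exists a constant $C>0$ such that for all $n\in\mathbb N$ $$\varrho_n=\lim_{L\to\infty}\ \inf_{x\ge 1} I_{L,n}(x),\qquad C<\varrho_n<\infty,$$ and $$\frac{2}{\varrho_n}=4\sup_{\substack{V\in C_c^\infty(\mathbb R^2)\\ \|V\|_{L^2}^2\le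 1}}\ \sup_{\substack{F\subset C_c^\infty(\mathbb R^2)\text{ linear subspace}\\ \dim F=n}}\ \inf_{\substack{\psi\in F\\ \|\psi\|_{L^2}^2=1}}\ \int_{\mathbb R^2}\bigl(-|\nabla\psi|^2+V\psi^2\bigr).$$ Moreover, $$\frac{2}{\varrho_1}=4\sup_{\substack{\psi\in C_c^\infty(\mathbb R^2)\\ \|\psi\|_{L^2}^2=1}}\Bigl(\|\psi\|_{L^4}^2-\int_{\mathbb R^2}|\nabla\psi|^2\Bigr)=\chi,$$ where $\chi$ is the smallest constant $C>0$ such that $\|f\|_{L^4}^4\le C\,\|\nabla f\|_{L^2}^2\,\|f\|_{L^2}^2$ for all real-valued $f\in H^1(\mathbb R^2)$; in particular, such a smallest constant exists. -/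

import Mathlib

open MeasureTheory Filter Topology Set
open scoped ENNReal ContDiff

noncomputable section

namespace DirichletBox

/-- The plane `ℝ²` with its Euclidean norm and Lebesgue measure. -/
abbrev Plane : Type := EuclideanSpace ℝ (Fin 2)

/-- `C_c^∞(ℝ²)`: smooth real functions with compact support. -/
def IsTest (φ : Plane → ℝ) : Prop :=
  ContDiff ℝ ∞ φ ∧ HasCompactSupport φ

/-- The box `Q_L = [0, L]²`. -/
def box (L : ℝ) : Set Plane := {x | ∀ i, 0 ≤ x i ∧ x i ≤ L}

/-- Lebesgue measure on the box `Q_L`. -/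
abbrev boxMeasure (L : ℝ) : Measure Plane := (volume : Measure Plane).restrict (box L)

/-- The real Hilbert space `L²(Q_L)`. -/
abbrev L2Box (L : ℝ) : Type := Lp ℝ 2 (boxMeasure L)

/-- `C_c^∞(Q_L)`: test functions whose support lies in the interior of `Q_L`. -/
def IsBoxTest (L : ℝ) (φ : Plane → ℝ) : Prop :=
  IsTest φ ∧ tsupport φ ⊆ interior (box L)

/-- `f ∈ H¹₀(Q_L)` with weak gradient `g`: the pair `(f, g)` is the limit in `L² × L²` of pairs
`(φ, ∇φ)` with `φ ∈ C_c^∞(Q_L)`, that is, `f` lies in the closure of `C_c^∞(Q_L)` in `H¹`. -/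
def HasDirichletGradient (L : ℝ) (f : L2Box L) (g : Lp Plane 2 (boxMeasure L)) : Prop :=
  ∃ φ : ℕ → Plane → ℝ, (∀ k, IsBoxTest L (φ k)) ∧
    Tendsto (fun k => eLpNorm (fun x => φ k x - f x) 2 (boxMeasure L)) atTop (𝓝 0) ∧
    Tendsto (fun k => eLpNorm (fun x => gradient (φ k) x - g x) 2 (boxMeasure L)) atTop (𝓝 0)

/-- The graph of the Dirichlet Schrödinger operator `Δ + V` on `L²(Q_L)`, `V ∈ L²(Q_L)`: `f` is in
the domain and `Δ f + V f = h`, which means that `f ∈ H¹₀(Q_L)`, `h ∈ L²(Q_L)` and the equation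
holds weakly, i.e. when tested against `C_c^∞(Q_L)`. -/
def SchrodingerGraph (L : ℝ) (V f h : L2Box L) : Prop :=
  ∃ g : Lp Plane 2 (boxMeasure L), HasDirichletGradient L f g ∧
    ∀ φ : Plane → ℝ, IsBoxTest L φ →
      ∫ x, (-inner ℝ (g x) (gradient φ x) + V x * f x * φ x) ∂(boxMeasure L) =
        ∫ x, h x * φ x ∂(boxMeasure L)

/-- The eigenspace `ker (ν - (Δ + V))`. -/
def eigenspace (L : ℝ) (V : L2Box L) (ν : ℝ) : Set (L2Box L) :=
  {f | SchrodingerGraph L V f (ν • f)}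

/-- At least `n` eigenvalues of `Δ + V` on `Q_L`, counted with multiplicity, are `≥ μ`: the
eigenspaces to eigenvalues `ν ≥ μ` together span a space of dimension at least `n` (eigenspaces to
different eigenvalues are linearly independent, so this dimension is the sum of the
multiplicities). -/
def AtLeastEigenvaluesAbove (L : ℝ) (V : L2Box L) (n : ℕ) (μ : ℝ) : Prop :=
  (n : Cardinal) ≤ Module.rank ℝ (Submodule.span ℝ (⋃ ν ∈ Ici μ, eigenspace L V ν))

/-- `λ_n(Q_L, V) = x`: the `n`-th entry (`n = 1, 2, …`) of the list `λ₁ ≥ λ₂ ≥ …` of the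
eigenvalues of the Dirichlet operator `Δ + V` on `Q_L`, counted with multiplicity, is `x`. -/
def IsNthEigenvalue (L : ℝ) (V : L2Box L) (n : ℕ) (x : ℝ) : Prop :=
  IsGreatest {μ : ℝ | AtLeastEigenvaluesAbove L V n μ} x

/-- The rate function `I_{L,n}(x) = inf {½ ‖V‖² : V ∈ L²(Q_L), λ_n(Q_L, V) = x}`, with values in
`[0, ∞]`. -/
def rateFunction (L : ℝ) (n : ℕ) (x : ℝ) : ℝ≥0∞ :=
  ⨅ (V : L2Box L) (_ : IsNthEigenvalue L V n x), ENNReal.ofReal (‖V‖ ^ 2 / 2)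

/-- `inf I_{L,n}[1, ∞)`. -/
def rateInf (L : ℝ) (n : ℕ) : ℝ≥0∞ := ⨅ x ∈ Ici (1 : ℝ), rateFunction L n x

/-- `ϱ_n = inf_{L > 0} inf I_{L,n}[1, ∞)`. -/
def rho (n : ℕ) : ℝ≥0∞ := ⨅ L ∈ Ioi (0 : ℝ), rateInf L n

/-- `sup_V sup_F inf_ψ ∫ -|∇ψ|² + V ψ²` over `V ∈ C_c^∞(ℝ²)` with `‖V‖₂² ≤ 1`, over
`n`-dimensional linear subspaces `F` of `C_c^∞(ℝ²)`, and over `ψ ∈ F` with `‖ψ‖₂² = 1`, in the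
complete lattice of extended reals. -/
def maxMinValue (n : ℕ) : EReal :=
  ⨆ (V : Plane → ℝ) (_ : IsTest V ∧ ∫ x, V x ^ 2 ≤ 1),
    ⨆ (F : Submodule ℝ (Plane → ℝ)) (_ : (∀ ψ ∈ F, IsTest ψ) ∧ Module.rank ℝ F = n),
      ⨅ (ψ : Plane → ℝ) (_ : ψ ∈ F ∧ ∫ x, ψ x ^ 2 = 1),
        ((∫ x, (-‖gradient ψ x‖ ^ 2 + V x * ψ x ^ 2) : ℝ) : EReal)

/-- `sup (‖ψ‖₄² - ∫ |∇ψ|²)` over `ψ ∈ C_c^∞(ℝ²)` with `‖ψ‖₂² = 1`. -/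
def quarticValue : EReal :=
  ⨆ (ψ : Plane → ℝ) (_ : IsTest ψ ∧ ∫ x, ψ x ^ 2 = 1),
    ((√(∫ x, ψ x ^ 4) - ∫ x, ‖gradient ψ x‖ ^ 2 : ℝ) : EReal)

/-- `f ∈ H¹(ℝ²)` with weak gradient `∇f = g`. -/
def IsSobolevGradient (f : Plane → ℝ) (g : Plane → Plane) : Prop :=
  MemLp f 2 ∧ MemLp g 2 ∧
    ∀ φ : Plane → ℝ, IsTest φ → ∫ x, f x • gradient φ x = -∫ x, φ x • g x

/-- The constants `C > 0` with `‖f‖₄⁴ ≤ C ‖∇f‖₂² ‖f‖₂²` for all `f ∈ H¹(ℝ²)`. -/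
def ladyzhenskayaConstants : Set ℝ :=
  {C | 0 < C ∧ ∀ (f : Plane → ℝ) (g : Plane → Plane), IsSobolevGradient f g →
    eLpNorm f 4 volume ^ 4 ≤
      ENNReal.ofReal C * eLpNorm g 2 volume ^ 2 * eLpNorm f 2 volume ^ 2}

end DirichletBox

end

/-!
The number that governs everything is the max-min value `m` (`maxMinValue n`), and the proof shows
`ϱ_n = 1 / (2 m)`, with the same value for the limit as `L → ∞`; this is `rho_eq` and
`tendsto_rateInf`. The link between potentials and `m` is scaling: under `x ↦ t x` the form of
`Δ + V` and, in two dimensions, also `‖V‖₂²` are multiplied by `t²`. Hence an `n`-dimensional space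
of test functions on which the form of `Δ + V` is at least `μ` shows `μ / ‖V‖₂² ≤ m`
(`TrialSpace.div_le_maxMinValue`).

*Lower bound, for every box.* If `V ∈ L²(Q_L)` has `n` eigenvalues above `x ≥ 1`, the form is at
least `x` on the span of the eigenfunctions, since eigenfunctions to different eigenvalues are
orthogonal. By Ladyzhenskaya's inequality `H¹₀(Q_L)` embeds into `L⁴(Q_L)`, so that the form
`-⟪∇f, ∇f'⟫ + ∫ V f f'` is continuous in `V ∈ L²` and `f, f' ∈ H¹₀` jointly, and eigenfunctions and
potential may be replaced by test functions with an arbitrarily small loss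
(`exists_trialSpace_of_atLeastEigenvaluesAbove`). The previous remark gives `1 ≤ m ‖V‖²`.

*Upper bound, for large boxes.* For `a < m` there is a trial space on the plane at level `a`, with
normalized potential. Rescaled to level `1` it has a potential of norm squared `1 / a`, and translated
it fits into every large box. It remains to see that a trial space at level `μ` in the box forces
the `n`-th eigenvalue to exist and to be at least `μ` (`exists_le_isNthEigenvalue`). Test potentials
are bounded, so for large `K` the form of `K - (Δ + V)` is coercive on `H¹₀(Q_L)`, and its inverse, as
an operator on `L²(Q_L)`, is symmetric and, by Rellich's theorem (`isCompactOperator_dirichletFst`),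
compact. The min-max principle for compact operators (`finrank_le_finrank_spectralSpan`) gives the
claim. Rellich's theorem is proved by approximating the embedding by averages over small cells.

*The constants.* For fixed normalized `ψ` the best normalized potential is `ψ² / ‖ψ‖₄²`, by the
Cauchy-Schwarz inequality; thus `m = q` (`quarticValue`) if `n = 1`, and `m ≤ q` in general. The
Gagliardo-Nirenberg-Sobolev inequality in `L¹`, applied to `ψ²`, gives `q < ∞`, and separated bumps
in a well give `m > 0`. Optimising `‖ψ‖₄² - ‖∇ψ‖₂²` over the scaling of `ψ` identifies `4 q` with the
best constant in Ladyzhenskaya's inequality for test functions, which extends to `H¹(ℝ²)` by cut-off,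
mollification and Fatou's lemma (`isLeast_ladyzhenskayaConstants`).
-/

noncomputable section

namespace DirichletBox

/-! ### Compact symmetric operators -/

section Spectral
variable {H : Type*} [NormedAddCommGroup H] [InnerProductSpace ℝ H]

/-- The span of the eigenspaces of `A` to eigenvalues `β ∈ s`. -/
def spectralSpan (A : H →L[ℝ] H) (s : Set ℝ) : Submodule ℝ H :=
  ⨆ β ∈ s, Module.End.eigenspace (A : Module.End ℝ H) β

lemma mem_spectralSpan_iff {A : H →L[ℝ] H} {s : Set ℝ} {u : H} :
    u ∈ spectralSpan A s ↔ ∃ v : s →₀ H, (∀ β : s, A (v β) = (β : ℝ) • v β) ∧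
      v.sum (fun _ x => x) = u := by
  rw [spectralSpan, iSup_subtype', Submodule.mem_iSup_iff_exists_finsupp]
  simp

lemma inner_eigenvector_eq_zero {A : H →L[ℝ] H} (hA : A.IsSymmetric) {β γ : ℝ} (h : β ≠ γ)
    {u v : H} (hu : A u = β • u) (hv : A v = γ • v) : inner ℝ u v = 0 := by
  have h1 : inner ℝ (A u) v = inner ℝ u (A v) := hA u v
  rw [hu, hv, inner_smul_left, inner_smul_right] at h1
  exact (mul_eq_mul_right_iff.1 h1).resolve_left h

/-- Expansion of the quadratic form of `A` and of the norm along eigenvectors. -/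
lemma inner_map_sum_eigenvectors {A : H →L[ℝ] H} (hA : A.IsSymmetric) {s : Set ℝ}
    (v : s →₀ H) (hv : ∀ β : s, A (v β) = (β : ℝ) • v β) :
    inner ℝ (A (v.sum fun _ x => x)) (v.sum fun _ x => x) =
        ∑ β ∈ v.support, (β : ℝ) * ‖v β‖ ^ 2 ∧
      ‖v.sum fun _ x => x‖ ^ 2 = ∑ β ∈ v.support, ‖v β‖ ^ 2 := by
  have key : ∀ β ∈ v.support, inner ℝ (v β) (v.sum fun _ x => x) = ‖v β‖ ^ 2 := by
    intro β hβ
    rw [Finsupp.sum, inner_sum, Finset.sum_eq_single β]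
    · exact real_inner_self_eq_norm_sq _
    · intro γ _ hne
      exact inner_eigenvector_eq_zero hA (fun h => hne (Subtype.ext h.symm)) (hv β) (hv γ)
    · intro h; exact absurd hβ h
  constructor
  · conv_lhs => rw [Finsupp.sum, map_sum, sum_inner]
    refine Finset.sum_congr rfl fun β hβ => ?_
    rw [hv, inner_smul_left]
    have := key β hβ
    rw [Finsupp.sum] at this
    rw [this]; simp
  · rw [← real_inner_self_eq_norm_sq]
    conv_lhs => rw [Finsupp.sum, sum_inner]
    exact Finset.sum_congr rfl fun β hβ => key β hβ

lemma spectralSpan_form_ge {A : H →L[ℝ] H} (hA : A.IsSymmetric) {c : ℝ} {u : H}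
    (hu : u ∈ spectralSpan A (Ici c)) : c * ‖u‖ ^ 2 ≤ inner ℝ (A u) u := by
  obtain ⟨v, hv, rfl⟩ := mem_spectralSpan_iff.1 hu
  obtain ⟨h1, h2⟩ := inner_map_sum_eigenvectors hA v hv
  rw [h1, h2, Finset.mul_sum]
  exact Finset.sum_le_sum fun β _ => mul_le_mul_of_nonneg_right β.2 (sq_nonneg _)

lemma spectralSpan_form_le {A : H →L[ℝ] H} (hA : A.IsSymmetric) {c : ℝ} {u : H}
    (hu : u ∈ spectralSpan A (Iio c)) : inner ℝ (A u) u ≤ c * ‖u‖ ^ 2 := by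
  obtain ⟨v, hv, rfl⟩ := mem_spectralSpan_iff.1 hu
  obtain ⟨h1, h2⟩ := inner_map_sum_eigenvectors hA v hv
  rw [h1, h2, Finset.mul_sum]
  exact Finset.sum_le_sum fun β _ => mul_le_mul_of_nonneg_right β.2.le (sq_nonneg _)

lemma spectralSpan_invariant {A : H →L[ℝ] H} {s : Set ℝ} {u : H} (hu : u ∈ spectralSpan A s) :
    A u ∈ spectralSpan A s := by
  obtain ⟨v, hv, rfl⟩ := mem_spectralSpan_iff.1 hu
  rw [Finsupp.sum, map_sum]
  refine Submodule.sum_mem _ fun β _ => ?_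
  refine Submodule.mem_iSup_of_mem (β : ℝ) (Submodule.mem_iSup_of_mem β.2 ?_)
  rw [hv]
  exact Submodule.smul_mem _ _ (Module.End.mem_eigenspace_iff.2 (hv β))

variable [CompleteSpace H]

/-- A compact operator has only finitely many independent eigenvectors to eigenvalues `≥ c > 0`:
it is bounded below on the closure of their span. -/
lemma finiteDimensional_spectralSpan {A : H →L[ℝ] H} (hA : A.IsSymmetric)
    (hc : IsCompactOperator A) {c : ℝ} (hc0 : 0 < c) :
    FiniteDimensional ℝ (spectralSpan A (Ici c)) := by
  set K := (spectralSpan A (Ici c)).topologicalClosure with hK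
  have hcl : IsClosed (K : Set H) := Submodule.isClosed_topologicalClosure _
  -- The form bound passes to the closure, where it makes `A` bounded below.
  have hlow : ∀ u ∈ K, c * ‖u‖ ≤ ‖A u‖ := by
    intro u hu
    have h1 : c * ‖u‖ ^ 2 ≤ inner ℝ (A u) u := by
      have hcl' : IsClosed {u : H | c * ‖u‖ ^ 2 ≤ inner ℝ (A u) u} :=
        isClosed_le (by fun_prop) (by fun_prop)
      have : closure (spectralSpan A (Ici c) : Set H) ⊆ {u : H | c * ‖u‖ ^ 2 ≤ inner ℝ (A u) u} :=
        closure_minimal (fun u hu => spectralSpan_form_ge hA hu) hcl'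
      exact this hu
    have h2 := real_inner_le_norm (A u) u
    rcases eq_or_lt_of_le (norm_nonneg u) with h | h
    · rw [← h]; simp
    · nlinarith
  have hemb : IsClosedEmbedding (fun u : K => A u) := by
    have hL : AntilipschitzWith (c⁻¹).toNNReal (A ∘L K.subtypeL) := by
      refine ContinuousLinearMap.antilipschitz_of_bound _ fun u => ?_
      rw [Real.coe_toNNReal _ (inv_pos.2 hc0).le]
      have := hlow u u.2
      rw [inv_mul_eq_div, le_div_iff₀ hc0]
      simpa [mul_comm] using this
    have : CompleteSpace K := hcl.completeSpace_coe
    exact hL.isClosedEmbedding (A ∘L K.subtypeL).uniformContinuous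
  -- A compact operator that is a closed embedding on `K` makes the identity of `K` compact.
  have hK : FiniteDimensional ℝ K := by
    apply FiniteDimensional.of_isCompactOperator_id (𝕜 := ℝ)
    obtain ⟨C, hC, hn⟩ := hc
    refine ⟨_, hemb.isCompact_preimage hC, ?_⟩
    exact (K.subtypeL.continuous.tendsto' 0 0 rfl) hn
  exact Submodule.finiteDimensional_of_le (Submodule.le_topologicalClosure _)

/-- On the orthogonal complement of the eigenspaces to eigenvalues `≥ c`, the quadratic form of a
compact self-adjoint operator is at most `c`. -/
lemma form_le_of_mem_orthogonal {A : H →L[ℝ] H} (hA : A.IsSymmetric)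
    (hc : IsCompactOperator A) {c : ℝ} {u : H} (hu : u ∈ (spectralSpan A (Ici c))ᗮ) :
    inner ℝ (A u) u ≤ c * ‖u‖ ^ 2 := by
  set W := spectralSpan A (Iio c)
  have hW : W ≤ (spectralSpan A (Ici c))ᗮ := by
    refine iSup₂_le fun β hβ x hx => ?_
    rw [Submodule.mem_orthogonal]
    intro y hy
    obtain ⟨v, hv, rfl⟩ := mem_spectralSpan_iff.1 hy
    rw [Finsupp.sum, sum_inner]
    refine Finset.sum_eq_zero fun γ _ => ?_
    exact inner_eigenvector_eq_zero hA (ne_of_lt (lt_of_lt_of_le (mem_Iio.1 hβ) γ.2)).symm (hv γ)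
      (Module.End.mem_eigenspace_iff.1 hx)
  have hsup : spectralSpan A (Ici c) ⊔ W = ⨆ μ, Module.End.eigenspace (A : Module.End ℝ H) μ := by
    apply le_antisymm
    · refine sup_le ?_ ?_ <;> exact iSup₂_le fun β _ => le_iSup _ β
    · refine iSup_le fun β => ?_
      rcases le_or_gt c β with h | h
      · exact le_sup_of_le_left (le_iSup₂_of_le β h le_rfl)
      · exact le_sup_of_le_right (le_iSup₂_of_le β h le_rfl)
  have hbot : (spectralSpan A (Ici c) ⊔ W)ᗮ = ⊥ := by
    rw [hsup]; exact ContinuousLinearMap.orthogonalComplement_iSup_eigenspaces_eq_bot hc hA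
  have hmem : u ∈ W.topologicalClosure := by
    have hle : W.topologicalClosure ≤ (spectralSpan A (Ici c))ᗮ :=
      Submodule.topologicalClosure_minimal _ hW (Submodule.isClosed_orthogonal _)
    have : CompleteSpace W.topologicalClosure :=
      (Submodule.isClosed_topologicalClosure W).completeSpace_coe
    set p : H := W.topologicalClosure.starProjection u
    have hp : p ∈ W.topologicalClosure := Submodule.starProjection_apply_mem _ _
    have h1 : u - p ∈ (spectralSpan A (Ici c) ⊔ W)ᗮ := by
      rw [← Submodule.inf_orthogonal]
      refine ⟨Submodule.sub_mem _ hu (hle hp), ?_⟩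
      exact Submodule.orthogonal_le (Submodule.le_topologicalClosure W)
        (Submodule.sub_starProjection_mem_orthogonal u)
    rw [hbot, Submodule.mem_bot, sub_eq_zero] at h1
    rw [h1]; exact hp
  have hcl' : IsClosed {u : H | inner ℝ (A u) u ≤ c * ‖u‖ ^ 2} :=
    isClosed_le (by fun_prop) (by fun_prop)
  exact closure_minimal (fun u hu => spectralSpan_form_le hA hu) hcl' hmem

/-- Half of the min-max principle: a space on which the form of `A` is at least `d > c` meets the
orthogonal complement of the spectral span above `c` only in `0`. -/
lemma finrank_le_finrank_spectralSpan {A : H →L[ℝ] H} (hA : A.IsSymmetric)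
    (hc : IsCompactOperator A) {c d : ℝ} (hc0 : 0 < c) (hcd : c < d) (F : Submodule ℝ H)
    [FiniteDimensional ℝ F] (hF : ∀ u ∈ F, d * ‖u‖ ^ 2 ≤ inner ℝ (A u) u) :
    Module.finrank ℝ F ≤ Module.finrank ℝ (spectralSpan A (Ici c)) := by
  by_contra! hlt
  have := finiteDimensional_spectralSpan hA hc hc0
  set U := spectralSpan A (Ici c)
  obtain ⟨u, hu, hu0⟩ := (Submodule.ne_bot_iff _).1
    (LinearMap.ker_ne_bot_of_finrank_lt (f := (U.orthogonalProjectionOnto ∘L F.subtypeL).toLinearMap)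
      hlt)
  have h1 : (u : H) ∈ Uᗮ := by
    rw [← Submodule.ker_orthogonalProjectionOnto]
    simpa using hu
  have h2 := form_le_of_mem_orthogonal hA hc h1
  have h3 := hF u u.2
  have : 0 < ‖(u : H)‖ := norm_pos_iff.2 (by simpa using hu0)
  nlinarith [pow_pos this 2]

lemma finite_eigenvalues_ge {A : H →L[ℝ] H} (hA : A.IsSymmetric)
    (hc : IsCompactOperator A) {c : ℝ} (hc0 : 0 < c) :
    {β | c ≤ β ∧ ∃ u : H, u ≠ 0 ∧ A u = β • u}.Finite := by
  have := finiteDimensional_spectralSpan hA hc hc0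
  set U := spectralSpan A (Ici c)
  let B : Module.End ℝ U := (A : H →ₗ[ℝ] H).restrict fun u hu => spectralSpan_invariant hu
  refine (Module.End.finite_hasEigenvalue B).subset ?_
  rintro β ⟨hβ, u, hu0, hu⟩
  have hmem : u ∈ U := Submodule.mem_iSup_of_mem β (Submodule.mem_iSup_of_mem hβ
    (Module.End.mem_eigenspace_iff.2 hu))
  refine Module.End.hasEigenvalue_of_hasEigenvector (x := (⟨u, hmem⟩ : U)) ⟨?_, ?_⟩
  · rw [Module.End.mem_eigenspace_iff]; exact Subtype.ext hu
  · simpa using hu0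

end Spectral

/-! ### Test functions and trial spaces -/

section Tests

lemma finrank_plane : Module.finrank ℝ Plane = 2 := by simp

namespace IsTest
variable {φ ψ : Plane → ℝ}

lemma continuous (h : IsTest φ) : Continuous φ := h.1.continuous

lemma differentiable (h : IsTest φ) : Differentiable ℝ φ := h.1.differentiable (by simp)

lemma zero : IsTest (0 : Plane → ℝ) := ⟨contDiff_const, HasCompactSupport.zero⟩

lemma add (h : IsTest φ) (h' : IsTest ψ) : IsTest (φ + ψ) := ⟨h.1.add h'.1, h.2.add h'.2⟩

lemma smul (c : ℝ) (h : IsTest φ) : IsTest (c • φ) :=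
  ⟨contDiff_const.smul h.1, h.2.smul_left (f := fun _ => c)⟩

lemma mul (h : IsTest φ) (h' : IsTest ψ) : IsTest (φ * ψ) := ⟨h.1.mul h'.1, h.2.mul_right⟩

lemma sum {ι : Type*} {s : Finset ι} {f : ι → Plane → ℝ} (h : ∀ i ∈ s, IsTest (f i)) :
    IsTest (∑ i ∈ s, f i) := by
  classical
  induction s using Finset.induction_on with
  | empty => simpa using zero
  | insert a s ha ih =>
    rw [Finset.sum_insert ha]
    exact (h a (Finset.mem_insert_self _ _)).add
      (ih fun i hi => h i (Finset.mem_insert_of_mem hi))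

lemma continuous_gradient (h : IsTest φ) : Continuous (gradient φ) := by
  have : Continuous (fderiv ℝ φ) := h.1.continuous_fderiv (by simp)
  exact (InnerProductSpace.toDual ℝ Plane).symm.continuous.comp this

lemma hasCompactSupport_gradient (h : IsTest φ) : HasCompactSupport (gradient φ) :=
  (h.2.fderiv ℝ).comp_left (g := (InnerProductSpace.toDual ℝ Plane).symm) (map_zero _)

lemma memLp (h : IsTest φ) (p : ℝ≥0∞) (μ : Measure Plane) [IsFiniteMeasureOnCompacts μ] :
    MemLp φ p μ := h.continuous.memLp_of_hasCompactSupport h.2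

lemma memLp_gradient (h : IsTest φ) (p : ℝ≥0∞) (μ : Measure Plane)
    [IsFiniteMeasureOnCompacts μ] : MemLp (gradient φ) p μ :=
  h.continuous_gradient.memLp_of_hasCompactSupport h.hasCompactSupport_gradient

lemma integrable (h : IsTest φ) : Integrable φ :=
  h.continuous.integrable_of_hasCompactSupport h.2

lemma integrable_sq (h : IsTest φ) : Integrable (fun x => φ x ^ 2) := by
  simpa [pow_two] using! (h.mul h).integrable

lemma integrable_gradient_sq (h : IsTest φ) : Integrable (fun x => ‖gradient φ x‖ ^ 2) :=
  (h.memLp_gradient 2 volume).integrable_norm_pow (by norm_num)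

lemma integrable_mul_sq (h : IsTest φ) {V : Plane → ℝ} (hV : IsTest V) :
    Integrable (fun x => V x * φ x ^ 2) := by
  simpa [pow_two] using! (hV.mul (h.mul h)).integrable

lemma eq_zero_of_integral_sq (h : IsTest φ) (h0 : ∫ x, φ x ^ 2 = 0) : φ = 0 := by
  have h1 := (integral_eq_zero_iff_of_nonneg (fun x => sq_nonneg (φ x)) h.integrable_sq).1 h0
  have h2 : (fun x => φ x ^ 2) = fun _ => 0 :=
    (h.continuous.pow 2).ae_eq_iff_eq volume continuous_const |>.1 h1
  funext x
  simpa using congrFun h2 x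

lemma comp_affine (h : IsTest φ) {t : ℝ} (ht : t ≠ 0) (b : Plane) :
    IsTest (fun x => φ (t • x + b)) :=
  ⟨h.1.comp (by fun_prop : ContDiff ℝ ∞ fun x : Plane => t • x + b),
    h.2.comp_homeomorph ((Homeomorph.smulOfNeZero t ht).trans (Homeomorph.addRight b))⟩

end IsTest

lemma gradient_add {φ ψ : Plane → ℝ} (h : Differentiable ℝ φ) (h' : Differentiable ℝ ψ)
    (x : Plane) : gradient (φ + ψ) x = gradient φ x + gradient ψ x := by
  simp [gradient, fderiv_add (h x) (h' x)]

lemma gradient_smul {φ : Plane → ℝ} (c : ℝ) (h : Differentiable ℝ φ) (x : Plane) :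
    gradient (c • φ) x = c • gradient φ x := by
  simp [gradient, fderiv_const_smul (h x)]

lemma gradient_mul {φ ψ : Plane → ℝ} (h : Differentiable ℝ φ) (h' : Differentiable ℝ ψ)
    (x : Plane) : gradient (φ * ψ) x = φ x • gradient ψ x + ψ x • gradient φ x := by
  simp [gradient, fderiv_mul (h x) (h' x)]

lemma gradient_sum {ι : Type*} {s : Finset ι} {f : ι → Plane → ℝ} (h : ∀ i ∈ s, IsTest (f i))
    (x : Plane) : gradient (∑ i ∈ s, f i) x = ∑ i ∈ s, gradient (f i) x := by
  simp [gradient, fderiv_sum fun i hi => (h i hi).differentiable x]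

lemma gradient_comp_affine {φ : Plane → ℝ} (h : Differentiable ℝ φ) (t : ℝ) (b x : Plane) :
    gradient (fun x => φ (t • x + b)) x = t • gradient φ (t • x + b) := by
  have h1 : HasFDerivAt (fun x : Plane => t • x + b) (t • ContinuousLinearMap.id ℝ Plane) x :=
    ((hasFDerivAt_id x).const_smul t).add_const b
  have h2 := (h (t • x + b)).hasFDerivAt.comp x h1
  rw [gradient, show (fun x => φ (t • x + b)) = φ ∘ fun x => t • x + b from rfl, h2.fderiv]
  simp [gradient]

lemma integral_comp_affine {E : Type*} [NormedAddCommGroup E] [NormedSpace ℝ E]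
    (f : Plane → E) {t : ℝ} (ht : 0 < t) (b : Plane) :
    ∫ x, f (t • x + b) = (t ^ 2)⁻¹ • ∫ x, f x := by
  rw [Measure.integral_comp_smul_of_nonneg volume (fun y => f (y + b)) t (hR := ht.le),
    integral_add_right_eq_self f b, finrank_plane]

/-- The quadratic form `∫ -|∇ψ|² + V ψ²` of `Δ + V`. -/
def energy (V ψ : Plane → ℝ) : ℝ := ∫ x, (-‖gradient ψ x‖ ^ 2 + V x * ψ x ^ 2)

lemma energy_eq {V ψ : Plane → ℝ} (hV : IsTest V) (hψ : IsTest ψ) :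
    energy V ψ = (∫ x, V x * ψ x ^ 2) - ∫ x, ‖gradient ψ x‖ ^ 2 := by
  rw [energy, integral_add hψ.integrable_gradient_sq.fun_neg (hψ.integrable_mul_sq hV),
    integral_neg]
  ring

lemma energy_smul {V ψ : Plane → ℝ} (c : ℝ) (hψ : IsTest ψ) :
    energy V (c • ψ) = c ^ 2 * energy V ψ := by
  rw [energy, energy, ← integral_const_mul]
  congr 1 with x
  rw [gradient_smul c hψ.differentiable, norm_smul, mul_pow, Real.norm_eq_abs, sq_abs]
  simp only [Pi.smul_apply, smul_eq_mul]
  ring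

lemma integral_sq_smul (c : ℝ) (ψ : Plane → ℝ) :
    ∫ x, (c • ψ) x ^ 2 = c ^ 2 * ∫ x, ψ x ^ 2 := by
  rw [← integral_const_mul]
  simp only [Pi.smul_apply, smul_eq_mul, mul_pow]

/-- `V` is a test potential with `‖V‖₂² ≤ B`, and `F` is an `n`-dimensional space of test functions
on which the form of `Δ + V` is at least `μ`. -/
structure TrialSpace (n : ℕ) (V : Plane → ℝ) (F : Submodule ℝ (Plane → ℝ)) (B μ : ℝ) : Prop where
  isTest_potential : IsTest V
  integral_sq_le : ∫ x, V x ^ 2 ≤ B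
  isTest : ∀ ψ ∈ F, IsTest ψ
  rank_eq : Module.rank ℝ F = n
  le_energy : ∀ ψ ∈ F, μ * ∫ x, ψ x ^ 2 ≤ energy V ψ

/-- Covariance under `x ↦ t x + b`: potentials transform as `V ↦ t² V(t x + b)`, which in two
dimensions multiplies `‖V‖₂²`, and the eigenvalues, by `t²`. -/
lemma TrialSpace.comp_affine {n : ℕ} {V : Plane → ℝ} {F : Submodule ℝ (Plane → ℝ)} {B μ : ℝ}
    (h : TrialSpace n V F B μ) {t : ℝ} (ht : 0 < t) (b : Plane) :
    TrialSpace n (fun x => t ^ 2 * V (t • x + b))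
      (F.map (LinearMap.funLeft ℝ ℝ fun x => t • x + b)) (t ^ 2 * B) (t ^ 2 * μ) where
  isTest_potential := (h.isTest_potential.comp_affine ht.ne' b).smul (t ^ 2)
  integral_sq_le := by
    have := integral_comp_affine (fun x => V x ^ 2) ht b
    simp_rw [mul_pow, integral_const_mul, this, smul_eq_mul]
    have h1 := h.integral_sq_le
    have : (t ^ 2) ^ 2 * ((t ^ 2)⁻¹ * ∫ x, V x ^ 2) = t ^ 2 * ∫ x, V x ^ 2 := by
      field_simp
    rw [this]
    gcongr
  isTest := by
    rintro _ ⟨ψ, hψ, rfl⟩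
    exact (h.isTest ψ hψ).comp_affine ht.ne' b
  rank_eq := by
    rw [rank_map_eq, h.rank_eq]
    apply LinearMap.funLeft_injective_of_surjective
    intro y
    exact ⟨t⁻¹ • (y - b), by simp [smul_smul, ht.ne']⟩
  le_energy := by
    rintro _ ⟨ψ, hψ, rfl⟩
    have hd := (h.isTest ψ hψ).differentiable
    have h1 := integral_comp_affine (fun x => ψ x ^ 2) ht b
    have h2 := integral_comp_affine (fun x => t ^ 2 * (-‖gradient ψ x‖ ^ 2 + V x * ψ x ^ 2)) ht b
    have h3 : energy (fun x => t ^ 2 * V (t • x + b))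
        (LinearMap.funLeft ℝ ℝ (fun x : Plane => t • x + b) ψ) = energy V ψ := by
      rw [integral_const_mul (t ^ 2) fun x => -‖gradient ψ x‖ ^ 2 + V x * ψ x ^ 2, smul_eq_mul,
        inv_mul_cancel_left₀ (by positivity)] at h2
      rw [energy, energy, ← h2]
      congr 1 with x
      have : gradient (LinearMap.funLeft ℝ ℝ (fun x : Plane => t • x + b) ψ) x =
        t • gradient ψ (t • x + b) := gradient_comp_affine hd t b x
      rw [this, norm_smul, mul_pow, Real.norm_eq_abs, sq_abs]
      simp only [LinearMap.funLeft_apply]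
      ring
    rw [h3]
    simp only [LinearMap.funLeft_apply]
    rw [h1, smul_eq_mul]
    have : t ^ 2 * μ * ((t ^ 2)⁻¹ * ∫ x, ψ x ^ 2) = μ * ∫ x, ψ x ^ 2 := by
      field_simp
    rw [this]
    exact h.le_energy ψ hψ

/-- Rescaling normalizes the potential; this divides the level by `B`. -/
lemma TrialSpace.div_le_maxMinValue {n : ℕ} {V : Plane → ℝ} {F : Submodule ℝ (Plane → ℝ)}
    {B μ : ℝ} (h : TrialSpace n V F B μ) (hB : 0 < B) : ((μ / B : ℝ) : EReal) ≤ maxMinValue n := by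
  have ht : 0 < (√B)⁻¹ := inv_pos.2 (Real.sqrt_pos.2 hB)
  have h' := h.comp_affine ht 0
  have hsq : ((√B)⁻¹) ^ 2 = B⁻¹ := by rw [inv_pow, Real.sq_sqrt hB.le]
  rw [hsq, inv_mul_cancel₀ hB.ne'] at h'
  refine le_iSup₂_of_le _ ⟨h'.isTest_potential, h'.integral_sq_le⟩
    (le_iSup₂_of_le _ ⟨h'.isTest, h'.rank_eq⟩ (le_iInf₂ fun ψ hψ => ?_))
  have := h'.le_energy ψ hψ.1
  rw [hψ.2, mul_one, inv_mul_eq_div] at this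
  exact EReal.coe_le_coe_iff.2 this

/-- The bound on normalized `ψ` in the definition of `maxMinValue` extends to all `ψ` by
homogeneity. -/
lemma exists_trialSpace_of_lt_maxMinValue {n : ℕ} {a : ℝ} (ha : (a : EReal) < maxMinValue n) :
    ∃ V F, TrialSpace n V F 1 a := by
  obtain ⟨V, hV⟩ := lt_iSup_iff.1 ha
  obtain ⟨hV1, hV⟩ := lt_iSup_iff.1 hV
  obtain ⟨F, hF⟩ := lt_iSup_iff.1 hV
  obtain ⟨hF1, hF⟩ := lt_iSup_iff.1 hF
  refine ⟨V, F, hV1.1, hV1.2, hF1.1, hF1.2, fun ψ hψ => ?_⟩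
  have hψt := hF1.1 ψ hψ
  rcases eq_or_lt_of_le (integral_nonneg fun x => sq_nonneg (ψ x) : 0 ≤ ∫ x, ψ x ^ 2) with h0 | h0
  · have : ψ = 0 := hψt.eq_zero_of_integral_sq h0.symm
    subst this
    simp [energy, gradient]
  set s := ∫ x, ψ x ^ 2 with hs
  set c := (√s)⁻¹ with hc
  have hc2 : c ^ 2 = s⁻¹ := by rw [hc, inv_pow, Real.sq_sqrt h0.le]
  have h1 : ∫ x, (c • ψ) x ^ 2 = 1 := by
    rw [integral_sq_smul, hc2, inv_mul_cancel₀ h0.ne']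
  have h2 : energy V (c • ψ) = s⁻¹ * energy V ψ := by
    rw [energy_smul c hψt, hc2]
  have h3 := (lt_of_lt_of_le hF (iInf₂_le (c • ψ) ⟨F.smul_mem c hψ, h1⟩)).le
  have h4 : a ≤ energy V (c • ψ) := EReal.coe_le_coe_iff.1 h3
  rw [h2, inv_mul_eq_div, le_div_iff₀ h0] at h4
  exact h4

end Tests

/-! ### Families of test functions, positivity of the max-min value -/

section Families

/-- The symmetric bilinear form of `Δ + V` on test functions. -/
def energyForm (V φ ψ : Plane → ℝ) : ℝ :=
  ∫ x, (-inner ℝ (gradient φ x) (gradient ψ x) + V x * (φ x * ψ x))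

variable {n : ℕ} {e : Fin n → Plane → ℝ}

lemma IsTest.integrable_inner_gradient {φ ψ : Plane → ℝ} (hφ : IsTest φ) (hψ : IsTest ψ) :
    Integrable (fun x => inner ℝ (gradient φ x) (gradient ψ x)) :=
  (hφ.continuous_gradient.inner hψ.continuous_gradient).integrable_of_hasCompactSupport
    (hφ.hasCompactSupport_gradient.mono fun x hx => by
      contrapose! hx
      simp only [Function.mem_support, not_not] at hx ⊢
      rw [hx, inner_zero_left])

lemma IsTest.integrable_energyForm {V φ ψ : Plane → ℝ} (hV : IsTest V) (hφ : IsTest φ)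
    (hψ : IsTest ψ) :
    Integrable (fun x => -inner ℝ (gradient φ x) (gradient ψ x) + V x * (φ x * ψ x)) :=
  (hφ.integrable_inner_gradient hψ).fun_neg.add (hV.mul (hφ.mul hψ)).integrable

lemma isTest_linearCombination (he : ∀ i, IsTest (e i)) (a : Fin n → ℝ) :
    IsTest (∑ i, a i • e i) := IsTest.sum fun i _ => (he i).smul _

lemma integral_sq_linearCombination (he : ∀ i, IsTest (e i)) (a : Fin n → ℝ) :
    ∫ x, (∑ i, a i • e i) x ^ 2 = ∑ i, ∑ j, a i * a j * ∫ x, e i x * e j x := by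
  have h : ∀ x, (∑ i, a i • e i) x ^ 2 = ∑ i, ∑ j, a i * a j * (e i x * e j x) := by
    intro x
    simp only [Finset.sum_apply, Pi.smul_apply, smul_eq_mul, pow_two, Finset.sum_mul_sum]
    exact Finset.sum_congr rfl fun i _ => Finset.sum_congr rfl fun j _ => by ring
  have hi : ∀ i j, Integrable (fun x => a i * a j * (e i x * e j x)) := fun i j =>
    ((he i).mul (he j)).integrable.const_mul _
  simp_rw [h]
  rw [integral_finsetSum _ fun i _ => integrable_finsetSum _ fun j _ => hi i j]
  refine Finset.sum_congr rfl fun i _ => ?_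
  rw [integral_finsetSum _ fun j _ => hi i j]
  exact Finset.sum_congr rfl fun j _ => integral_const_mul _ _

lemma energy_linearCombination {V : Plane → ℝ} (hV : IsTest V) (he : ∀ i, IsTest (e i))
    (a : Fin n → ℝ) :
    energy V (∑ i, a i • e i) = ∑ i, ∑ j, a i * a j * energyForm V (e i) (e j) := by
  have hg : ∀ x, gradient (∑ i, a i • e i) x = ∑ i, a i • gradient (e i) x := by
    intro x
    rw [gradient_sum fun i _ => (he i).smul _]
    exact Finset.sum_congr rfl fun i _ => gradient_smul _ (he i).differentiable x
  have h : ∀ x, -‖gradient (∑ i, a i • e i) x‖ ^ 2 + V x * (∑ i, a i • e i) x ^ 2 =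
      ∑ i, ∑ j, a i * a j *
        (-inner ℝ (gradient (e i) x) (gradient (e j) x) + V x * (e i x * e j x)) := by
    intro x
    rw [hg, ← real_inner_self_eq_norm_sq, sum_inner]
    have h2 : (∑ i, a i • e i) x ^ 2 = ∑ i, ∑ j, a i * e i x * (a j * e j x) := by
      simp only [Finset.sum_apply, Pi.smul_apply, smul_eq_mul, pow_two, Finset.sum_mul_sum]
    rw [h2]
    simp only [inner_sum, inner_smul_left, inner_smul_right, Finset.mul_sum,
      ← Finset.sum_neg_distrib, ← Finset.sum_add_distrib, conj_trivial]
    exact Finset.sum_congr rfl fun i _ => Finset.sum_congr rfl fun j _ => by ring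
  have hi : ∀ i j, Integrable (fun x => a i * a j *
      (-inner ℝ (gradient (e i) x) (gradient (e j) x) + V x * (e i x * e j x))) := fun i j =>
    (hV.integrable_energyForm (he i) (he j)).const_mul _
  rw [energy]
  simp_rw [h]
  rw [integral_finsetSum _ fun i _ => integrable_finsetSum _ fun j _ => hi i j]
  refine Finset.sum_congr rfl fun i _ => ?_
  rw [integral_finsetSum _ fun j _ => hi i j]
  exact Finset.sum_congr rfl fun j _ => integral_const_mul _ _

/-- The span of `n` test functions is a trial space if the two forms, written in the coefficients,
satisfy the bounds; positivity of the `L²` form gives linear independence. -/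
lemma trialSpace_span {V : Plane → ℝ} (hV : IsTest V) {B μ : ℝ} (hB : ∫ x, V x ^ 2 ≤ B)
    (he : ∀ i, IsTest (e i))
    (hpos : ∀ a : Fin n → ℝ, a ≠ 0 → 0 < ∫ x, (∑ i, a i • e i) x ^ 2)
    (hle : ∀ a : Fin n → ℝ, μ * ∫ x, (∑ i, a i • e i) x ^ 2 ≤ energy V (∑ i, a i • e i)) :
    TrialSpace n V (Submodule.span ℝ (range e)) B μ where
  isTest_potential := hV
  integral_sq_le := hB
  isTest ψ hψ := by
    obtain ⟨a, rfl⟩ := (Submodule.mem_span_range_iff_exists_fun ℝ).1 hψ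
    exact isTest_linearCombination he a
  rank_eq := by
    have hli : LinearIndependent ℝ e := by
      rw [Fintype.linearIndependent_iff]
      intro a ha
      by_contra hne
      have := hpos a (fun h => hne fun i => by simp [h])
      rw [ha] at this
      simp at this
    rw [rank_span hli, Cardinal.mk_range_eq e hli.injective]
    simp
  le_energy ψ hψ := by
    obtain ⟨a, rfl⟩ := (Submodule.mem_span_range_iff_exists_fun ℝ).1 hψ
    exact hle a

/-- Many widely separated bumps inside a deep well give trial spaces of every dimension with
positive form. -/
lemma exists_trialSpace_pos (n : ℕ) :
    ∃ V F B, 0 < B ∧ TrialSpace n V F B 1 := by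
  -- Bumps of radius `2` at distance `5` from each other, with gradients of disjoint support as well.
  let φ : ContDiffBump (0 : Plane) := ⟨1, 2, by norm_num, by norm_num⟩
  have hφ : IsTest φ := ⟨φ.contDiff, φ.hasCompactSupport⟩
  let v : Plane := EuclideanSpace.single 0 1
  have hv : ‖v‖ = 1 := by simp [v]
  let e : Fin n → Plane → ℝ := fun i x => φ ((1 : ℝ) • x + -((5 * (i : ℝ)) • v))
  have he : ∀ i, IsTest (e i) := fun i => hφ.comp_affine one_ne_zero _
  have hsupp : ∀ i x, e i x ≠ 0 → ‖x - (5 * (i : ℝ)) • v‖ < 2 := by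
    intro i x hx
    have : ((1 : ℝ) • x + -((5 * (i : ℝ)) • v)) ∈ Function.support φ := hx
    rw [φ.support_eq] at this
    simpa [sub_eq_add_neg] using this
  have hgsupp : ∀ i x, gradient (e i) x ≠ 0 → ‖x - (5 * (i : ℝ)) • v‖ ≤ 2 := by
    intro i x hx
    have hx' : fderiv ℝ (e i) x ≠ 0 := fun h => hx (by simp [gradient, h])
    have h1 : x ∈ tsupport (e i) := tsupport_fderiv_subset ℝ (subset_tsupport _ hx')
    have h2 : tsupport (e i) ⊆ {x | ‖x - (5 * (i : ℝ)) • v‖ ≤ 2} :=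
      closure_minimal (fun y hy => (hsupp i y hy).le) (isClosed_le (by fun_prop) (by fun_prop))
    exact h2 h1
  have hsep : ∀ i j : Fin n, i ≠ j → ∀ x, ‖x - (5 * (i : ℝ)) • v‖ ≤ 2 →
      ‖x - (5 * (j : ℝ)) • v‖ ≤ 2 → False := by
    intro i j hij x h1 h2
    have h3 : ‖(5 * (i : ℝ)) • v - (5 * (j : ℝ)) • v‖ ≤ 4 := by
      calc _ = ‖(x - (5 * (j : ℝ)) • v) - (x - (5 * (i : ℝ)) • v)‖ := by congr 1; abel
        _ ≤ _ := norm_sub_le _ _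
        _ ≤ 4 := by linarith
    rw [← sub_smul, norm_smul, hv, mul_one, Real.norm_eq_abs, ← mul_sub, abs_mul] at h3
    have h4 : (1 : ℝ) ≤ |(i : ℝ) - j| := by
      have : (1 : ℤ) ≤ |(i : ℤ) - j| := Int.one_le_abs (by
        rw [sub_ne_zero]; exact_mod_cast fun h => hij (Fin.ext h))
      exact_mod_cast this
    rw [abs_of_pos (by norm_num : (0 : ℝ) < 5)] at h3
    linarith
  -- A cut-off equal to `1` on the union of the bumps.
  let W : ContDiffBump (0 : Plane) :=
    ⟨5 * n + 2, 5 * n + 3, by positivity, by linarith⟩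
  have hW : IsTest W := ⟨W.contDiff, W.hasCompactSupport⟩
  have hW1 : ∀ i x, W x * (e i x) = e i x := by
    intro i x
    rcases eq_or_ne (e i x) 0 with h | h
    · rw [h, mul_zero]
    · rw [W.one_of_mem_closedBall, one_mul]
      rw [mem_closedBall_zero_iff]
      have h1 := (hsupp i x h).le
      have h2 : ‖(5 * (i : ℝ)) • v‖ ≤ 5 * n := by
        rw [norm_smul, hv, mul_one, Real.norm_of_nonneg (by positivity)]
        have : (i : ℝ) ≤ n := by exact_mod_cast i.2.le
        linarith
      calc ‖x‖ = ‖(x - (5 * (i : ℝ)) • v) + (5 * (i : ℝ)) • v‖ := by rw [sub_add_cancel]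
        _ ≤ _ := norm_add_le _ _
        _ ≤ 5 * n + 2 := by linarith
  set M := ∫ x, φ x ^ 2 with hM
  set G := ∫ x, ‖gradient φ x‖ ^ 2 with hG
  have hMpos : 0 < M := by
    rcases eq_or_lt_of_le (integral_nonneg fun x => sq_nonneg (φ x) : 0 ≤ M) with h | h
    · have h0 := congrFun (hφ.eq_zero_of_integral_sq h.symm) 0
      rw [φ.one_of_mem_closedBall (by simp [φ])] at h0
      simp at h0
    · exact h
  have hM1 : ∀ i, ∫ x, e i x * e i x = M := by
    intro i
    have := integral_comp_affine (fun x => φ x ^ 2) one_pos (-((5 * (i : ℝ)) • v))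
    simpa [e, pow_two, M] using this
  have hM0 : ∀ i j, i ≠ j → ∀ x, e i x * e j x = 0 := by
    intro i j hij x
    by_contra h
    exact hsep i j hij x (hsupp i x (left_ne_zero_of_mul h)).le
      (hsupp j x (right_ne_zero_of_mul h)).le
  have hG1 : ∀ i, ∫ x, ‖gradient (e i) x‖ ^ 2 = G := by
    intro i
    have := integral_comp_affine (fun x => ‖gradient φ x‖ ^ 2) one_pos (-((5 * (i : ℝ)) • v))
    rw [one_pow, inv_one, one_smul] at this
    rw [hG, ← this]
    congr 1 with x
    rw [gradient_comp_affine hφ.differentiable, one_smul]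
  have hG0 : ∀ i j, i ≠ j → ∀ x, inner ℝ (gradient (e i) x) (gradient (e j) x) = 0 := by
    intro i j hij x
    by_contra h
    refine hsep i j hij x (hgsupp i x fun h0 => h ?_) (hgsupp j x fun h0 => h ?_)
    · rw [h0, inner_zero_left]
    · rw [h0, inner_zero_right]
  -- The depth `c` of the well is chosen so that `c M - G = M`.
  set c := G / M + 1 with hc
  have hmass : ∀ a : Fin n → ℝ, ∫ x, (∑ i, a i • e i) x ^ 2 = ∑ i, a i ^ 2 * M := by
    intro a
    rw [integral_sq_linearCombination he]
    refine Finset.sum_congr rfl fun i _ => ?_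
    rw [Finset.sum_eq_single i, hM1, pow_two]
    · intro j _ hj
      simp [hM0 i j hj.symm]
    · simp
  have hVt : IsTest (c • (W : Plane → ℝ)) := hW.smul c
  have hcM : c * M - G = M := by rw [hc]; field_simp; ring
  have henergy : ∀ a : Fin n → ℝ,
      energy (c • (W : Plane → ℝ)) (∑ i, a i • e i) = ∑ i, a i ^ 2 * M := by
    intro a
    have hval : ∀ i j, energyForm (c • (W : Plane → ℝ)) (e i) (e j) =
        c * (∫ x, e i x * e j x) - ∫ x, inner ℝ (gradient (e i) x) (gradient (e j) x) := by
      intro i j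
      have h1 : ∀ x, -inner ℝ (gradient (e i) x) (gradient (e j) x) +
          (c • (W : Plane → ℝ)) x * (e i x * e j x) =
          c * (e i x * e j x) - inner ℝ (gradient (e i) x) (gradient (e j) x) := by
        intro x
        rw [Pi.smul_apply, smul_eq_mul]
        linear_combination c * e j x * hW1 i x
      have h3 : Integrable (fun x => c * (e i x * e j x)) :=
        ((he i).mul (he j)).integrable.const_mul c
      rw [energyForm]
      simp_rw [h1]
      rw [integral_sub h3 ((he i).integrable_inner_gradient (he j)), ← integral_const_mul]
    rw [energy_linearCombination hVt he]
    refine Finset.sum_congr rfl fun i _ => ?_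
    rw [Finset.sum_eq_single i]
    · rw [hval, hM1, pow_two]
      simp_rw [real_inner_self_eq_norm_sq, hG1, hcM]
    · intro j _ hj
      rw [hval]
      simp [hM0 i j hj.symm, hG0 i j hj.symm]
    · simp
  refine ⟨c • (W : Plane → ℝ), _, (∫ x, (c • (W : Plane → ℝ)) x ^ 2) + 1, ?_,
    trialSpace_span hVt (by linarith) he ?_ ?_⟩
  · have : 0 ≤ ∫ x, (c • (W : Plane → ℝ)) x ^ 2 := integral_nonneg fun x => sq_nonneg _
    linarith
  · intro a ha
    rw [hmass]
    obtain ⟨i, hi⟩ := Function.ne_iff.1 ha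
    refine Finset.sum_pos' (fun i _ => by positivity) ⟨i, Finset.mem_univ i, ?_⟩
    have : a i ≠ 0 := hi
    positivity
  · intro a
    rw [hmass, henergy, one_mul]

lemma maxMinValue_pos (n : ℕ) : 0 < maxMinValue n := by
  obtain ⟨V, F, B, hB, h⟩ := exists_trialSpace_pos n
  refine lt_of_lt_of_le ?_ (h.div_le_maxMinValue hB)
  exact_mod_cast one_div_pos.2 hB

end Families

/-! ### The quartic functional -/

section Quartic

/-- The Cauchy-Schwarz inequality for square-integrable functions. -/
lemma sq_integral_mul_le {α : Type*} [MeasurableSpace α] {μ : Measure α} {f g : α → ℝ}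
    (hf : MemLp f 2 μ) (hg : MemLp g 2 μ) :
    (∫ x, f x * g x ∂μ) ^ 2 ≤ (∫ x, f x ^ 2 ∂μ) * ∫ x, g x ^ 2 ∂μ := by
  have key : ∀ {u v : α → ℝ} (hu : MemLp u 2 μ) (hv : MemLp v 2 μ),
      inner ℝ hu.toLp hv.toLp = ∫ x, u x * v x ∂μ := by
    intro u v hu hv
    rw [L2.inner_def]
    refine integral_congr_ae ?_
    filter_upwards [hu.coeFn_toLp, hv.coeFn_toLp] with x h1 h2
    rw [h1, h2]
    simp [mul_comm]
  have h := real_inner_mul_inner_self_le (hf.toLp) (hg.toLp)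
  rw [key, key, key] at h
  simpa only [pow_two] using h

/-- Ladyzhenskaya's inequality with some constant: the Gagliardo-Nirenberg-Sobolev inequality
`‖u‖₂ ≤ C ‖∇u‖₁` for `u = ψ²`. -/
lemma exists_ladyzhenskaya_const : ∃ C : ℝ, 0 < C ∧ ∀ ψ : Plane → ℝ, IsTest ψ →
    ∫ x, ψ x ^ 4 ≤ C * (∫ x, ‖gradient ψ x‖ ^ 2) * ∫ x, ψ x ^ 2 := by
  have hp : Real.HolderConjugate (Module.finrank ℝ Plane) 2 := by
    rw [finrank_plane]; exact Real.HolderConjugate.two_two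
  set C := lintegralPowLePowLIntegralFDerivConst (volume : Measure Plane) 2 with hC
  refine ⟨4 * C + 1, by positivity, fun ψ hψ => ?_⟩
  have hsq := hψ.mul hψ
  have h := lintegral_pow_le_pow_lintegral_fderiv (volume : Measure Plane)
    (hsq.1.of_le (by simp)) hsq.2 hp
  have hnorm : ∀ x, ‖fderiv ℝ (ψ * ψ) x‖ = 2 * (|ψ x| * ‖gradient ψ x‖) := by
    intro x
    have h1 : ‖fderiv ℝ (ψ * ψ) x‖ = ‖gradient (ψ * ψ) x‖ := by simp [gradient]
    rw [h1, gradient_mul hψ.differentiable hψ.differentiable, ← two_smul ℝ, norm_smul, norm_smul,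
      Real.norm_eq_abs, Real.norm_eq_abs, abs_two]
  have hi : Integrable (fun x => 2 * (|ψ x| * ‖gradient ψ x‖)) := by
    simp_rw [← hnorm]
    exact ((hsq.1.continuous_fderiv (by simp)).integrable_of_hasCompactSupport
      (hsq.2.fderiv ℝ)).norm
  have h1 : ∫⁻ x, ‖fderiv ℝ (ψ * ψ) x‖ₑ = ENNReal.ofReal (∫ x, 2 * (|ψ x| * ‖gradient ψ x‖)) := by
    rw [ofReal_integral_eq_lintegral_ofReal hi (ae_of_all _ fun x => by positivity)]
    refine lintegral_congr fun x => ?_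
    rw [← hnorm, ofReal_norm]
  have h2 : ∫⁻ x, ‖(ψ * ψ) x‖ₑ ^ (2 : ℝ) = ENNReal.ofReal (∫ x, ψ x ^ 4) := by
    have h4 : Integrable (fun x => ψ x ^ 4) := by
      refine (hsq.integrable_sq).congr (ae_of_all _ fun x => ?_)
      simp only [Pi.mul_apply]; ring
    rw [ofReal_integral_eq_lintegral_ofReal h4 (ae_of_all _ fun x => by positivity)]
    refine lintegral_congr fun x => ?_
    rw [← ofReal_norm, ENNReal.ofReal_rpow_of_nonneg (norm_nonneg _) (by norm_num)]
    congr 1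
    rw [Real.rpow_two, Real.norm_eq_abs, sq_abs, Pi.mul_apply]; ring
  rw [h1, h2, ENNReal.ofReal_rpow_of_nonneg (integral_nonneg fun x => by positivity) (by norm_num),
    ← hC, ← ENNReal.ofReal_coe_nnreal, ← ENNReal.ofReal_mul C.coe_nonneg,
    ENNReal.ofReal_le_ofReal_iff (by positivity), Real.rpow_two, integral_const_mul, mul_pow] at h
  have h3 := sq_integral_mul_le (hψ.memLp 2 volume).norm (hψ.memLp_gradient 2 volume).norm
  simp only [Real.norm_eq_abs, sq_abs] at h3
  have hG : 0 ≤ ∫ x, ‖gradient ψ x‖ ^ 2 := integral_nonneg fun x => sq_nonneg _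
  have hM : 0 ≤ ∫ x, ψ x ^ 2 := integral_nonneg fun x => sq_nonneg _
  have hGM := mul_nonneg hG hM
  calc _ ≤ _ := h
    _ ≤ C * (2 ^ 2 * ((∫ x, ψ x ^ 2) * ∫ x, ‖gradient ψ x‖ ^ 2)) := by gcongr
    _ ≤ _ := by nlinarith

/-- The functional `‖ψ‖₄² - ‖∇ψ‖₂²`. -/
def quarticFunctional (ψ : Plane → ℝ) : ℝ := √(∫ x, ψ x ^ 4) - ∫ x, ‖gradient ψ x‖ ^ 2

lemma le_quarticValue {ψ : Plane → ℝ} (h : IsTest ψ) (h1 : ∫ x, ψ x ^ 2 = 1) :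
    (quarticFunctional ψ : EReal) ≤ quarticValue := le_iSup₂_of_le ψ ⟨h, h1⟩ le_rfl

lemma quarticValue_lt_top : quarticValue < ⊤ := by
  obtain ⟨C, hC, h⟩ := exists_ladyzhenskaya_const
  refine lt_of_le_of_lt (b := ((C / 4 : ℝ) : EReal)) (iSup₂_le fun ψ hψ => ?_)
    (EReal.coe_lt_top _)
  refine EReal.coe_le_coe_iff.2 ?_
  have h1 := h ψ hψ.1
  rw [hψ.2, mul_one] at h1
  set G := ∫ x, ‖gradient ψ x‖ ^ 2 with hG
  have hG0 : 0 ≤ G := integral_nonneg fun x => sq_nonneg _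
  have h2 : √(∫ x, ψ x ^ 4) ≤ G + C / 4 := by
    apply Real.sqrt_le_iff.2 ⟨by positivity, h1.trans ?_⟩
    nlinarith [sq_nonneg (G - C / 4)]
  linarith

lemma energy_le_quarticFunctional {V ψ : Plane → ℝ} (hV : IsTest V) (hV1 : ∫ x, V x ^ 2 ≤ 1)
    (hψ : IsTest ψ) : energy V ψ ≤ quarticFunctional ψ := by
  rw [energy_eq hV hψ, quarticFunctional]
  gcongr
  apply Real.le_sqrt_of_sq_le
  have h := sq_integral_mul_le (hV.memLp 2 volume) ((hψ.mul hψ).memLp 2 volume)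
  have h1 : ∀ x, (ψ * ψ) x = ψ x ^ 2 := fun x => by simp [pow_two]
  simp only [h1, ← pow_mul] at h
  norm_num at h
  refine h.trans ?_
  have : 0 ≤ ∫ x, ψ x ^ 4 := integral_nonneg fun x => by positivity
  nlinarith

/-- Every trial space of positive dimension contains a normalized function, and for normalized `V` the
Cauchy-Schwarz inequality gives `∫ V ψ² ≤ ‖ψ‖₄²`. -/
lemma maxMinValue_le_quarticValue {n : ℕ} (hn : 1 ≤ n) : maxMinValue n ≤ quarticValue := by
  refine iSup₂_le fun V hV => iSup₂_le fun F hF => ?_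
  have hne : F ≠ ⊥ := by
    rintro rfl
    have := hF.2
    rw [rank_bot] at this
    have : n = 0 := by exact_mod_cast this.symm
    omega
  obtain ⟨ψ, hψF, hψ0⟩ := (Submodule.ne_bot_iff _).1 hne
  have hψ := hF.1 ψ hψF
  have hs : 0 < ∫ x, ψ x ^ 2 := by
    refine lt_of_le_of_ne (integral_nonneg fun x => sq_nonneg _) fun h => hψ0 ?_
    exact hψ.eq_zero_of_integral_sq h.symm
  have h1 : ∫ x, ((√(∫ x, ψ x ^ 2))⁻¹ • ψ) x ^ 2 = 1 := by
    rw [integral_sq_smul, inv_pow, Real.sq_sqrt hs.le, inv_mul_cancel₀ hs.ne']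
  refine (iInf₂_le _ ⟨F.smul_mem _ hψF, h1⟩).trans ?_
  refine le_trans ?_ (le_quarticValue (hψ.smul _) h1)
  exact EReal.coe_le_coe_iff.2 (energy_le_quarticFunctional hV.1 hV.2 (hψ.smul _))

/-- Equality in the Cauchy-Schwarz inequality is attained by `V = ψ² / ‖ψ‖₄²`. -/
lemma maxMinValue_one : maxMinValue 1 = quarticValue := by
  refine le_antisymm (maxMinValue_le_quarticValue le_rfl) (iSup₂_le fun ψ hψ => ?_)
  obtain ⟨hψ, h1⟩ := hψ
  have hψ0 : ψ ≠ 0 := by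
    rintro rfl
    simp at h1
  have hsq : ∀ x, (ψ * ψ) x = ψ x ^ 2 := fun x => by simp [pow_two]
  set R := ∫ x, ψ x ^ 4 with hR
  have hR' : ∫ x, (ψ * ψ) x ^ 2 = R := by
    simp_rw [hsq, ← pow_mul]; rfl
  have hRpos : 0 < R := by
    refine lt_of_le_of_ne (integral_nonneg fun x => by positivity) fun h => hψ0 ?_
    have h2 := (hψ.mul hψ).eq_zero_of_integral_sq (hR'.trans h.symm)
    funext x
    simpa using congrFun h2 x
  have hV : IsTest ((√R)⁻¹ • (ψ * ψ)) := (hψ.mul hψ).smul _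
  have hVs : ∫ x, ((√R)⁻¹ • (ψ * ψ)) x ^ 2 = 1 := by
    rw [integral_sq_smul, hR', inv_pow, Real.sq_sqrt hRpos.le, inv_mul_cancel₀ hRpos.ne']
  have henergy : energy ((√R)⁻¹ • (ψ * ψ)) ψ = quarticFunctional ψ := by
    rw [energy_eq hV hψ, quarticFunctional]
    congr 1
    have : ∀ x, ((√R)⁻¹ • (ψ * ψ)) x * ψ x ^ 2 = (√R)⁻¹ * ψ x ^ 4 := by
      intro x; rw [Pi.smul_apply, hsq, smul_eq_mul]; ring
    simp_rw [this, integral_const_mul]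
    rw [← hR, inv_mul_eq_div, Real.div_sqrt]
  have hT : TrialSpace 1 ((√R)⁻¹ • (ψ * ψ)) (Submodule.span ℝ {ψ}) 1 (quarticFunctional ψ) := by
    refine ⟨hV, hVs.le, ?_, ?_, ?_⟩
    · intro φ hφ
      obtain ⟨c, rfl⟩ := Submodule.mem_span_singleton.1 hφ
      exact hψ.smul c
    · rw [← Module.finrank_eq_rank, finrank_span_singleton hψ0]
    · intro φ hφ
      obtain ⟨c, rfl⟩ := Submodule.mem_span_singleton.1 hφ
      rw [integral_sq_smul, energy_smul c hψ, henergy, h1, mul_one, mul_comm]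
  simpa [quarticFunctional] using hT.div_le_maxMinValue one_pos

end Quartic

section Norms

lemma eLpNorm_pow_eq_lintegral {α E : Type*} [MeasurableSpace α] [NormedAddCommGroup E]
    {μ : Measure α} (f : α → E) {p : ℕ} (hp : p ≠ 0) :
    eLpNorm f p μ ^ p = ∫⁻ x, ‖f x‖ₑ ^ p ∂μ := by
  have := eLpNorm_nnreal_pow_eq_lintegral (μ := μ) (f := f) (p := (p : NNReal))
    (by exact_mod_cast hp)
  simpa using this

lemma eLpNorm_pow_eq_ofReal {α E : Type*} [MeasurableSpace α] [NormedAddCommGroup E]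
    {μ : Measure α} {f : α → E} {p : ℕ} (hp : p ≠ 0) (hf : MemLp f p μ) :
    eLpNorm f p μ ^ p = ENNReal.ofReal (∫ x, ‖f x‖ ^ p ∂μ) := by
  rw [eLpNorm_pow_eq_lintegral f hp, ofReal_integral_eq_lintegral_ofReal
    (hf.integrable_norm_pow hp) (ae_of_all _ fun x => by positivity)]
  refine lintegral_congr fun x => ?_
  rw [← ofReal_norm, ENNReal.ofReal_pow (norm_nonneg _)]

end Norms

/-! ### The sharp constant in Ladyzhenskaya's inequality -/

section SharpConstant

lemma quarticValue_pos : 0 < quarticValue := maxMinValue_one ▸ maxMinValue_pos 1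

lemma coe_toReal_quarticValue : ((quarticValue.toReal : ℝ) : EReal) = quarticValue :=
  EReal.coe_toReal quarticValue_lt_top.ne (ne_bot_of_gt quarticValue_pos)

lemma toReal_quarticValue_pos : 0 < quarticValue.toReal := by
  have := quarticValue_pos
  rw [← coe_toReal_quarticValue] at this
  exact_mod_cast this

/-- Optimising the scaling `ψ ↦ c ψ(t ·)` turns the bound `‖ψ‖₄² - ‖∇ψ‖₂² ≤ q` on normalized
functions into a multiplicative inequality with constant `4 q`. -/
lemma IsTest.integral_pow_four_le {ψ : Plane → ℝ} (hψ : IsTest ψ) :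
    ∫ x, ψ x ^ 4 ≤ 4 * quarticValue.toReal * (∫ x, ‖gradient ψ x‖ ^ 2) * ∫ x, ψ x ^ 2 := by
  set Q := quarticValue.toReal
  set R := ∫ x, ψ x ^ 4 with hR
  set G := ∫ x, ‖gradient ψ x‖ ^ 2 with hG
  set M := ∫ x, ψ x ^ 2 with hM
  have hR0 : 0 ≤ R := integral_nonneg fun x => by positivity
  have hG0 : 0 ≤ G := integral_nonneg fun x => by positivity
  rcases eq_or_lt_of_le (integral_nonneg fun x => sq_nonneg (ψ x) : 0 ≤ M) with h0 | hM0
  · have : ψ = 0 := hψ.eq_zero_of_integral_sq h0.symm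
    simp [hR, hM, this]
  have key : ∀ t : ℝ, 0 < t → t * √R ≤ Q * M + t ^ 2 * G := by
    intro t ht
    set φ : Plane → ℝ := (t / √M) • fun x => ψ (t • x + 0) with hφ
    have hφt : IsTest φ := (hψ.comp_affine ht.ne' 0).smul _
    have hc : (t / √M) ^ 2 = t ^ 2 / M := by rw [div_pow, Real.sq_sqrt hM0.le]
    have h1 : ∫ x, φ x ^ 2 = 1 := by
      rw [hφ, integral_sq_smul, integral_comp_affine (fun x => ψ x ^ 2) ht 0, hc, smul_eq_mul,
        ← hM]
      have : M ≠ 0 := hM0.ne'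
      field_simp
    have h2 : ∫ x, φ x ^ 4 = (t * √R / M) ^ 2 := by
      have : ∀ x, φ x ^ 4 = ((t / √M) ^ 2) ^ 2 * ψ (t • x + 0) ^ 4 := by
        intro x; rw [hφ, Pi.smul_apply, smul_eq_mul]; ring
      simp_rw [this, integral_const_mul]
      rw [integral_comp_affine (fun x => ψ x ^ 4) ht 0, hc, smul_eq_mul, ← hR, div_pow (t * √R),
        mul_pow, Real.sq_sqrt hR0]
      field_simp
    have h3 : ∫ x, ‖gradient φ x‖ ^ 2 = t ^ 2 / M * G := by
      have : ∀ x, ‖gradient φ x‖ ^ 2 = (t / √M) ^ 2 * (t ^ 2 * ‖gradient ψ (t • x + 0)‖ ^ 2) := by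
        intro x
        rw [hφ, gradient_smul _ (hψ.comp_affine ht.ne' 0).differentiable,
          gradient_comp_affine hψ.differentiable, norm_smul, norm_smul, mul_pow, mul_pow,
          Real.norm_eq_abs, Real.norm_eq_abs, sq_abs, sq_abs]
      simp_rw [this, integral_const_mul]
      rw [integral_comp_affine (fun x => ‖gradient ψ x‖ ^ 2) ht 0, hc, smul_eq_mul, ← hG]
      field_simp
    have h4 := le_quarticValue hφt h1
    rw [← coe_toReal_quarticValue, EReal.coe_le_coe_iff, quarticFunctional, h2, h3,
      Real.sqrt_sq (by positivity)] at h4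
    have h5 : t * √R / M - t ^ 2 / M * G = (t * √R - t ^ 2 * G) / M := by ring
    rw [h5, div_le_iff₀ hM0] at h4
    linarith
  have hQ : 0 ≤ Q := toReal_quarticValue_pos.le
  -- A quadratic polynomial in `t` without sign change has nonpositive discriminant.
  have hdisc := discrim_le_zero (a := G) (b := -√R) (c := Q * M) fun t => by
    rcases le_or_gt t 0 with ht | ht
    · have := mul_nonneg (neg_nonneg.2 ht) (Real.sqrt_nonneg R)
      have := mul_nonneg hQ hM0.le
      nlinarith [mul_nonneg hG0 (mul_self_nonneg t)]
    · nlinarith [key t ht]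
  rw [discrim, neg_sq, Real.sq_sqrt hR0] at hdisc
  linarith

lemma IsTest.eLpNorm_four_pow_le {ψ : Plane → ℝ} (hψ : IsTest ψ) :
    eLpNorm ψ 4 volume ^ 4 ≤ ENNReal.ofReal (4 * quarticValue.toReal) *
      eLpNorm (gradient ψ) 2 volume ^ 2 * eLpNorm ψ 2 volume ^ 2 := by
  have hQ := toReal_quarticValue_pos
  have h4 := eLpNorm_pow_eq_ofReal (p := 4) (by norm_num) (hψ.memLp 4 volume)
  have h2 := eLpNorm_pow_eq_ofReal (p := 2) (by norm_num) (hψ.memLp 2 volume)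
  have hg := eLpNorm_pow_eq_ofReal (p := 2) (by norm_num) (hψ.memLp_gradient 2 volume)
  push_cast at h4 h2 hg
  have e4 : ∀ x, ‖ψ x‖ ^ 4 = ψ x ^ 4 := fun x => by
    rw [Real.norm_eq_abs]; exact Even.pow_abs (by decide) _
  have e2 : ∀ x, ‖ψ x‖ ^ 2 = ψ x ^ 2 := fun x => by rw [Real.norm_eq_abs, sq_abs]
  simp_rw [e4] at h4
  simp_rw [e2] at h2
  have hG0 : 0 ≤ ∫ x, ‖gradient ψ x‖ ^ 2 := integral_nonneg fun x => by positivity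
  rw [h4, h2, hg, ← ENNReal.ofReal_mul (by positivity), ← ENNReal.ofReal_mul (by positivity)]
  exact ENNReal.ofReal_le_ofReal hψ.integral_pow_four_le

lemma IsTest.isSobolevGradient {ψ : Plane → ℝ} (hψ : IsTest ψ) :
    IsSobolevGradient ψ (gradient ψ) := by
  refine ⟨hψ.memLp 2 _, hψ.memLp_gradient 2 _, fun φ hφ => ?_⟩
  have hi : ∀ {u v : Plane → ℝ}, IsTest u → IsTest v → Integrable (fun x => u x • gradient v x) :=
    fun {u v} hu hv => (hu.continuous.smul hv.continuous_gradient).integrable_of_hasCompactSupport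
      hu.2.smul_right
  refine ext_inner_right ℝ fun v => ?_
  rw [inner_neg_left, real_inner_comm, ← integral_inner (hi hψ hφ), real_inner_comm,
    ← integral_inner (hi hφ hψ)]
  have hj : ∀ {u w : Plane → ℝ}, IsTest u → IsTest w →
      Integrable (fun x => u x * fderiv ℝ w x v) := fun {u w} hu hw =>
    (hu.continuous.mul ((hw.1.continuous_fderiv (by simp)).clm_apply
      continuous_const)).integrable_of_hasCompactSupport hu.2.mul_right
  have h := integral_mul_fderiv_eq_neg_fderiv_mul_of_integrable (μ := (volume : Measure Plane))
    (f := ψ) (g := φ) (v := v) (by simpa only [mul_comm] using hj hφ hψ) (hj hψ hφ)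
    (hψ.mul hφ).integrable (fun x _ => hψ.differentiable x) (fun x _ => hφ.differentiable x)
  simp_rw [inner_smul_right, real_inner_comm _ v, inner_gradient_left]
  rw [h]
  simp_rw [mul_comm]

/-- `4 q` is the smallest constant in Ladyzhenskaya's inequality: any other constant `C` satisfies
`‖ψ‖₄² - ‖∇ψ‖₂² ≤ √C ‖∇ψ‖₂ - ‖∇ψ‖₂² ≤ C / 4` for normalized `ψ`. -/
lemma le_of_mem_ladyzhenskayaConstants {C : ℝ} (hC : C ∈ ladyzhenskayaConstants) :
    4 * quarticValue.toReal ≤ C := by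
  have h : quarticValue ≤ ((C / 4 : ℝ) : EReal) := by
    refine iSup₂_le fun ψ hψ => EReal.coe_le_coe_iff.2 ?_
    obtain ⟨hψ, h1⟩ := hψ
    have h := hC.2 _ _ hψ.isSobolevGradient
    have h4 := eLpNorm_pow_eq_ofReal (p := 4) (by norm_num) (hψ.memLp 4 volume)
    have h2 := eLpNorm_pow_eq_ofReal (p := 2) (by norm_num) (hψ.memLp 2 volume)
    have hg := eLpNorm_pow_eq_ofReal (p := 2) (by norm_num) (hψ.memLp_gradient 2 volume)
    push_cast at h4 h2 hg
    have e4 : ∀ x, ‖ψ x‖ ^ 4 = ψ x ^ 4 := fun x => by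
      rw [Real.norm_eq_abs]; exact Even.pow_abs (by decide) _
    have e2 : ∀ x, ‖ψ x‖ ^ 2 = ψ x ^ 2 := fun x => by rw [Real.norm_eq_abs, sq_abs]
    simp_rw [e4] at h4
    simp_rw [e2, h1] at h2
    set G := ∫ x, ‖gradient ψ x‖ ^ 2 with hG
    have hG0 : 0 ≤ G := integral_nonneg fun x => by positivity
    rw [h4, h2, hg, ENNReal.ofReal_one, mul_one, ← ENNReal.ofReal_mul hC.1.le,
      ENNReal.ofReal_le_ofReal_iff (mul_nonneg hC.1.le hG0)] at h
    have h3 : √(∫ x, ψ x ^ 4) ≤ G + C / 4 := by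
      apply Real.sqrt_le_iff.2 ⟨by linarith [hC.1], h.trans ?_⟩
      nlinarith [sq_nonneg (G - C / 4)]
    linarith
  rw [← coe_toReal_quarticValue, EReal.coe_le_coe_iff] at h
  linarith

end SharpConstant

/-! ### Mollification in the Sobolev space of the plane -/

section Density

open scoped Convolution

/-- Averaging against a probability density does not increase the `L²` norm. -/
lemma lintegral_enorm_sq_convolution_le {E : Type*} [NormedAddCommGroup E] [NormedSpace ℝ E]
    {ρ : Plane → ℝ} (hρ : Continuous ρ) (hρ0 : ∀ x, 0 ≤ ρ x) (hρi : Integrable ρ)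
    (hρ1 : ∫ x, ρ x = 1) {h : Plane → E} (hh : AEStronglyMeasurable h) :
    ∫⁻ x, ‖∫ t, ρ t • h (x - t)‖ₑ ^ 2 ≤ ∫⁻ x, ‖h x‖ₑ ^ 2 := by
  have hmass : ∫⁻ t, ENNReal.ofReal (ρ t) = 1 := by
    rw [← ofReal_integral_eq_lintegral_ofReal hρi (ae_of_all _ hρ0), hρ1, ENNReal.ofReal_one]
  have hmeas : AEMeasurable (fun p : Plane × Plane => ‖h (p.1 - p.2)‖ₑ)
      (volume.prod volume) :=
    (hh.comp_quasiMeasurePreserving (quasiMeasurePreserving_sub volume volume)).enorm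
  have hmeas1 : ∀ x, AEMeasurable (fun t => ‖h (x - t)‖ₑ) volume := fun x =>
    (hh.comp_quasiMeasurePreserving
      (quasiMeasurePreserving_sub_left_of_right_invariant volume x)).enorm
  have hρm : Measurable (fun t => ENNReal.ofReal (ρ t)) := hρ.measurable.ennreal_ofReal
  have hpt : ∀ x, ‖∫ t, ρ t • h (x - t)‖ₑ ^ 2 ≤
      ∫⁻ t, ENNReal.ofReal (ρ t) * ‖h (x - t)‖ₑ ^ 2 := by
    intro x
    have h1 : ‖∫ t, ρ t • h (x - t)‖ₑ ≤
        ∫⁻ t, ENNReal.ofReal (ρ t) ^ (1 / 2 : ℝ) *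
          (ENNReal.ofReal (ρ t) ^ (1 / 2 : ℝ) * ‖h (x - t)‖ₑ) := by
      refine (enorm_integral_le_lintegral_enorm _).trans (lintegral_mono fun t => ?_)
      rw [← mul_assoc, ← ENNReal.rpow_add_of_nonneg _ _ (by norm_num) (by norm_num), enorm_smul,
        Real.enorm_of_nonneg (hρ0 t)]
      norm_num
    have h2 := ENNReal.lintegral_mul_le_Lp_mul_Lq volume Real.HolderConjugate.two_two
      (f := fun t => ENNReal.ofReal (ρ t) ^ (1 / 2 : ℝ))
      (g := fun t => ENNReal.ofReal (ρ t) ^ (1 / 2 : ℝ) * ‖h (x - t)‖ₑ)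
      (hρm.pow_const _).aemeasurable ((hρm.pow_const _).aemeasurable.mul (hmeas1 x))
    have h3 : ∀ a : ℝ≥0∞, (a ^ (1 / 2 : ℝ)) ^ (2 : ℝ) = a := fun a => by
      rw [← ENNReal.rpow_mul]; norm_num
    simp only [Pi.mul_apply, ENNReal.mul_rpow_of_nonneg _ _ (by norm_num : (0 : ℝ) ≤ 2), h3,
      hmass, ENNReal.one_rpow, one_mul] at h2
    calc ‖∫ t, ρ t • h (x - t)‖ₑ ^ 2 ≤
        ((∫⁻ t, ENNReal.ofReal (ρ t) * ‖h (x - t)‖ₑ ^ (2 : ℝ)) ^ (1 / 2 : ℝ)) ^ 2 := by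
          gcongr; exact h1.trans h2
      _ = _ := by
          rw [← ENNReal.rpow_two, h3]
          simp only [ENNReal.rpow_two]
  calc ∫⁻ x, ‖∫ t, ρ t • h (x - t)‖ₑ ^ 2
      ≤ ∫⁻ x, ∫⁻ t, ENNReal.ofReal (ρ t) * ‖h (x - t)‖ₑ ^ 2 := lintegral_mono hpt
    _ = ∫⁻ t, ∫⁻ x, ENNReal.ofReal (ρ t) * ‖h (x - t)‖ₑ ^ 2 := by
        refine lintegral_lintegral_swap ?_
        exact (hρm.comp measurable_snd).aemeasurable.mul (hmeas.pow_const 2)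
    _ = ∫⁻ t, ENNReal.ofReal (ρ t) * ∫⁻ x, ‖h x‖ₑ ^ 2 := by
        refine lintegral_congr fun t => ?_
        rw [lintegral_const_mul' _ _ ENNReal.ofReal_ne_top,
          lintegral_sub_right_eq_self (fun x => ‖h x‖ₑ ^ 2) t]
    _ = ∫⁻ x, ‖h x‖ₑ ^ 2 := by
        rw [lintegral_mul_const _ hρm, hmass, one_mul]

variable {f : Plane → ℝ} {g : Plane → Plane}

lemma contDiff_mollify (hf : LocallyIntegrable f) (φ : ContDiffBump (0 : Plane)) :
    ContDiff ℝ ∞ (fun x => ∫ t, φ.normed volume t • f (x - t)) :=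
  φ.hasCompactSupport_normed.contDiff_convolution_left (ContinuousLinearMap.lsmul ℝ ℝ)
    φ.contDiff_normed hf

/-- Mollification commutes with the weak gradient. -/
lemma IsSobolevGradient.gradient_mollify (h : IsSobolevGradient f g)
    (φ : ContDiffBump (0 : Plane)) (x : Plane) :
    gradient (fun x => ∫ t, φ.normed volume t • f (x - t)) x =
      ∫ t, φ.normed volume t • g (x - t) := by
  set ρ := φ.normed (volume : Measure Plane) with hρ
  have hρt : IsTest ρ := ⟨φ.contDiff_normed, φ.hasCompactSupport_normed⟩
  have hf : LocallyIntegrable f := h.1.locallyIntegrable (by norm_num)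
  have hg : LocallyIntegrable g := h.2.1.locallyIntegrable (by norm_num)
  have hu : (fun x => ∫ t, ρ t • f (x - t)) =
      f ⋆[(ContinuousLinearMap.lsmul ℝ ℝ).flip, volume] ρ := by
    rw [convolution_flip]; rfl
  have hd := hρt.2.hasFDerivAt_convolution_right
    ((ContinuousLinearMap.lsmul ℝ ℝ : ℝ →L[ℝ] ℝ →L[ℝ] ℝ).flip) hf (hρt.1.of_le (by simp)) x
  have hφ : IsTest (fun y => ρ ((-1 : ℝ) • y + x)) := hρt.comp_affine (by norm_num) x
  have hw := h.2.2 _ hφ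
  simp_rw [gradient_comp_affine hρt.differentiable] at hw
  have h1 : ∫ y, f y • gradient ρ (x - y) = ∫ y, ρ (x - y) • g y := by
    have e : ∀ y : Plane, (-1 : ℝ) • y + x = x - y := fun y => by
      rw [neg_one_smul]; abel
    simp_rw [e, neg_one_smul, smul_neg, integral_neg] at hw
    exact neg_injective hw
  have h2 : ∫ y, ρ (x - y) • g y = ∫ t, ρ t • g (x - t) := by
    rw [← integral_sub_left_eq_self (fun t => ρ t • g (x - t)) volume x]
    simp
  rw [← h2, ← h1]
  refine ext_inner_right ℝ fun v => ?_
  have hint : Integrable (fun y => f y • gradient ρ (x - y)) := by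
    have hcont : Continuous (fun y => gradient ρ (x - y)) :=
      hρt.continuous_gradient.comp (continuous_const.sub continuous_id)
    have hcs : HasCompactSupport (fun y => gradient ρ (x - y)) :=
      hρt.hasCompactSupport_gradient.comp_homeomorph (Homeomorph.subLeft x)
    exact hf.integrable_smul_right_of_hasCompactSupport hcont hcs
  rw [inner_gradient_left, hu, hd.fderiv, convolution_precompR_apply _ hf (hρt.2.fderiv ℝ)
    (hρt.1.continuous_fderiv (by simp)), real_inner_comm, ← integral_inner hint, convolution_def]
  refine integral_congr_ae (ae_of_all _ fun y => ?_)
  simp [real_inner_comm _ v, inner_smul_left, inner_gradient_left, mul_comm]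

/-- Ladyzhenskaya's inequality for test functions extends to `H¹(ℝ²)`: cut off, mollify, and pass to
the limit with Fatou's lemma. -/
lemma IsSobolevGradient.eLpNorm_four_pow_le (h : IsSobolevGradient f g) {C : ℝ≥0∞} (hC : C ≠ ⊤)
    (hle : ∀ ψ : Plane → ℝ, IsTest ψ → eLpNorm ψ 4 volume ^ 4 ≤
      C * eLpNorm (gradient ψ) 2 volume ^ 2 * eLpNorm ψ 2 volume ^ 2) :
    eLpNorm f 4 volume ^ 4 ≤ C * eLpNorm g 2 volume ^ 2 * eLpNorm f 2 volume ^ 2 := by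
  have hf : LocallyIntegrable f := h.1.locallyIntegrable (by norm_num)
  let φ : ℕ → ContDiffBump (0 : Plane) := fun k =>
    ⟨1 / ((k : ℝ) + 1), 2 * (1 / ((k : ℝ) + 1)), by positivity, by
      have : 0 < 1 / ((k : ℝ) + 1) := by positivity
      linarith⟩
  let χ : ContDiffBump (0 : Plane) := ⟨1, 2, by norm_num, by norm_num⟩
  have hχ : IsTest χ := ⟨χ.contDiff, χ.hasCompactSupport⟩
  obtain ⟨c, hc⟩ := hχ.continuous_gradient.bounded_above_of_compact_support
    hχ.hasCompactSupport_gradient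
  have hc0 : 0 ≤ c := (norm_nonneg _).trans (hc 0)
  let r : ℕ → ℝ := fun k => 1 / ((k : ℝ) + 1)
  have hr : ∀ k, 0 < r k := fun k => by positivity
  have hr0 : Tendsto r atTop (𝓝 0) := tendsto_one_div_add_atTop_nhds_zero_nat
  let u : ℕ → Plane → ℝ := fun k x => ∫ t, (φ k).normed volume t • f (x - t)
  have hu : ∀ k, ContDiff ℝ ∞ (u k) := fun k => contDiff_mollify hf _
  let X : ℕ → Plane → ℝ := fun k x => χ (r k • x + 0)
  have hX : ∀ k, IsTest (X k) := fun k => hχ.comp_affine (hr k).ne' 0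
  have hψ : ∀ k, IsTest (X k * u k) := fun k => ⟨(hX k).1.mul (hu k), (hX k).2.mul_right⟩
  have hmol : ∀ {E : Type} [NormedAddCommGroup E] [NormedSpace ℝ E] (k : ℕ) (h : Plane → E),
      AEStronglyMeasurable h →
      eLpNorm (fun x => ∫ t, (φ k).normed volume t • h (x - t)) 2 volume ≤ eLpNorm h 2 volume := by
    intro E _ _ k h hh
    rw [← ENNReal.pow_le_pow_left_iff two_ne_zero]
    have e1 := eLpNorm_pow_eq_lintegral (μ := volume) (p := 2)
      (fun x => ∫ t, (φ k).normed volume t • h (x - t)) (by norm_num)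
    have e2 := eLpNorm_pow_eq_lintegral (μ := volume) (p := 2) h (by norm_num)
    push_cast at e1 e2
    rw [e1, e2]
    exact lintegral_enorm_sq_convolution_le ((φ k).contDiff_normed (n := 0)).continuous
      (fun x => (φ k).nonneg_normed x) (φ k).integrable_normed
      (φ k).integral_normed hh
  have hu2 : ∀ k, eLpNorm (u k) 2 volume ≤ eLpNorm f 2 volume := fun k => hmol k f h.1.1
  have hug : ∀ k, eLpNorm (gradient (u k)) 2 volume ≤ eLpNorm g 2 volume := fun k => by
    have : gradient (u k) = fun x => ∫ t, (φ k).normed volume t • g (x - t) :=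
      funext fun x => h.gradient_mollify (φ k) x
    rw [this]
    exact hmol k g h.2.1.1
  have hX1 : ∀ k x, ‖X k x‖ ≤ 1 := fun k x => by
    rw [Real.norm_of_nonneg χ.nonneg]; exact χ.le_one
  have hψ2 : ∀ k, eLpNorm (X k * u k) 2 volume ≤ eLpNorm f 2 volume := fun k => by
    refine (eLpNorm_mono fun x => ?_).trans (hu2 k)
    rw [Pi.mul_apply, norm_mul]
    exact mul_le_of_le_one_left (norm_nonneg _) (hX1 k x)
  have hψg : ∀ k, eLpNorm (gradient (X k * u k)) 2 volume ≤
      eLpNorm g 2 volume + ENNReal.ofReal (r k * c) * eLpNorm f 2 volume := fun k => by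
    have hgc : Continuous (gradient (u k)) :=
      (InnerProductSpace.toDual ℝ Plane).symm.continuous.comp ((hu k).continuous_fderiv (by simp))
    have h1 : eLpNorm (gradient (X k * u k)) 2 volume ≤
        eLpNorm ((fun x => ‖gradient (u k) x‖) + (r k * c) • fun x => ‖u k x‖) 2 volume := by
      refine eLpNorm_mono fun x => ?_
      rw [gradient_mul (hX k).differentiable ((hu k).differentiable (by simp))]
      refine (norm_add_le _ _).trans ?_
      have e1 : ‖gradient (X k) x‖ ≤ r k * c := by
        rw [gradient_comp_affine hχ.differentiable, norm_smul, Real.norm_of_nonneg (hr k).le]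
        exact mul_le_mul_of_nonneg_left (hc _) (hr k).le
      rw [norm_smul, norm_smul]
      refine le_trans ?_ (le_abs_self _)
      simp only [Pi.add_apply, Pi.smul_apply, smul_eq_mul]
      have := mul_le_of_le_one_left (norm_nonneg (gradient (u k) x)) (hX1 k x)
      have := mul_le_mul_of_nonneg_left e1 (norm_nonneg (u k x))
      linarith
    refine h1.trans ((eLpNorm_add_le hgc.norm.aestronglyMeasurable
      ((hu k).continuous.norm.const_smul _).aestronglyMeasurable (by norm_num)).trans ?_)
    rw [eLpNorm_const_smul, eLpNorm_norm, eLpNorm_norm,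
      Real.enorm_of_nonneg (mul_nonneg (hr k).le hc0)]
    gcongr
    · exact hug k
    · exact hu2 k
  have hbd : ∀ k, eLpNorm (X k * u k) 4 volume ^ 4 ≤
      C * (eLpNorm g 2 volume + ENNReal.ofReal (r k * c) * eLpNorm f 2 volume) ^ 2 *
        eLpNorm f 2 volume ^ 2 := fun k => by
    refine (hle _ (hψ k)).trans ?_
    gcongr
    · exact hψg k
    · exact hψ2 k
  have hae : ∀ᵐ x, Tendsto (fun k => (X k * u k) x) atTop (𝓝 (f x)) := by
    have h1 := ContDiffBump.ae_convolution_tendsto_right_of_locallyIntegrable (μ := volume)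
      (φ := φ) (l := atTop) (K := 2) (g := f) (by simpa [φ, r] using hr0.const_mul 2)
      (Eventually.of_forall fun k => le_rfl) hf
    filter_upwards [h1] with x hx
    have h2 : ∀ᶠ k in atTop, X k x = 1 := by
      have : Tendsto (fun k => r k * ‖x‖) atTop (𝓝 0) := by simpa using hr0.mul_const ‖x‖
      filter_upwards [this.eventually (gt_mem_nhds one_pos)] with k hk
      apply χ.one_of_mem_closedBall
      rw [add_zero, mem_closedBall_zero_iff, norm_smul, Real.norm_of_nonneg (hr k).le]
      exact hk.le
    refine hx.congr' ?_
    filter_upwards [h2] with k hk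
    rw [Pi.mul_apply, hk, one_mul]
    rfl
  have hfatou : eLpNorm f 4 volume ^ 4 ≤ liminf (fun k => eLpNorm (X k * u k) 4 volume ^ 4) atTop := by
    have e : ∀ v : Plane → ℝ, eLpNorm v 4 volume ^ 4 = ∫⁻ x, ‖v x‖ₑ ^ 4 := fun v => by
      simpa using eLpNorm_pow_eq_lintegral (μ := volume) (p := 4) v (by norm_num)
    simp_rw [e]
    calc ∫⁻ x, ‖f x‖ₑ ^ 4 = ∫⁻ x, liminf (fun k => ‖(X k * u k) x‖ₑ ^ 4) atTop := by
          refine lintegral_congr_ae ?_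
          filter_upwards [hae] with x hx
          have : Tendsto (fun k => ‖(X k * u k) x‖ₑ ^ 4) atTop (𝓝 (‖f x‖ₑ ^ 4)) :=
            ((ENNReal.continuous_pow 4).tendsto _).comp ((continuous_enorm.tendsto _).comp hx)
          exact this.liminf_eq.symm
      _ ≤ _ := lintegral_liminf_le fun k =>
          ((hψ k).continuous.measurable.enorm).pow_const 4
  have hlim : Tendsto (fun k => C * (eLpNorm g 2 volume + ENNReal.ofReal (r k * c) *
      eLpNorm f 2 volume) ^ 2 * eLpNorm f 2 volume ^ 2) atTop
      (𝓝 (C * eLpNorm g 2 volume ^ 2 * eLpNorm f 2 volume ^ 2)) := by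
    have hf2 : eLpNorm f 2 volume ^ 2 ≠ ⊤ := ENNReal.pow_ne_top h.1.2.ne
    have h1 : Tendsto (fun k => ENNReal.ofReal (r k * c)) atTop (𝓝 0) := by
      have := ENNReal.tendsto_ofReal (hr0.mul_const c)
      simpa using this
    have h2 := ENNReal.Tendsto.mul_const h1 (Or.inr h.1.2.ne : (0 : ℝ≥0∞) ≠ 0 ∨ _ )
    rw [zero_mul] at h2
    have h3 := (h2.const_add (eLpNorm g 2 volume))
    rw [add_zero] at h3
    have h4 := ((ENNReal.continuous_pow 2).tendsto _).comp h3
    exact ENNReal.Tendsto.mul_const (ENNReal.Tendsto.const_mul h4 (Or.inr hC)) (Or.inr hf2)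
  refine hfatou.trans ?_
  rw [← hlim.liminf_eq]
  exact liminf_le_liminf (Eventually.of_forall hbd)

lemma isLeast_ladyzhenskayaConstants :
    IsLeast ladyzhenskayaConstants (4 * quarticValue.toReal) := by
  refine ⟨⟨by have := toReal_quarticValue_pos; positivity, fun f g h => ?_⟩,
    fun C hC => le_of_mem_ladyzhenskayaConstants hC⟩
  exact h.eLpNorm_four_pow_le ENNReal.ofReal_ne_top fun ψ hψ => hψ.eLpNorm_four_pow_le

end Density

/-! ### The Sobolev space of the box and its embedding into L⁴ -/

section DirichletSpace

instance fact_one_le_four : Fact ((1 : ℝ≥0∞) ≤ 4) := ⟨by norm_num⟩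

instance holderTriple_four_four_two : ENNReal.HolderTriple 4 4 2 := ⟨by
  rw [← two_mul, show (4 : ℝ≥0∞) = 2 * 2 by norm_num, ENNReal.mul_inv (by simp) (by simp),
    ← mul_assoc, ENNReal.mul_inv_cancel (by simp) (by simp), one_mul]⟩

/-- `C_c^∞(Q_L)` as a linear space. -/
def boxTests (L : ℝ) : Submodule ℝ (Plane → ℝ) where
  carrier := {φ | IsBoxTest L φ}
  add_mem' {φ ψ} hφ hψ := ⟨hφ.1.add hψ.1,
    (tsupport_add φ ψ).trans (union_subset hφ.2 hψ.2)⟩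
  zero_mem' := ⟨IsTest.zero, by
    rw [tsupport_eq_empty_iff.2 rfl]; exact empty_subset _⟩
  smul_mem' c φ hφ := ⟨hφ.1.smul c, (tsupport_smul_subset_right (fun _ => c) φ).trans hφ.2⟩

variable {L : ℝ}

lemma isClosed_box (L : ℝ) : IsClosed (box L) := by
  simp only [box, ofPred_forall]
  refine isClosed_iInter fun i => IsClosed.and ?_ ?_
  · exact isClosed_le continuous_const (by fun_prop)
  · exact isClosed_le (by fun_prop) continuous_const

lemma isTest_coe (φ : boxTests L) : IsTest (φ : Plane → ℝ) := φ.2.1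

lemma boxTest_eq_zero (φ : boxTests L) {x : Plane} (hx : x ∉ box L) : (φ : Plane → ℝ) x = 0 :=
  image_eq_zero_of_notMem_tsupport fun h => hx (interior_subset (φ.2.2 h))

lemma boxTest_gradient_eq_zero (φ : boxTests L) {x : Plane} (hx : x ∉ box L) :
    gradient (φ : Plane → ℝ) x = 0 := by
  have : fderiv ℝ (φ : Plane → ℝ) x = 0 := image_eq_zero_of_notMem_tsupport fun h =>
    hx (interior_subset (φ.2.2 (tsupport_fderiv_subset ℝ h)))
  simp [gradient, this]

/-- The class in `L^p(Q_L)` of a test function. -/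
def toLpBox (L : ℝ) (p : ℝ≥0∞) : boxTests L →ₗ[ℝ] Lp ℝ p (boxMeasure L) where
  toFun φ := ((isTest_coe φ).memLp p (boxMeasure L)).toLp
  map_add' _ _ := rfl
  map_smul' _ _ := rfl

/-- The class in `L²(Q_L)` of the gradient of a test function. -/
def gradBox (L : ℝ) : boxTests L →ₗ[ℝ] Lp Plane 2 (boxMeasure L) where
  toFun φ := ((isTest_coe φ).memLp_gradient 2 (boxMeasure L)).toLp
  map_add' φ ψ := by
    rw [← MemLp.toLp_add]
    exact MemLp.toLp_congr _ _ (ae_of_all _ fun x =>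
      gradient_add (isTest_coe φ).differentiable (isTest_coe ψ).differentiable x)
  map_smul' c φ := by
    rw [RingHom.id_apply, ← MemLp.toLp_const_smul]
    exact MemLp.toLp_congr _ _ (ae_of_all _ fun x => gradient_smul c (isTest_coe φ).differentiable x)

lemma coeFn_toLpBox (φ : boxTests L) (p : ℝ≥0∞) :
    toLpBox L p φ =ᵐ[boxMeasure L] (φ : Plane → ℝ) :=
  MemLp.coeFn_toLp ((isTest_coe φ).memLp p (boxMeasure L))

lemma coeFn_gradBox (φ : boxTests L) :
    gradBox L φ =ᵐ[boxMeasure L] gradient (φ : Plane → ℝ) :=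
  MemLp.coeFn_toLp ((isTest_coe φ).memLp_gradient 2 (boxMeasure L))

/-- The Hilbert space `L²(Q_L) × L²(Q_L)²` of pairs (function, gradient). -/
abbrev PairSpace (L : ℝ) : Type := WithLp 2 (L2Box L × Lp Plane 2 (boxMeasure L))

/-- A test function together with its gradient. -/
def pairBox (L : ℝ) : boxTests L →ₗ[ℝ] PairSpace L :=
  (WithLp.linearEquiv 2 ℝ _).symm.toLinearMap ∘ₗ (toLpBox L 2).prod (gradBox L)

@[simp] lemma pairBox_fst (φ : boxTests L) : (pairBox L φ).fst = toLpBox L 2 φ := rfl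

@[simp] lemma pairBox_snd (φ : boxTests L) : (pairBox L φ).snd = gradBox L φ := rfl

/-- `H¹₀(Q_L)`, realised as the closed space of pairs `(f, ∇f)`. -/
def dirichletSpace (L : ℝ) : Submodule ℝ (PairSpace L) :=
  (LinearMap.range (pairBox L)).topologicalClosure

lemma mem_dirichletSpace_iff_seq {p : PairSpace L} : p ∈ dirichletSpace L ↔
    ∃ φ : ℕ → boxTests L, Tendsto (fun k => pairBox L (φ k)) atTop (𝓝 p) := by
  rw [dirichletSpace, ← SetLike.mem_coe, Submodule.topologicalClosure_coe, mem_closure_iff_seq_limit]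
  constructor
  · rintro ⟨u, hu, hlim⟩
    choose φ hφ using hu
    exact ⟨φ, by simpa only [hφ] using hlim⟩
  · rintro ⟨φ, hφ⟩
    exact ⟨_, fun k => ⟨φ k, rfl⟩, hφ⟩

lemma tendsto_pairSpace_iff {ι : Type*} {l : Filter ι} {u : ι → PairSpace L} {p : PairSpace L} :
    Tendsto u l (𝓝 p) ↔ Tendsto (fun k => (u k).fst) l (𝓝 p.fst) ∧
      Tendsto (fun k => (u k).snd) l (𝓝 p.snd) := by
  constructor
  · intro h
    exact ⟨((WithLp.fstL 2 ℝ (L2Box L) (Lp Plane 2 (boxMeasure L))).continuous.tendsto p).comp h,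
      ((WithLp.sndL 2 ℝ (L2Box L) (Lp Plane 2 (boxMeasure L))).continuous.tendsto p).comp h⟩
  · rintro ⟨h1, h2⟩
    exact ((WithLp.prodContinuousLinearEquiv 2 ℝ (L2Box L)
      (Lp Plane 2 (boxMeasure L))).symm.continuous.tendsto (p.fst, p.snd)).comp (h1.prodMk_nhds h2)

/-- `dirichletSpace` consists of the pairs described by `HasDirichletGradient`. -/
lemma mem_dirichletSpace_iff {p : PairSpace L} :
    p ∈ dirichletSpace L ↔ HasDirichletGradient L p.fst p.snd := by
  have e1 : ∀ φ : ℕ → boxTests L, Tendsto (fun k => toLpBox L 2 (φ k)) atTop (𝓝 p.fst) ↔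
      Tendsto (fun k => eLpNorm (fun x => (φ k : Plane → ℝ) x - p.fst x) 2 (boxMeasure L))
        atTop (𝓝 0) := by
    intro φ
    rw [Lp.tendsto_Lp_iff_tendsto_eLpNorm']
    refine tendsto_congr fun k => eLpNorm_congr_ae ?_
    filter_upwards [coeFn_toLpBox (φ k) 2] with x hx
    rw [Pi.sub_apply, hx]
  have e2 : ∀ φ : ℕ → boxTests L, Tendsto (fun k => gradBox L (φ k)) atTop (𝓝 p.snd) ↔
      Tendsto (fun k => eLpNorm (fun x => gradient (φ k : Plane → ℝ) x - p.snd x) 2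
        (boxMeasure L)) atTop (𝓝 0) := by
    intro φ
    rw [Lp.tendsto_Lp_iff_tendsto_eLpNorm']
    refine tendsto_congr fun k => eLpNorm_congr_ae ?_
    filter_upwards [coeFn_gradBox (φ k)] with x hx
    rw [Pi.sub_apply, hx]
  rw [mem_dirichletSpace_iff_seq]
  constructor
  · rintro ⟨φ, hφ⟩
    obtain ⟨h1, h2⟩ := tendsto_pairSpace_iff.1 hφ
    exact ⟨fun k => φ k, fun k => (φ k).2, (e1 φ).1 h1, (e2 φ).1 h2⟩
  · rintro ⟨φ, hφ, h1, h2⟩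
    refine ⟨fun k => ⟨φ k, hφ k⟩, tendsto_pairSpace_iff.2 ⟨(e1 _).2 h1, (e2 _).2 h2⟩⟩

lemma eLpNorm_toLpBox (φ : boxTests L) (p : ℝ≥0∞) :
    eLpNorm (φ : Plane → ℝ) p (boxMeasure L) = eLpNorm (φ : Plane → ℝ) p volume :=
  eLpNorm_restrict_eq_of_support_subset fun x hx => by
    by_contra h
    exact hx (boxTest_eq_zero φ h)

lemma eLpNorm_gradBox (φ : boxTests L) (p : ℝ≥0∞) :
    eLpNorm (gradient (φ : Plane → ℝ)) p (boxMeasure L) =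
      eLpNorm (gradient (φ : Plane → ℝ)) p volume :=
  eLpNorm_restrict_eq_of_support_subset fun x hx => by
    by_contra h
    exact hx (boxTest_gradient_eq_zero φ h)

/-- The constant of the embedding `H¹₀(Q_L) → L⁴(Q_L)`. -/
def embeddingConst : ℝ := √√(4 * quarticValue.toReal)

lemma norm_toLpBox_four_le (φ : boxTests L) :
    ‖toLpBox L 4 φ‖ ≤ embeddingConst * ‖pairBox L φ‖ := by
  have hQ := toReal_quarticValue_pos
  have h := (isTest_coe φ).eLpNorm_four_pow_le
  rw [← eLpNorm_toLpBox, ← eLpNorm_toLpBox, ← eLpNorm_gradBox] at h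
  have h' := ENNReal.toReal_mono (ENNReal.mul_ne_top (ENNReal.mul_ne_top ENNReal.ofReal_ne_top
    (ENNReal.pow_ne_top ((isTest_coe φ).memLp_gradient 2 (boxMeasure L)).2.ne))
    (ENNReal.pow_ne_top ((isTest_coe φ).memLp 2 (boxMeasure L)).2.ne)) h
  rw [ENNReal.toReal_mul, ENNReal.toReal_mul, ENNReal.toReal_pow, ENNReal.toReal_pow,
    ENNReal.toReal_pow, ENNReal.toReal_ofReal (by positivity)] at h'
  have n4 : ‖toLpBox L 4 φ‖ = (eLpNorm (φ : Plane → ℝ) 4 (boxMeasure L)).toReal :=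
    Lp.norm_toLp _ ((isTest_coe φ).memLp 4 (boxMeasure L))
  have n2 : ‖toLpBox L 2 φ‖ = (eLpNorm (φ : Plane → ℝ) 2 (boxMeasure L)).toReal :=
    Lp.norm_toLp _ ((isTest_coe φ).memLp 2 (boxMeasure L))
  have ng : ‖gradBox L φ‖ = (eLpNorm (gradient (φ : Plane → ℝ)) 2 (boxMeasure L)).toReal :=
    Lp.norm_toLp _ ((isTest_coe φ).memLp_gradient 2 (boxMeasure L))
  rw [← n4, ← n2, ← ng] at h'
  have hn := WithLp.prod_norm_sq_eq_of_L2 (pairBox L φ)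
  rw [pairBox_fst, pairBox_snd] at hn
  have hc : embeddingConst ^ 4 = 4 * quarticValue.toReal := by
    rw [embeddingConst, show 4 = 2 * 2 from rfl, pow_mul, Real.sq_sqrt (Real.sqrt_nonneg _),
      Real.sq_sqrt (by positivity)]
  refine le_of_pow_le_pow_left₀ (n := 4) (by norm_num)
    (mul_nonneg (Real.sqrt_nonneg _) (norm_nonneg _)) (h'.trans ?_)
  rw [mul_pow, hc, mul_assoc]
  refine mul_le_mul_of_nonneg_left ?_ (by positivity)
  have : ‖pairBox L φ‖ ^ 4 = (‖toLpBox L 2 φ‖ ^ 2 + ‖gradBox L φ‖ ^ 2) ^ 2 := by rw [← hn]; ring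
  rw [this]
  nlinarith [sq_nonneg (‖toLpBox L 2 φ‖ ^ 2), sq_nonneg (‖gradBox L φ‖ ^ 2),
    mul_nonneg (sq_nonneg ‖toLpBox L 2 φ‖) (sq_nonneg ‖gradBox L φ‖)]

/-- By Ladyzhenskaya's inequality, convergence in `H¹₀(Q_L)` implies convergence in `L⁴(Q_L)`. -/
lemma exists_tendsto_toLpBox_four {p : PairSpace L} {φ : ℕ → boxTests L}
    (h : Tendsto (fun k => pairBox L (φ k)) atTop (𝓝 p)) :
    ∃ F : Lp ℝ 4 (boxMeasure L), F =ᵐ[boxMeasure L] p.fst ∧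
      Tendsto (fun k => toLpBox L 4 (φ k)) atTop (𝓝 F) ∧ ‖F‖ ≤ embeddingConst * ‖p‖ := by
  have hc : CauchySeq (fun k => toLpBox L 4 (φ k)) := by
    have h1 := h.cauchySeq
    rw [Metric.cauchySeq_iff] at h1 ⊢
    intro ε hε
    have hC : 0 ≤ embeddingConst := Real.sqrt_nonneg _
    obtain ⟨N, hN⟩ := h1 (ε / (embeddingConst + 1)) (by positivity)
    refine ⟨N, fun m hm n hn => ?_⟩
    have h2 := hN m hm n hn
    rw [dist_eq_norm, ← map_sub] at h2 ⊢
    refine (norm_toLpBox_four_le _).trans_lt ?_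
    rw [lt_div_iff₀ (by positivity)] at h2
    have := norm_nonneg (pairBox L (φ m - φ n))
    nlinarith
  obtain ⟨F, hF⟩ := cauchySeq_tendsto_of_complete hc
  refine ⟨F, ?_, hF, ?_⟩
  · have h4 := tendstoInMeasure_of_tendsto_Lp hF
    have h2 := tendstoInMeasure_of_tendsto_Lp (tendsto_pairSpace_iff.1 h).1
    have h4' : TendstoInMeasure (boxMeasure L) (fun k => (φ k : Plane → ℝ)) atTop F :=
      TendstoInMeasure.congr_left (fun k => coeFn_toLpBox (φ k) 4) h4
    have h2' : TendstoInMeasure (boxMeasure L) (fun k => (φ k : Plane → ℝ)) atTop p.fst :=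
      TendstoInMeasure.congr_left (fun k => coeFn_toLpBox (φ k) 2) h2
    exact tendstoInMeasure_ae_unique h4' h2'
  · exact le_of_tendsto_of_tendsto hF.norm (h.norm.const_mul _)
      (Eventually.of_forall fun k => norm_toLpBox_four_le _)

lemma exists_lift_four (p : dirichletSpace L) :
    ∃ F : Lp ℝ 4 (boxMeasure L), F =ᵐ[boxMeasure L] (p : PairSpace L).fst ∧
      ‖F‖ ≤ embeddingConst * ‖p‖ := by
  obtain ⟨φ, hφ⟩ := mem_dirichletSpace_iff_seq.1 p.2
  obtain ⟨F, h1, _, h3⟩ := exists_tendsto_toLpBox_four hφ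
  exact ⟨F, h1, h3⟩

/-- The embedding `H¹₀(Q_L) → L⁴(Q_L)`. -/
def embedFour (L : ℝ) : dirichletSpace L →L[ℝ] Lp ℝ 4 (boxMeasure L) :=
  LinearMap.mkContinuous
    { toFun := fun p => (exists_lift_four p).choose
      map_add' := fun p q => by
        refine Lp.ext ?_
        have e : (↑(p + q) : PairSpace L).fst = (p : PairSpace L).fst + (q : PairSpace L).fst := rfl
        filter_upwards [(exists_lift_four p).choose_spec.1, (exists_lift_four q).choose_spec.1,
          (exists_lift_four (p + q)).choose_spec.1, Lp.coeFn_add (p : PairSpace L).fst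
          (q : PairSpace L).fst, Lp.coeFn_add (exists_lift_four p).choose
          (exists_lift_four q).choose] with x h1 h2 h3 h4 h5
        rw [h3, e, h4, h5, Pi.add_apply, Pi.add_apply, h1, h2]
      map_smul' := fun c p => by
        refine Lp.ext ?_
        have e : (↑(c • p) : PairSpace L).fst = c • (p : PairSpace L).fst := rfl
        filter_upwards [(exists_lift_four p).choose_spec.1,
          (exists_lift_four (c • p)).choose_spec.1, Lp.coeFn_smul c (p : PairSpace L).fst,
          Lp.coeFn_smul c (exists_lift_four p).choose] with x h1 h3 h4 h5
        rw [h3, e, h4, RingHom.id_apply, h5, Pi.smul_apply, Pi.smul_apply, h1] }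
    embeddingConst fun p => (exists_lift_four p).choose_spec.2

lemma coeFn_embedFour (p : dirichletSpace L) :
    embedFour L p =ᵐ[boxMeasure L] (p : PairSpace L).fst := (exists_lift_four p).choose_spec.1

/-- A test function as an element of `H¹₀(Q_L)`. -/
def testPair (L : ℝ) : boxTests L →ₗ[ℝ] dirichletSpace L :=
  (pairBox L).codRestrict _ fun φ =>
    Submodule.le_topologicalClosure _ (LinearMap.mem_range_self _ φ)

@[simp] lemma coe_testPair (φ : boxTests L) : (testPair L φ : PairSpace L) = pairBox L φ := rfl

lemma denseRange_testPair : DenseRange (testPair L) := by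
  intro p
  rw [mem_closure_iff_seq_limit]
  obtain ⟨φ, hφ⟩ := mem_dirichletSpace_iff_seq.1 p.2
  exact ⟨fun k => testPair L (φ k), fun k => ⟨φ k, rfl⟩, tendsto_subtype_rng.2 hφ⟩

lemma coeFn_embedFour_testPair (φ : boxTests L) :
    embedFour L (testPair L φ) =ᵐ[boxMeasure L] (φ : Plane → ℝ) :=
  (coeFn_embedFour _).trans (coeFn_toLpBox φ 2)

end DirichletSpace

/-! ### The form of the Schrödinger operator and its eigenfunctions -/

section Form

variable {L : ℝ}

/-- The function underlying an element of `H¹₀(Q_L)`. -/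
def dirichletFst (L : ℝ) : dirichletSpace L →L[ℝ] L2Box L :=
  (WithLp.fstL 2 ℝ (L2Box L) (Lp Plane 2 (boxMeasure L))) ∘L (dirichletSpace L).subtypeL

/-- The gradient of an element of `H¹₀(Q_L)`. -/
def dirichletSnd (L : ℝ) : dirichletSpace L →L[ℝ] Lp Plane 2 (boxMeasure L) :=
  (WithLp.sndL 2 ℝ (L2Box L) (Lp Plane 2 (boxMeasure L))) ∘L (dirichletSpace L).subtypeL

/-- The product `L⁴ × L⁴ → L²`. -/
def mulFour (L : ℝ) :
    Lp ℝ 4 (boxMeasure L) →L[ℝ] Lp ℝ 4 (boxMeasure L) →L[ℝ] L2Box L :=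
  (ContinuousLinearMap.mul ℝ ℝ).holderL (boxMeasure L) 4 4 2

lemma coeFn_mulFour (F G : Lp ℝ 4 (boxMeasure L)) :
    mulFour L F G =ᵐ[boxMeasure L] fun x => F x * G x :=
  (ContinuousLinearMap.mul ℝ ℝ).coeFn_holder F G

/-- The symmetric bilinear form of `Δ + V` on `H¹₀(Q_L)`. -/
def boxForm (V : L2Box L) : dirichletSpace L →ₗ[ℝ] dirichletSpace L →ₗ[ℝ] ℝ :=
  LinearMap.mk₂ ℝ (fun p q => -inner ℝ (dirichletSnd L p) (dirichletSnd L q) +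
      inner ℝ V (mulFour L (embedFour L p) (embedFour L q)))
    (by
      intro p p' q
      simp only [map_add, inner_add_left, inner_add_right, add_apply]
      ring)
    (by
      intro c p q
      simp only [map_smul, inner_smul_left, inner_smul_right, smul_apply,
        smul_eq_mul, conj_trivial]
      ring)
    (by
      intro p q q'
      simp only [map_add, inner_add_right]
      ring)
    (by
      intro c p q
      simp only [map_smul, inner_smul_right, smul_eq_mul]
      ring)

lemma boxForm_apply (V : L2Box L) (p q : dirichletSpace L) :
    boxForm V p q = -inner ℝ (dirichletSnd L p) (dirichletSnd L q) +
      inner ℝ V (mulFour L (embedFour L p) (embedFour L q)) := rfl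

lemma boxForm_comm (V : L2Box L) (p q : dirichletSpace L) : boxForm V p q = boxForm V q p := by
  have : mulFour L (embedFour L p) (embedFour L q) = mulFour L (embedFour L q) (embedFour L p) := by
    refine Lp.ext ?_
    filter_upwards [coeFn_mulFour (embedFour L p) (embedFour L q),
      coeFn_mulFour (embedFour L q) (embedFour L p)] with x h1 h2
    rw [h1, h2, mul_comm]
  rw [boxForm_apply, boxForm_apply, this, real_inner_comm]

lemma tendsto_boxForm {ι : Type*} {l : Filter ι} {v : ι → L2Box L} {u w : ι → dirichletSpace L}
    {V : L2Box L} {p q : dirichletSpace L} (hv : Tendsto v l (𝓝 V)) (hu : Tendsto u l (𝓝 p))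
    (hw : Tendsto w l (𝓝 q)) :
    Tendsto (fun k => boxForm (v k) (u k) (w k)) l (𝓝 (boxForm V p q)) := by
  simp only [boxForm_apply]
  have h1 := ((dirichletSnd L).continuous.tendsto p).comp hu
  have h2 := ((dirichletSnd L).continuous.tendsto q).comp hw
  have h3 := ((embedFour L).continuous.tendsto p).comp hu
  have h4 := ((embedFour L).continuous.tendsto q).comp hw
  have hc : Continuous fun z : Lp ℝ 4 (boxMeasure L) × Lp ℝ 4 (boxMeasure L) =>
    mulFour L z.1 z.2 := by fun_prop
  have h5 := (hc.tendsto (embedFour L p, embedFour L q)).comp (h3.prodMk_nhds h4)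
  exact (h1.inner h2).neg.add (hv.inner h5)

/-- The restriction of a test potential to the box. -/
def potBox (L : ℝ) {V : Plane → ℝ} (hV : IsTest V) : L2Box L := (hV.memLp 2 (boxMeasure L)).toLp

lemma coeFn_potBox {V : Plane → ℝ} (hV : IsTest V) : potBox L hV =ᵐ[boxMeasure L] V :=
  MemLp.coeFn_toLp (hV.memLp 2 (boxMeasure L))

lemma inner_testPair (h : L2Box L) (φ : boxTests L) :
    inner ℝ h (dirichletFst L (testPair L φ)) =
      ∫ x, h x * (φ : Plane → ℝ) x ∂(boxMeasure L) := by
  rw [L2.inner_def]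
  refine integral_congr_ae ?_
  filter_upwards [coeFn_toLpBox φ 2] with x hx
  have : (dirichletFst L (testPair L φ)) x = (φ : Plane → ℝ) x := hx
  rw [this]
  simp [mul_comm]

lemma boxForm_testPair_right (V : L2Box L) (p : dirichletSpace L) (φ : boxTests L) :
    boxForm V p (testPair L φ) = ∫ x, (-inner ℝ ((p : PairSpace L).snd x)
      (gradient (φ : Plane → ℝ) x) + V x * (p : PairSpace L).fst x * (φ : Plane → ℝ) x)
        ∂(boxMeasure L) := by
  rw [boxForm_apply, L2.inner_def, L2.inner_def, ← integral_neg, ← integral_add]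
  · refine integral_congr_ae ?_
    filter_upwards [coeFn_mulFour (embedFour L p) (embedFour L (testPair L φ)), coeFn_embedFour p,
      coeFn_embedFour_testPair φ, coeFn_gradBox φ] with x h1 h2 h3 h4
    have e1 : (dirichletSnd L (testPair L φ)) x = gradient (φ : Plane → ℝ) x := h4
    rw [h1, h2, h3, e1]
    have e2 : (dirichletSnd L p) x = (p : PairSpace L).snd x := rfl
    rw [e2]
    simp
    ring
  · exact (L2.integrable_inner _ _).fun_neg
  · exact L2.integrable_inner _ _

lemma boxForm_potBox_testPair {V : Plane → ℝ} (hV : IsTest V) (φ ψ : boxTests L) :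
    boxForm (potBox L hV) (testPair L φ) (testPair L ψ) = energyForm V φ ψ := by
  have hset : ∫ x in box L, (-inner ℝ (gradient (φ : Plane → ℝ) x) (gradient (ψ : Plane → ℝ) x) +
      V x * ((φ : Plane → ℝ) x * (ψ : Plane → ℝ) x)) = energyForm V φ ψ :=
    setIntegral_eq_integral_of_forall_compl_eq_zero fun x hx => by
      rw [boxTest_eq_zero φ hx, boxTest_gradient_eq_zero φ hx]
      simp
  rw [boxForm_testPair_right, ← hset]
  refine integral_congr_ae ?_
  filter_upwards [coeFn_potBox (L := L) hV, coeFn_toLpBox φ 2, coeFn_gradBox φ] with x h1 h2 h3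
  rw [coe_testPair, pairBox_fst, pairBox_snd, h1, h2, h3, mul_assoc]

lemma inner_testPair_testPair (φ ψ : boxTests L) :
    inner ℝ (dirichletFst L (testPair L φ)) (dirichletFst L (testPair L ψ)) =
      ∫ x, (φ : Plane → ℝ) x * (ψ : Plane → ℝ) x := by
  have hset : ∫ x in box L, (φ : Plane → ℝ) x * (ψ : Plane → ℝ) x =
      ∫ x, (φ : Plane → ℝ) x * (ψ : Plane → ℝ) x :=
    setIntegral_eq_integral_of_forall_compl_eq_zero fun x hx => by
      rw [boxTest_eq_zero φ hx, zero_mul]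
  rw [inner_testPair, ← hset]
  refine integral_congr_ae ?_
  filter_upwards [coeFn_toLpBox φ 2] with x h1
  have : (dirichletFst L (testPair L φ)) x = (φ : Plane → ℝ) x := h1
  rw [this]

/-- Pairs `(f, ∇f)` in `H¹₀(Q_L)` for which `Δ f + V f = ν f` holds in form sense. -/
def eigenPairs (V : L2Box L) (ν : ℝ) : Submodule ℝ (dirichletSpace L) where
  carrier := {p | ∀ q, boxForm V p q = ν * inner ℝ (dirichletFst L p) (dirichletFst L q)}
  add_mem' {p p'} hp hp' q := by
    rw [map_add, LinearMap.add_apply, hp q, hp' q, map_add, inner_add_left, mul_add]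
  zero_mem' q := by simp
  smul_mem' c p hp q := by
    rw [map_smul, LinearMap.smul_apply, hp q, map_smul, inner_smul_left, smul_eq_mul]
    simp; ring

/-- Test functions being dense in `H¹₀(Q_L)`, the weak equation may be tested against all of
`H¹₀(Q_L)`, because the form is continuous there. -/
lemma schrodingerGraph_iff {V f h : L2Box L} : SchrodingerGraph L V f h ↔
    ∃ p : dirichletSpace L, dirichletFst L p = f ∧
      ∀ q, boxForm V p q = inner ℝ h (dirichletFst L q) := by
  have key : ∀ p : dirichletSpace L, (∀ q, boxForm V p q = inner ℝ h (dirichletFst L q)) ↔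
      ∀ φ : boxTests L, boxForm V p (testPair L φ) =
        inner ℝ h (dirichletFst L (testPair L φ)) := by
    intro p
    refine ⟨fun H φ => H _, fun H q => ?_⟩
    have hcont : Continuous fun q => boxForm V p q := by
      rw [continuous_iff_continuousAt]
      exact fun q => tendsto_boxForm tendsto_const_nhds tendsto_const_nhds tendsto_id
    have hcont' : Continuous fun q => (inner ℝ h (dirichletFst L q) : ℝ) := by fun_prop
    exact congrFun (denseRange_testPair.equalizer hcont hcont' (funext H)) q
  constructor
  · rintro ⟨g, hg, hw⟩
    let P : PairSpace L := WithLp.toLp 2 (f, g)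
    have hP : P ∈ dirichletSpace L := mem_dirichletSpace_iff.2 hg
    refine ⟨⟨P, hP⟩, rfl, (key _).2 fun φ => ?_⟩
    rw [boxForm_testPair_right, inner_testPair]
    exact hw φ φ.2
  · rintro ⟨p, rfl, hw⟩
    refine ⟨(p : PairSpace L).snd, mem_dirichletSpace_iff.1 p.2, fun φ hφ => ?_⟩
    have := hw (testPair L ⟨φ, hφ⟩)
    rw [boxForm_testPair_right, inner_testPair] at this
    exact this

/-- The eigenspaces of `Δ + V` consist of the first components of the eigenpairs. -/
lemma eigenspace_eq_map (V : L2Box L) (ν : ℝ) :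
    eigenspace L V ν = ((eigenPairs V ν).map (dirichletFst L).toLinearMap : Submodule ℝ _) := by
  ext f
  rw [eigenspace, mem_ofPred_eq, schrodingerGraph_iff]
  constructor
  · rintro ⟨p, rfl, h⟩
    refine ⟨p, fun q => ?_, rfl⟩
    rw [h q, inner_smul_left]; rfl
  · rintro ⟨p, hp, rfl⟩
    refine ⟨p, rfl, fun q => ?_⟩
    rw [hp q]
    exact (inner_smul_left _ _ _).symm

/-- The span of the eigenpairs to eigenvalues `≥ x`. -/
def eigenPairsAbove (V : L2Box L) (x : ℝ) : Submodule ℝ (dirichletSpace L) :=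
  ⨆ ν ∈ Ici x, eigenPairs V ν

lemma span_eigenspaces (V : L2Box L) (x : ℝ) :
    Submodule.span ℝ (⋃ ν ∈ Ici x, eigenspace L V ν) =
      (eigenPairsAbove V x).map (dirichletFst L).toLinearMap := by
  simp_rw [eigenspace_eq_map, eigenPairsAbove, Submodule.map_iSup, Submodule.span_iUnion,
    Submodule.span_eq]

/-- The form of `Δ + V` is at least `x` on the span of the eigenfunctions to eigenvalues `≥ x`,
because eigenfunctions to different eigenvalues are orthogonal. -/
lemma le_boxForm_of_mem_eigenPairsAbove {V : L2Box L} {x : ℝ} {p : dirichletSpace L}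
    (hp : p ∈ eigenPairsAbove V x) : x * ‖dirichletFst L p‖ ^ 2 ≤ boxForm V p p := by
  rw [eigenPairsAbove, iSup_subtype', Submodule.mem_iSup_iff_exists_finsupp] at hp
  obtain ⟨v, hv, rfl⟩ := hp
  have hv' : ∀ ν : Ici x, ∀ q, boxForm V (v ν) q =
    ν * inner ℝ (dirichletFst L (v ν)) (dirichletFst L q) := fun ν => hv ν
  have horth : ∀ ν ν' : Ici x, ν ≠ ν' →
      inner ℝ (dirichletFst L (v ν)) (dirichletFst L (v ν')) = (0 : ℝ) := by
    intro ν ν' hne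
    have h1 := hv' ν (v ν')
    rw [boxForm_comm, hv' ν' (v ν), real_inner_comm] at h1
    exact (mul_eq_mul_right_iff.1 h1).resolve_left fun h => hne (Subtype.ext h.symm)
  have hsum : ∀ ν ∈ v.support,
      inner ℝ (dirichletFst L (v ν)) (dirichletFst L (v.sum fun _ y => y)) =
        ‖dirichletFst L (v ν)‖ ^ 2 := by
    intro ν hν
    rw [Finsupp.sum, map_sum, inner_sum, Finset.sum_eq_single ν]
    · exact real_inner_self_eq_norm_sq _
    · exact fun ν' _ hne => horth ν ν' hne.symm
    · exact fun h => absurd hν h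
  have h1 : boxForm V (v.sum fun _ y => y) (v.sum fun _ y => y) =
      ∑ ν ∈ v.support, (ν : ℝ) * ‖dirichletFst L (v ν)‖ ^ 2 := by
    conv_lhs => rw [Finsupp.sum, map_sum (boxForm V), LinearMap.sum_apply]
    refine Finset.sum_congr rfl fun ν hν => ?_
    rw [hv' ν, ← hsum ν hν]
    rfl
  have h2 : ‖dirichletFst L (v.sum fun _ y => y)‖ ^ 2 =
      ∑ ν ∈ v.support, ‖dirichletFst L (v ν)‖ ^ 2 := by
    rw [← real_inner_self_eq_norm_sq]
    conv_lhs => rw [Finsupp.sum, map_sum, sum_inner]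
    refine Finset.sum_congr rfl fun ν hν => ?_
    rw [← hsum ν hν, Finsupp.sum, map_sum]
  rw [h1, h2, Finset.mul_sum]
  exact Finset.sum_le_sum fun ν _ => mul_le_mul_of_nonneg_right ν.2 (sq_nonneg _)

end Form

/-! ### Approximation of eigenfunctions by test functions -/

section Approximation

variable {L : ℝ}

lemma exists_orthonormal_of_le_rank {E : Type*} [NormedAddCommGroup E] [InnerProductSpace ℝ E]
    {S : Submodule ℝ E} {n : ℕ} (h : (n : Cardinal) ≤ Module.rank ℝ S) :
    ∃ v : Fin n → E, Orthonormal ℝ v ∧ ∀ i, v i ∈ S := by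
  obtain ⟨s, hs, hli⟩ := le_rank_iff_exists_linearIndependent_finset.1 h
  let e := (Fintype.equivFinOfCardEq (by simpa using hs : Fintype.card s = n)).symm
  have ho := InnerProductSpace.gramSchmidtNormed_orthonormal (𝕜 := ℝ) (hli.comp e e.injective)
  exact ⟨_, ho.comp_linearIsometry S.subtypeₗᵢ, fun i => Subtype.coe_prop _⟩

/-- Expansion of a form in the coefficients, shifted by a multiple of the norm, for vectors that are
orthonormal under a linear map. -/
lemma sum_shifted_form {D E : Type*} [AddCommGroup D] [Module ℝ D] [NormedAddCommGroup E]
    [InnerProductSpace ℝ E] (B : D →ₗ[ℝ] D →ₗ[ℝ] ℝ) (T : D →ₗ[ℝ] E) {n : ℕ} (p : Fin n → D)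
    (c : ℝ) (a : Fin n → ℝ) :
    ∑ i, ∑ j, a i * a j * (B (p i) (p j) - c * inner ℝ (T (p i)) (T (p j))) =
      B (∑ i, a i • p i) (∑ i, a i • p i) - c * ‖T (∑ i, a i • p i)‖ ^ 2 := by
  rw [← real_inner_self_eq_norm_sq]
  simp only [map_sum, map_smul, LinearMap.sum_apply, LinearMap.smul_apply, smul_eq_mul, sum_inner,
    inner_sum, inner_smul_left, inner_smul_right, conj_trivial, Finset.mul_sum, mul_sub,
    Finset.sum_sub_distrib]
  congr 1
  · rw [Finset.sum_comm]
    exact Finset.sum_congr rfl fun i _ => Finset.sum_congr rfl fun j _ => by ring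
  · exact Finset.sum_congr rfl fun i _ => Finset.sum_congr rfl fun j _ => by
      rw [real_inner_comm (T (p i)) (T (p j))]; ring

lemma norm_sq_sum_orthonormal {E : Type*} [NormedAddCommGroup E] [InnerProductSpace ℝ E] {n : ℕ}
    {v : Fin n → E} (hv : Orthonormal ℝ v) (a : Fin n → ℝ) :
    ‖∑ i, a i • v i‖ ^ 2 = ∑ i, a i ^ 2 := by
  rw [← real_inner_self_eq_norm_sq, hv.inner_sum]
  simp [pow_two]

/-- Positive definiteness of quadratic forms in finitely many variables is stable under small
perturbations of the coefficients. -/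
lemma eventually_quadratic_ge {n : ℕ} {M : ℕ → Fin n → Fin n → ℝ} {M' : Fin n → Fin n → ℝ}
    (hM : ∀ i j, Tendsto (fun k => M k i j) atTop (𝓝 (M' i j))) {ε : ℝ} (hε : 0 < ε)
    (h : ∀ a : Fin n → ℝ, ε * ∑ i, a i ^ 2 ≤ ∑ i, ∑ j, a i * a j * M' i j) :
    ∀ᶠ k in atTop, ∀ a : Fin n → ℝ, ε / 2 * ∑ i, a i ^ 2 ≤ ∑ i, ∑ j, a i * a j * M k i j := by
  set η := ε / (2 * (n + 1)) with hη
  have hη0 : 0 < η := by positivity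
  have hev : ∀ᶠ k in atTop, ∀ i j, |M k i j - M' i j| < η := by
    rw [eventually_all]; intro i
    rw [eventually_all]; intro j
    have := (hM i j).eventually (Metric.ball_mem_nhds _ hη0)
    simpa [Real.dist_eq] using this
  filter_upwards [hev] with k hk a
  have hterm : ∀ i j, a i * a j * M' i j - η * ((a i ^ 2 + a j ^ 2) / 2) ≤ a i * a j * M k i j := by
    intro i j
    have h1 : |a i * a j * (M k i j - M' i j)| ≤ (a i ^ 2 + a j ^ 2) / 2 * η := by
      rw [abs_mul]
      refine mul_le_mul ?_ (hk i j).le (abs_nonneg _) (by positivity)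
      rw [abs_mul]
      nlinarith [sq_nonneg (|a i| - |a j|), sq_abs (a i), sq_abs (a j)]
    have h2 := neg_le_of_abs_le h1
    linarith
  have hs : ∑ i, ∑ j, (a i * a j * M' i j - η * ((a i ^ 2 + a j ^ 2) / 2)) ≤
      ∑ i, ∑ j, a i * a j * M k i j :=
    Finset.sum_le_sum fun i _ => Finset.sum_le_sum fun j _ => hterm i j
  have e : ∑ i : Fin n, ∑ j : Fin n, η * ((a i ^ 2 + a j ^ 2) / 2) = η * (n * ∑ i, a i ^ 2) := by
    simp_rw [← Finset.mul_sum, add_div, Finset.sum_add_distrib]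
    congr 1
    rw [Finset.sum_const, Finset.card_univ, Fintype.card_fin, nsmul_eq_mul]
    simp_rw [Finset.sum_const, Finset.card_univ, Fintype.card_fin, nsmul_eq_mul]
    rw [← Finset.mul_sum, ← Finset.sum_div]
    ring
  simp_rw [Finset.sum_sub_distrib] at hs
  rw [e] at hs
  have hS : 0 ≤ ∑ i, a i ^ 2 := Finset.sum_nonneg fun i _ => sq_nonneg _
  have h3 : η * (n * ∑ i, a i ^ 2) ≤ ε / 2 * ∑ i, a i ^ 2 := by
    have : η * n ≤ ε / 2 := by
      rw [hη, div_mul_eq_mul_div, div_le_div_iff₀ (by positivity) (by norm_num)]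
      nlinarith
    nlinarith
  have := h a
  linarith

/-- Test potentials approximate a potential on the box, with control of the norm on the plane. -/
lemma exists_testPotentials (V : L2Box L) : ∃ (W : ℕ → Plane → ℝ) (hW : ∀ k, IsTest (W k)),
    Tendsto (fun k => potBox L (hW k)) atTop (𝓝 V) ∧
      Tendsto (fun k => ∫ x, W k x ^ 2) atTop (𝓝 (‖V‖ ^ 2)) := by
  have hbox : MeasurableSet (box L) := (isClosed_box L).measurableSet
  set f : Plane → ℝ := (box L).indicator V with hf
  have hfm : MemLp f 2 volume := (memLp_indicator_iff_restrict hbox).2 (Lp.memLp V)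
  have hex : ∀ k : ℕ, ∃ g, HasCompactSupport g ∧ ContDiff ℝ ∞ g ∧
      eLpNorm (f - g) 2 volume ≤ ENNReal.ofReal (1 / ((k : ℝ) + 1)) := fun k =>
    hfm.exist_eLpNorm_sub_le (by norm_num) (by norm_num) (by positivity)
  choose W hW1 hW2 hW3 using hex
  have hW : ∀ k, IsTest (W k) := fun k => ⟨hW2 k, hW1 k⟩
  have hlim : Tendsto (fun k => eLpNorm (W k - f) 2 volume) atTop (𝓝 0) := by
    have h0 : Tendsto (fun k : ℕ => ENNReal.ofReal (1 / ((k : ℝ) + 1))) atTop (𝓝 0) := by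
      have := ENNReal.tendsto_ofReal (tendsto_one_div_add_atTop_nhds_zero_nat (𝕜 := ℝ))
      simpa using this
    refine tendsto_of_tendsto_of_tendsto_of_le_of_le tendsto_const_nhds h0 (fun k => zero_le)
      fun k => ?_
    rw [eLpNorm_sub_comm]
    exact hW3 k
  refine ⟨W, hW, ?_, ?_⟩
  · rw [Lp.tendsto_Lp_iff_tendsto_eLpNorm']
    refine tendsto_of_tendsto_of_tendsto_of_le_of_le tendsto_const_nhds hlim (fun k => zero_le)
      fun k => ?_
    have : eLpNorm (⇑(potBox L (hW k)) - ⇑V) 2 (boxMeasure L) =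
        eLpNorm (W k - f) 2 (boxMeasure L) := by
      refine eLpNorm_congr_ae ?_
      filter_upwards [coeFn_potBox (L := L) (hW k), ae_restrict_mem hbox] with x hx hxb
      rw [Pi.sub_apply, Pi.sub_apply, hx, hf, indicator_of_mem hxb]
    rw [this]
    exact eLpNorm_restrict_le _ _ _ _
  · have h1 : Tendsto (fun k => ((hW k).memLp 2 volume).toLp) atTop (𝓝 hfm.toLp) :=
      (Lp.tendsto_Lp_iff_tendsto_eLpNorm'' W (fun k => (hW k).memLp 2 volume) f hfm).2 hlim
    have h2 := h1.norm.pow 2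
    have h3 : ∀ k, ‖((hW k).memLp 2 volume).toLp‖ ^ 2 = ∫ x, W k x ^ 2 := fun k => by
      rw [← real_inner_self_eq_norm_sq, L2.inner_def]
      refine integral_congr_ae ?_
      filter_upwards [((hW k).memLp 2 volume).coeFn_toLp] with x hx
      rw [hx]; simp [pow_two]
    have h4 : ‖hfm.toLp‖ = ‖V‖ := by
      rw [Lp.norm_toLp, Lp.norm_def, hf, eLpNorm_indicator_eq_eLpNorm_restrict hbox]
    simp_rw [h3, h4] at h2
    exact h2

/-- If `n` eigenvalues of `Δ + V` lie above `x`, then up to `ε` there is an `n`-dimensional trial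
space at level `x`: orthonormal vectors in the span of the eigenfunctions, and `V` itself, are
approximated by test functions, and the forms converge. -/
lemma exists_trialSpace_of_atLeastEigenvaluesAbove {V : L2Box L} {n : ℕ} {x : ℝ}
    (h : AtLeastEigenvaluesAbove L V n x) {ε : ℝ} (hε : 0 < ε) :
    ∃ W F, TrialSpace n W F (‖V‖ ^ 2 + ε) (x - ε) := by
  rw [AtLeastEigenvaluesAbove, span_eigenspaces] at h
  obtain ⟨v, hv, hvmem⟩ := exists_orthonormal_of_le_rank h
  have hlift : ∀ i, ∃ p ∈ eigenPairsAbove V x, dirichletFst L p = v i := hvmem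
  choose p hp hpv using hlift
  have happ : ∀ i, ∃ φ : ℕ → boxTests L,
      Tendsto (fun k => testPair L (φ k)) atTop (𝓝 (p i)) := fun i => by
    obtain ⟨φ, hφ⟩ := mem_dirichletSpace_iff_seq.1 (p i).2
    exact ⟨φ, tendsto_subtype_rng.2 hφ⟩
  choose φ hφ using happ
  obtain ⟨W, hW, hWV, hWn⟩ := exists_testPotentials V
  have hcomb : ∀ a : Fin n → ℝ, ‖dirichletFst L (∑ i, a i • p i)‖ ^ 2 = ∑ i, a i ^ 2 := by
    intro a
    rw [← norm_sq_sum_orthonormal hv, map_sum]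
    simp_rw [map_smul, hpv]
  have hexp := sum_shifted_form (boxForm V) (dirichletFst L).toLinearMap p
  simp only [ContinuousLinearMap.coe_coe] at hexp
  have hN : ∀ i j, Tendsto (fun k => ∫ y, (φ i k : Plane → ℝ) y * (φ j k : Plane → ℝ) y) atTop
      (𝓝 (inner ℝ (dirichletFst L (p i)) (dirichletFst L (p j)))) := by
    intro i j
    simp_rw [← inner_testPair_testPair]
    exact (((dirichletFst L).continuous.tendsto _).comp (hφ i)).inner
      (((dirichletFst L).continuous.tendsto _).comp (hφ j))
  have hE : ∀ i j, Tendsto (fun k => energyForm (W k) (φ i k) (φ j k)) atTop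
      (𝓝 (boxForm V (p i) (p j))) := by
    intro i j
    simp_rw [← boxForm_potBox_testPair (hW _)]
    exact tendsto_boxForm hWV (hφ i) (hφ j)
  -- The approximating functions are eventually linearly independent, their mass being at least half
  -- the sum of the squares of the coefficients.
  have ev1 := eventually_quadratic_ge hN one_pos fun a => by
    have h1 := sum_shifted_form 0 (dirichletFst L).toLinearMap p (-1) a
    simp only [ContinuousLinearMap.coe_coe, LinearMap.zero_apply, hcomb] at h1
    simp only [zero_sub, neg_mul, one_mul, neg_neg] at h1
    rw [h1, one_mul]
  -- The shifted form `⟪(Δ + V - x + ε) u, u⟫` is at least `ε ‖u‖²` in the limit.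
  have ev2 := eventually_quadratic_ge
    (M := fun k i j => energyForm (W k) (φ i k) (φ j k) -
      (x - ε) * ∫ y, (φ i k : Plane → ℝ) y * (φ j k : Plane → ℝ) y)
    (fun i j => (hE i j).sub ((hN i j).const_mul (x - ε))) hε fun a => by
      have hmem : ∑ i, a i • p i ∈ eigenPairsAbove V x :=
        Submodule.sum_mem _ fun i _ => Submodule.smul_mem _ _ (hp i)
      have h1 := le_boxForm_of_mem_eigenPairsAbove hmem
      rw [hexp, hcomb]
      rw [hcomb] at h1
      linarith
  have ev3 : ∀ᶠ k in atTop, ∫ y, W k y ^ 2 < ‖V‖ ^ 2 + ε :=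
    hWn.eventually (gt_mem_nhds (by linarith))
  obtain ⟨k, hk1, hk2, hk3⟩ := (ev1.and (ev2.and ev3)).exists
  have hφt : ∀ i, IsTest (φ i k : Plane → ℝ) := fun i => isTest_coe (φ i k)
  refine ⟨W k, _, trialSpace_span (hW k) hk3.le hφt (fun a ha => ?_) fun a => ?_⟩
  · rw [integral_sq_linearCombination hφt]
    refine lt_of_lt_of_le ?_ (hk1 a)
    obtain ⟨i, hi⟩ := Function.ne_iff.1 ha
    have : 0 < ∑ i, a i ^ 2 := Finset.sum_pos' (fun i _ => sq_nonneg _)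
      ⟨i, Finset.mem_univ i, by have : a i ≠ 0 := hi
                                positivity⟩
    linarith
  · rw [integral_sq_linearCombination hφt, energy_linearCombination (hW k) hφt]
    have h1 := hk2 a
    have h2 : 0 ≤ ε / 2 * ∑ i, a i ^ 2 :=
      mul_nonneg (by linarith) (Finset.sum_nonneg fun i _ => sq_nonneg _)
    simp only [mul_sub, Finset.sum_sub_distrib] at h1
    have h3 : ∑ i, ∑ j, a i * a j * ((x - ε) * ∫ y, (φ i k : Plane → ℝ) y * (φ j k : Plane → ℝ) y) =
        (x - ε) * ∑ i, ∑ j, a i * a j * ∫ y, (φ i k : Plane → ℝ) y * (φ j k : Plane → ℝ) y := by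
      simp only [Finset.mul_sum]
      exact Finset.sum_congr rfl fun i _ => Finset.sum_congr rfl fun j _ => by ring
    rw [h3] at h1
    linarith

end Approximation

/-! ### Translation estimates -/

section Translation

/-- The Cauchy-Schwarz inequality against the constant function `1`. -/
lemma sq_lintegral_le {α : Type*} [MeasurableSpace α] {μ : Measure α} {f : α → ℝ≥0∞}
    (hf : AEMeasurable f μ) : (∫⁻ a, f a ∂μ) ^ 2 ≤ μ univ * ∫⁻ a, f a ^ 2 ∂μ := by
  have h := ENNReal.lintegral_mul_le_Lp_mul_Lq μ Real.HolderConjugate.two_two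
    (aemeasurable_const (b := (1 : ℝ≥0∞))) hf
  simp only [Pi.mul_apply, one_mul, ENNReal.rpow_two, one_pow, lintegral_one] at h
  calc (∫⁻ a, f a ∂μ) ^ 2 ≤ (μ univ ^ (1 / 2 : ℝ) * (∫⁻ a, f a ^ 2 ∂μ) ^ (1 / 2 : ℝ)) ^ 2 := by
        gcongr
    _ = μ univ * ∫⁻ a, f a ^ 2 ∂μ := by
        rw [mul_pow, ← ENNReal.rpow_mul_natCast, ← ENNReal.rpow_mul_natCast]; simp

/-- The increments of a test function are controlled by its gradient along segments. -/
lemma IsTest.enorm_sub_sq_le {f : Plane → ℝ} (hf : IsTest f) (x z : Plane) :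
    ‖f (x + z) - f x‖ₑ ^ 2 ≤
      ‖z‖ₑ ^ 2 * ∫⁻ t in Ioc (0 : ℝ) 1, ‖gradient f (x + t • z)‖ₑ ^ 2 := by
  have hder : ∀ t ∈ uIcc (0 : ℝ) 1, HasDerivAt (fun t : ℝ => f (x + t • z))
      (inner ℝ (gradient f (x + t • z)) z) t := by
    intro t _
    have h1 : HasDerivAt (fun t : ℝ => x + t • z) z t := by
      simpa using ((hasDerivAt_id t).smul_const z).const_add x
    have h2 := (hf.differentiable (x + t • z)).hasFDerivAt.comp_hasDerivAt t h1
    have e : inner ℝ (gradient f (x + t • z)) z = fderiv ℝ f (x + t • z) z := by simp [gradient]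
    rw [e]
    exact h2
  have hcont : Continuous fun t : ℝ => gradient f (x + t • z) :=
    hf.continuous_gradient.comp (by fun_prop)
  have hFTC := intervalIntegral.integral_eq_sub_of_hasDerivAt hder
    (Continuous.intervalIntegrable (by fun_prop) _ _)
  simp only [one_smul, zero_smul, add_zero] at hFTC
  rw [← hFTC, intervalIntegral.integral_of_le zero_le_one]
  calc ‖∫ t in Ioc (0 : ℝ) 1, (inner ℝ (gradient f (x + t • z)) z : ℝ)‖ₑ ^ 2
      ≤ (∫⁻ t in Ioc (0 : ℝ) 1, ‖(inner ℝ (gradient f (x + t • z)) z : ℝ)‖ₑ) ^ 2 := by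
        gcongr; exact enorm_integral_le_lintegral_enorm _
    _ ≤ 1 * ∫⁻ t in Ioc (0 : ℝ) 1, ‖(inner ℝ (gradient f (x + t • z)) z : ℝ)‖ₑ ^ 2 := by
        have := sq_lintegral_le (μ := volume.restrict (Ioc (0 : ℝ) 1))
          (f := fun t => ‖(inner ℝ (gradient f (x + t • z)) z : ℝ)‖ₑ)
          (hcont.inner continuous_const).enorm.aemeasurable
        simpa using this
    _ ≤ ∫⁻ t in Ioc (0 : ℝ) 1, ‖z‖ₑ ^ 2 * ‖gradient f (x + t • z)‖ₑ ^ 2 := by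
        rw [one_mul]
        refine lintegral_mono fun t => ?_
        rw [← mul_pow]
        gcongr
        rw [mul_comm, ← ofReal_norm, ← ofReal_norm, ← ofReal_norm,
          ← ENNReal.ofReal_mul (norm_nonneg _)]
        exact ENNReal.ofReal_le_ofReal (norm_inner_le_norm _ _)
    _ = _ := lintegral_const_mul' _ _ (by simp)

/-- Translations move a test function in `L²` by at most the length of the translation times the norm
of the gradient. -/
lemma IsTest.lintegral_translate_le {f : Plane → ℝ} (hf : IsTest f) (z : Plane) :
    ∫⁻ x, ‖f (x + z) - f x‖ₑ ^ 2 ≤ ‖z‖ₑ ^ 2 * ∫⁻ x, ‖gradient f x‖ₑ ^ 2 := by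
  have hc := hf.continuous_gradient
  calc ∫⁻ x, ‖f (x + z) - f x‖ₑ ^ 2
      ≤ ∫⁻ x, ‖z‖ₑ ^ 2 * ∫⁻ t in Ioc (0 : ℝ) 1, ‖gradient f (x + t • z)‖ₑ ^ 2 :=
        lintegral_mono fun x => hf.enorm_sub_sq_le x z
    _ = ‖z‖ₑ ^ 2 * ∫⁻ t in Ioc (0 : ℝ) 1, ∫⁻ x, ‖gradient f (x + t • z)‖ₑ ^ 2 := by
        rw [lintegral_const_mul' _ _ (by simp), lintegral_lintegral_swap]
        exact Continuous.aemeasurable (by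
          have : Continuous fun p : Plane × ℝ => gradient f (p.1 + p.2 • z) :=
            hc.comp (by fun_prop)
          exact (ENNReal.continuous_pow 2).comp this.enorm)
    _ = ‖z‖ₑ ^ 2 * ∫⁻ x, ‖gradient f x‖ₑ ^ 2 := by
        congr 1
        simp_rw [lintegral_add_right_eq_self (fun x => ‖gradient f x‖ₑ ^ 2)]
        simp

end Translation

/-! ### Averages over cells -/

section Cells

/-- The half-open square cells of side `h`. -/
def cell (h : ℝ) (k : Fin 2 → ℤ) : Set Plane := {x | ∀ i, ⌊x i / h⌋ = k i}

lemma measurableSet_cell (h : ℝ) (k : Fin 2 → ℤ) : MeasurableSet (cell h k) := by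
  simp only [cell, ofPred_forall]
  refine MeasurableSet.iInter fun i => ?_
  have : Measurable fun x : Plane => ⌊x i / h⌋ := by
    apply Int.measurable_floor.comp; fun_prop
  exact this (measurableSet_singleton (k i))

lemma cell_eq_preimage {h : ℝ} (hh : 0 < h) (k : Fin 2 → ℤ) :
    cell h k = WithLp.ofLp ⁻¹' (univ.pi fun i => Ico (k i * h) ((k i + 1) * h)) := by
  ext x
  simp [cell, Int.floor_eq_iff, le_div_iff₀ hh, div_lt_iff₀ hh]

lemma volume_cell {h : ℝ} (hh : 0 < h) (k : Fin 2 → ℤ) :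
    volume (cell h k) = ENNReal.ofReal (h ^ 2) := by
  rw [cell_eq_preimage hh, (PiLp.volume_preserving_ofLp (Fin 2)).measure_preimage
    (MeasurableSet.univ_pi fun i => measurableSet_Ico).nullMeasurableSet, volume_pi_pi]
  simp only [Real.volume_Ico, Fin.prod_univ_two]
  rw [← ENNReal.ofReal_mul (by nlinarith)]
  congr 1; ring

lemma cell_subset_closedBall {h : ℝ} (hh : 0 < h) {k : Fin 2 → ℤ} {x : Plane} (hx : x ∈ cell h k) :
    cell h k ⊆ Metric.closedBall x (2 * h) := by
  intro y hy
  rw [cell_eq_preimage hh] at hx hy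
  have hx' : ∀ i, k i * h ≤ x i ∧ x i < (k i + 1) * h := fun i => hx i (mem_univ i)
  have hy' : ∀ i, k i * h ≤ y i ∧ y i < (k i + 1) * h := fun i => hy i (mem_univ i)
  rw [Metric.mem_closedBall, EuclideanSpace.dist_eq, Real.sqrt_le_left (by positivity)]
  simp only [Fin.sum_univ_two, Real.dist_eq, sq_abs]
  have := hx' 0; have := hx' 1; have := hy' 0; have := hy' 1
  have h0 : (y 0 - x 0) ^ 2 ≤ h ^ 2 := sq_le_sq' (by linarith) (by linarith)
  have h1 : (y 1 - x 1) ^ 2 ≤ h ^ 2 := sq_le_sq' (by linarith) (by linarith)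
  nlinarith [sq_nonneg h]

/-- The deviation of a test function from its average on the cell containing a point. -/
lemma IsTest.enorm_sub_average_sq_le {f : Plane → ℝ} (hf : IsTest f) {h : ℝ} (hh : 0 < h)
    {k : Fin 2 → ℤ} {x : Plane} (hx : x ∈ cell h k) :
    ‖f x - (h ^ 2)⁻¹ * ∫ y in cell h k, f y‖ₑ ^ 2 ≤
      (ENNReal.ofReal (h ^ 2))⁻¹ *
        ∫⁻ z in Metric.closedBall (0 : Plane) (2 * h), ‖f (x + z) - f x‖ₑ ^ 2 := by
  have h2 : 0 < h ^ 2 := by positivity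
  have hv : ENNReal.ofReal (h ^ 2) ≠ 0 := by simpa using hh.ne'
  have hfin : volume (cell h k) ≠ ⊤ := by rw [volume_cell hh]; exact ENNReal.ofReal_ne_top
  have e1 : f x - (h ^ 2)⁻¹ * ∫ y in cell h k, f y = (h ^ 2)⁻¹ * ∫ y in cell h k, (f x - f y) := by
    rw [integral_sub (integrableOn_const (C := f x) hfin) hf.integrable.integrableOn,
      setIntegral_const,
      Measure.real, volume_cell hh, ENNReal.toReal_ofReal h2.le, smul_eq_mul]
    field_simp
  have e2 : ∫⁻ y in cell h k, ‖f x - f y‖ₑ ^ 2 ≤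
      ∫⁻ z in Metric.closedBall (0 : Plane) (2 * h), ‖f (x + z) - f x‖ₑ ^ 2 := by
    calc ∫⁻ y in cell h k, ‖f x - f y‖ₑ ^ 2
        ≤ ∫⁻ y in Metric.closedBall x (2 * h), ‖f x - f y‖ₑ ^ 2 :=
          lintegral_mono_set (cell_subset_closedBall hh hx)
      _ = ∫⁻ z, (Metric.closedBall x (2 * h)).indicator (fun y => ‖f x - f y‖ₑ ^ 2) (x + z) := by
          rw [lintegral_add_left_eq_self, lintegral_indicator measurableSet_closedBall]
      _ = _ := by
          rw [← lintegral_indicator measurableSet_closedBall]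
          refine lintegral_congr fun z => ?_
          simp only [indicator, Metric.mem_closedBall, dist_self_add_left, dist_zero_right]
          rw [enorm_sub_rev]
  rw [e1, enorm_mul, mul_pow]
  have e3 : ‖(h ^ 2)⁻¹‖ₑ = (ENNReal.ofReal (h ^ 2))⁻¹ := by
    rw [Real.enorm_eq_ofReal (by positivity), ENNReal.ofReal_inv_of_pos h2]
  rw [e3]
  calc (ENNReal.ofReal (h ^ 2))⁻¹ ^ 2 * ‖∫ y in cell h k, (f x - f y)‖ₑ ^ 2
      ≤ (ENNReal.ofReal (h ^ 2))⁻¹ ^ 2 *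
        (ENNReal.ofReal (h ^ 2) * ∫⁻ y in cell h k, ‖f x - f y‖ₑ ^ 2) := by
        gcongr
        calc ‖∫ y in cell h k, (f x - f y)‖ₑ ^ 2 ≤ (∫⁻ y in cell h k, ‖f x - f y‖ₑ) ^ 2 := by
              gcongr; exact enorm_integral_le_lintegral_enorm _
          _ ≤ _ := by
              have hm : Continuous f := hf.continuous
              have := sq_lintegral_le (μ := volume.restrict (cell h k))
                (f := fun y => ‖f x - f y‖ₑ) (by fun_prop)
              rwa [Measure.restrict_apply_univ, volume_cell hh] at this
    _ = (ENNReal.ofReal (h ^ 2))⁻¹ * ∫⁻ y in cell h k, ‖f x - f y‖ₑ ^ 2 := by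
        rw [pow_two, ← mul_assoc, mul_assoc _ _ (ENNReal.ofReal (h ^ 2)),
          ENNReal.inv_mul_cancel hv ENNReal.ofReal_ne_top, mul_one]
    _ ≤ _ := by gcongr

/-- The estimate for translations, averaged over the ball of radius `2 h`. -/
lemma IsTest.lintegral_translate_ball_le {f : Plane → ℝ} (hf : IsTest f) {h : ℝ} (hh : 0 < h) :
    (ENNReal.ofReal (h ^ 2))⁻¹ * ∫⁻ x, ∫⁻ z in Metric.closedBall (0 : Plane) (2 * h),
        ‖f (x + z) - f x‖ₑ ^ 2 ≤
      16 * volume (Metric.ball (0 : Plane) 1) * ENNReal.ofReal (h ^ 2) *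
        ∫⁻ x, ‖gradient f x‖ₑ ^ 2 := by
  have hv : ENNReal.ofReal (h ^ 2) ≠ 0 := by simpa using hh.ne'
  have hm : Continuous f := hf.continuous
  have h4 : ENNReal.ofReal (2 * h) ^ 2 = 4 * ENNReal.ofReal (h ^ 2) := by
    rw [← ENNReal.ofReal_pow (by positivity), mul_pow, ENNReal.ofReal_mul (by norm_num)]
    norm_num
  rw [lintegral_lintegral_swap (Continuous.aemeasurable (by
    have : Continuous fun p : Plane × Plane => f (p.1 + p.2) - f p.1 := by fun_prop
    simp only [Function.uncurry_def]
    exact (ENNReal.continuous_pow 2).comp this.enorm))]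
  calc (ENNReal.ofReal (h ^ 2))⁻¹ * ∫⁻ z in Metric.closedBall (0 : Plane) (2 * h), ∫⁻ x,
        ‖f (x + z) - f x‖ₑ ^ 2
      ≤ (ENNReal.ofReal (h ^ 2))⁻¹ * ∫⁻ z in Metric.closedBall (0 : Plane) (2 * h),
        (4 * ENNReal.ofReal (h ^ 2)) * ∫⁻ x, ‖gradient f x‖ₑ ^ 2 := by
        refine mul_le_mul' le_rfl ?_
        refine setLIntegral_mono' measurableSet_closedBall fun z hz => ?_
        refine (hf.lintegral_translate_le z).trans ?_
        rw [← h4]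
        gcongr
        rw [← ofReal_norm]
        exact ENNReal.ofReal_le_ofReal (by simpa using hz)
    _ = (ENNReal.ofReal (h ^ 2))⁻¹ * ((4 * ENNReal.ofReal (h ^ 2)) *
          (∫⁻ x, ‖gradient f x‖ₑ ^ 2) *
          (4 * ENNReal.ofReal (h ^ 2) * volume (Metric.ball (0 : Plane) 1))) := by
        rw [setLIntegral_const, Measure.addHaar_closedBall _ _ (by positivity : 0 ≤ 2 * h)]
        simp only [finrank_euclideanSpace, Fintype.card_fin]
        rw [ENNReal.ofReal_pow (by positivity : 0 ≤ 2 * h), h4]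
    _ = ((ENNReal.ofReal (h ^ 2))⁻¹ * ENNReal.ofReal (h ^ 2)) * (16 *
          volume (Metric.ball (0 : Plane) 1) * ENNReal.ofReal (h ^ 2) *
        ∫⁻ x, ‖gradient f x‖ₑ ^ 2) := by ring
    _ = _ := by rw [ENNReal.inv_mul_cancel hv ENNReal.ofReal_ne_top, one_mul]

end Cells

/-! ### Rellich's theorem on the box -/

section Rellich

variable {L : ℝ}

lemma boxMeasure_cell_ne_top {h : ℝ} (hh : 0 < h) (k : Fin 2 → ℤ) :
    boxMeasure L (cell h k) ≠ ⊤ := by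
  refine ((Measure.restrict_apply_le _ _).trans_lt ?_).ne
  rw [volume_cell hh]; exact ENNReal.ofReal_lt_top

/-- The class in `L²(Q_L)` of the indicator of a cell. -/
def cellIndicator (L : ℝ) {h : ℝ} (hh : 0 < h) (k : Fin 2 → ℤ) : L2Box L :=
  indicatorConstLp 2 (measurableSet_cell h k) (boxMeasure_cell_ne_top hh k) 1

/-- The indices of the cells of side `h` that meet the box. -/
def cellIndices (L h : ℝ) : Finset (Fin 2 → ℤ) := Fintype.piFinset fun _ => Finset.Icc 0 ⌊L / h⌋

/-- Averaging over the cells of side `h`. -/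
def cellAverage (L : ℝ) {h : ℝ} (hh : 0 < h) : L2Box L →L[ℝ] L2Box L :=
  ∑ k ∈ cellIndices L h, (innerSL ℝ ((h ^ 2)⁻¹ • cellIndicator L hh k)).smulRight
    (cellIndicator L hh k)

lemma isCompactOperator_cellAverage {h : ℝ} (hh : 0 < h) :
    IsCompactOperator (cellAverage L hh) := by
  have : cellAverage L hh ∈ compactOperator (RingHom.id ℝ) (L2Box L) (L2Box L) := by
    refine Submodule.sum_mem _ fun k _ => ?_
    have h1 : IsCompactOperator (innerSL ℝ ((h ^ 2)⁻¹ • cellIndicator L hh k) : L2Box L →L[ℝ] ℝ) :=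
      isCompactOperator_of_locallyCompactSpace_dom _
    exact h1.clm_comp ((ContinuousLinearMap.id ℝ ℝ).smulRight (cellIndicator L hh k))
  exact this

lemma floor_mem_cellIndices {h : ℝ} (hh : 0 < h) {x : Plane} (hx : x ∈ box L) :
    (fun i => ⌊x i / h⌋) ∈ cellIndices L h := by
  rw [cellIndices, Fintype.mem_piFinset]
  intro i
  rw [Finset.mem_Icc]
  exact ⟨Int.floor_nonneg.2 (div_nonneg (hx i).1 hh.le),
    Int.floor_le_floor (div_le_div_of_nonneg_right (hx i).2 hh.le)⟩

/-- On a test function `cellAverage` gives at `x` the average over the cell containing `x`; the part of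
the cell outside of the box contributes nothing. -/
lemma coeFn_cellAverage {h : ℝ} (hh : 0 < h) (φ : boxTests L) :
    ∀ᵐ x ∂(boxMeasure L), cellAverage L hh (toLpBox L 2 φ) x =
      (h ^ 2)⁻¹ * ∫ y in cell h (fun i => ⌊x i / h⌋), (φ : Plane → ℝ) y := by
  have hinner : ∀ k, inner ℝ ((h ^ 2)⁻¹ • cellIndicator L hh k) (toLpBox L 2 φ) =
      (h ^ 2)⁻¹ * ∫ y in cell h k, (φ : Plane → ℝ) y := by
    intro k
    rw [inner_smul_left, conj_trivial, cellIndicator, L2.inner_indicatorConstLp_one]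
    congr 1
    have h1 : ∫ y in cell h k, (toLpBox L 2 φ) y ∂(boxMeasure L) =
        ∫ y in cell h k, (φ : Plane → ℝ) y ∂(boxMeasure L) :=
      setIntegral_congr_ae (measurableSet_cell h k)
        ((coeFn_toLpBox φ 2).mono fun y hy _ => hy)
    rw [h1, Measure.restrict_restrict (measurableSet_cell h k), ← setIntegral_indicator
      (isClosed_box L).measurableSet]
    refine integral_congr_ae (ae_of_all _ fun y => ?_)
    by_cases hy : y ∈ box L
    · simp [indicator_of_mem hy]
    · simp [indicator_of_notMem hy, boxTest_eq_zero φ hy]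
  have hval : cellAverage L hh (toLpBox L 2 φ) = ∑ k ∈ cellIndices L h,
      ((h ^ 2)⁻¹ * ∫ y in cell h k, (φ : Plane → ℝ) y) • cellIndicator L hh k := by
    rw [cellAverage, sum_apply]
    refine Finset.sum_congr rfl fun k _ => ?_
    rw [ContinuousLinearMap.smulRight_apply, innerSL_apply_apply, hinner]
  have h1 : ∀ᵐ x ∂(boxMeasure L), ∀ k : Fin 2 → ℤ,
      cellIndicator L hh k x = (cell h k).indicator (fun _ => (1 : ℝ)) x :=
    ae_all_iff.2 fun k => indicatorConstLp_coeFn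
  have h2 : ∀ᵐ x ∂(boxMeasure L), ∀ k : Fin 2 → ℤ,
      (((h ^ 2)⁻¹ * ∫ y in cell h k, (φ : Plane → ℝ) y) • cellIndicator L hh k : L2Box L) x =
      ((h ^ 2)⁻¹ * ∫ y in cell h k, (φ : Plane → ℝ) y) * cellIndicator L hh k x :=
    ae_all_iff.2 fun k => Lp.coeFn_smul _ _
  rw [hval]
  filter_upwards [h1, h2, Lp.coeFn_finsetSum (cellIndices L h) (fun k =>
    (((h ^ 2)⁻¹ * ∫ y in cell h k, (φ : Plane → ℝ) y) • cellIndicator L hh k : L2Box L)),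
    ae_restrict_mem (isClosed_box L).measurableSet] with x e1 e2 e3 hx
  rw [e3, Finset.sum_apply, Finset.sum_eq_single fun i => ⌊x i / h⌋]
  · rw [e2, e1, indicator_of_mem (show x ∈ cell h _ from fun i => rfl), mul_one]
  · intro k _ hk
    rw [e2, e1, indicator_of_notMem fun hmem => hk (funext fun i => (hmem i).symm), mul_zero]
  · exact fun hn => absurd (floor_mem_cellIndices hh hx) hn

/-- Poincaré's inequality on the cells, summed over the box. -/
lemma norm_sub_cellAverage_le {h : ℝ} (hh : 0 < h) (φ : boxTests L) :
    ‖toLpBox L 2 φ - cellAverage L hh (toLpBox L 2 φ)‖ ≤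
      √(16 * (volume (Metric.ball (0 : Plane) 1)).toReal) * h * ‖gradBox L φ‖ := by
  have hφ := isTest_coe φ
  have h1 : ∫⁻ x, ‖(toLpBox L 2 φ - cellAverage L hh (toLpBox L 2 φ) : L2Box L) x‖ₑ ^ 2
      ∂(boxMeasure L) ≤ 16 * volume (Metric.ball (0 : Plane) 1) * ENNReal.ofReal (h ^ 2) *
        ∫⁻ x, ‖gradient (φ : Plane → ℝ) x‖ₑ ^ 2 := by
    refine le_trans ?_ (hφ.lintegral_translate_ball_le hh)
    rw [← lintegral_const_mul' _ _ (by simpa using hh.ne')]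
    refine (lintegral_mono_ae ?_).trans (lintegral_mono' Measure.restrict_le_self le_rfl)
    filter_upwards [coeFn_cellAverage hh φ, coeFn_toLpBox φ 2,
      Lp.coeFn_sub (toLpBox L 2 φ) (cellAverage L hh (toLpBox L 2 φ))] with x e1 e2 e3
    rw [e3, Pi.sub_apply, e1, e2]
    exact hφ.enorm_sub_average_sq_le hh fun i => rfl
  have h2 : ‖toLpBox L 2 φ - cellAverage L hh (toLpBox L 2 φ)‖ ^ 2 =
      (∫⁻ x, ‖(toLpBox L 2 φ - cellAverage L hh (toLpBox L 2 φ) : L2Box L) x‖ₑ ^ 2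
        ∂(boxMeasure L)).toReal := by
    have := eLpNorm_pow_eq_lintegral (μ := boxMeasure L) (p := 2)
      (toLpBox L 2 φ - cellAverage L hh (toLpBox L 2 φ) : L2Box L) (by norm_num)
    rw [← this, Lp.norm_def, ENNReal.toReal_pow]
    rfl
  have h3 : ∫⁻ x, ‖gradient (φ : Plane → ℝ) x‖ₑ ^ 2 =
      eLpNorm (gradient (φ : Plane → ℝ)) 2 (boxMeasure L) ^ 2 := by
    rw [eLpNorm_gradBox]
    exact (eLpNorm_pow_eq_lintegral (p := 2) _ (by norm_num)).symm
  have ng : ‖gradBox L φ‖ = (eLpNorm (gradient (φ : Plane → ℝ)) 2 (boxMeasure L)).toReal :=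
    Lp.norm_toLp _ (hφ.memLp_gradient 2 (boxMeasure L))
  refine le_of_pow_le_pow_left₀ (n := 2) (by norm_num) (by positivity) ?_
  rw [h2, mul_pow, mul_pow, Real.sq_sqrt (by positivity), ng]
  rw [h3] at h1
  refine (ENNReal.toReal_mono ?_ h1).trans_eq ?_
  · exact ENNReal.mul_ne_top (ENNReal.mul_ne_top (ENNReal.mul_ne_top (by norm_num)
      measure_ball_lt_top.ne) ENNReal.ofReal_ne_top)
      (ENNReal.pow_ne_top (hφ.memLp_gradient 2 (boxMeasure L)).2.ne)
  · simp [ENNReal.toReal_mul, sq_nonneg]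

/-- A bounded operator that compact operators approximate in norm is compact. -/
lemma isCompactOperator_of_approx {E F : Type*} [NormedAddCommGroup E] [NormedSpace ℝ E]
    [NormedAddCommGroup F] [NormedSpace ℝ F] [CompleteSpace F] {T : E →L[ℝ] F} {C : ℝ}
    (hC : 0 ≤ C) (h : ∀ ε : ℝ, 0 < ε → ∃ S : E →L[ℝ] F, IsCompactOperator S ∧
      ∀ u, ‖T u - S u‖ ≤ C * ε * ‖u‖) : IsCompactOperator T := by
  have hpos : ∀ k : ℕ, 0 < 1 / ((k : ℝ) + 1) := fun k => by positivity
  choose S hS hTS using fun k => h _ (hpos k)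
  have h0 : Tendsto (fun k : ℕ => C * (1 / ((k : ℝ) + 1))) atTop (𝓝 0) := by
    simpa using (tendsto_one_div_add_atTop_nhds_zero_nat (𝕜 := ℝ)).const_mul C
  have hlim : Tendsto S atTop (𝓝 T) := by
    rw [tendsto_iff_norm_sub_tendsto_zero]
    refine squeeze_zero (fun k => norm_nonneg _) (fun k => ?_) h0
    rw [norm_sub_rev]
    exact ContinuousLinearMap.opNorm_le_bound _ (by positivity) (hTS k)
  exact isCompactOperator_of_tendsto hlim (Eventually.of_forall hS)

/-- Rellich's theorem: `H¹₀(Q_L)` embeds compactly into `L²(Q_L)`. -/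
theorem isCompactOperator_dirichletFst : IsCompactOperator (dirichletFst L) := by
  refine isCompactOperator_of_approx
    (Real.sqrt_nonneg (16 * (volume (Metric.ball (0 : Plane) 1)).toReal)) fun h hh =>
      ⟨(cellAverage L hh).comp (dirichletFst L),
        (isCompactOperator_cellAverage hh).comp_clm _, fun p => ?_⟩
  refine denseRange_testPair.induction_on (p := fun p =>
    ‖dirichletFst L p - cellAverage L hh (dirichletFst L p)‖ ≤ _ * h * ‖p‖) p ?_ ?_
  · exact isClosed_le (by fun_prop) (continuous_norm.const_mul _)
  · intro φ
    refine (norm_sub_cellAverage_le hh φ).trans ?_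
    gcongr
    have hn := WithLp.prod_norm_sq_eq_of_L2 (pairBox L φ)
    rw [pairBox_fst, pairBox_snd] at hn
    refine le_of_pow_le_pow_left₀ (n := 2) (by norm_num) (norm_nonneg _) ?_
    change _ ≤ ‖pairBox L φ‖ ^ 2
    nlinarith [sq_nonneg ‖toLpBox L 2 φ‖]

end Rellich

/-! ### Resolvents of coercive forms -/

section Resolvent

variable {D H : Type*} [NormedAddCommGroup D] [InnerProductSpace ℝ D] [CompleteSpace D]
  [NormedAddCommGroup H] [InnerProductSpace ℝ H] [CompleteSpace H]

/-- The operator on `H` solving `a(u, ·) = ⟪f, ι ·⟫` for a coercive form `a` on `D` and an embedding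
`ι : D → H`: it sends `f` to `ι u`. -/
def formResolvent {a : D →L[ℝ] D →L[ℝ] ℝ} (ha : IsCoercive a) (ι : D →L[ℝ] H) : H →L[ℝ] H :=
  ι ∘L (ha.continuousLinearEquivOfBilin.symm : D →L[ℝ] D) ∘L ContinuousLinearMap.adjoint ι

variable {a : D →L[ℝ] D →L[ℝ] ℝ} (ha : IsCoercive a) (ι : D →L[ℝ] H)

lemma exists_formResolvent_eq (f : H) :
    ∃ u, formResolvent ha ι f = ι u ∧ ∀ v, a u v = inner ℝ f (ι v) := by
  refine ⟨ha.continuousLinearEquivOfBilin.symm (ContinuousLinearMap.adjoint ι f), rfl, fun v => ?_⟩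
  rw [← ha.continuousLinearEquivOfBilin_apply, ContinuousLinearEquiv.apply_symm_apply,
    ContinuousLinearMap.adjoint_inner_left]

lemma formResolvent_eq_of_form {f : H} {u : D} (h : ∀ v, a u v = inner ℝ f (ι v)) :
    formResolvent ha ι f = ι u := by
  have : ha.continuousLinearEquivOfBilin u = ContinuousLinearMap.adjoint ι f := by
    refine ext_inner_right ℝ fun v => ?_
    rw [ha.continuousLinearEquivOfBilin_apply, h, ContinuousLinearMap.adjoint_inner_left]
  rw [formResolvent, ContinuousLinearMap.comp_apply, ContinuousLinearMap.comp_apply, ← this]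
  simp

lemma isSymmetric_formResolvent (hsymm : ∀ u v, a u v = a v u) :
    (formResolvent ha ι).IsSymmetric := by
  intro f g
  obtain ⟨u, hu, hu'⟩ := exists_formResolvent_eq ha ι f
  obtain ⟨v, hv, hv'⟩ := exists_formResolvent_eq ha ι g
  simp only [ContinuousLinearMap.coe_coe]
  rw [hu, hv, real_inner_comm, ← hv', hsymm, hu']

lemma isCompactOperator_formResolvent (hι : IsCompactOperator ι) :
    IsCompactOperator (formResolvent ha ι) := hι.comp_clm _

/-- A bound of the form on `u` is a lower bound of the resolvent on `ι u`. -/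
lemma le_inner_formResolvent (hsymm : ∀ u v, a u v = a v u) {κ : ℝ} (hκ : 0 < κ) {u : D}
    (h : a u u ≤ κ * ‖ι u‖ ^ 2) :
    κ⁻¹ * ‖ι u‖ ^ 2 ≤ inner ℝ (formResolvent ha ι (ι u)) (ι u) := by
  obtain ⟨v, hv, hv'⟩ := exists_formResolvent_eq ha ι (ι u)
  have h1 : a v u = ‖ι u‖ ^ 2 := by rw [hv', real_inner_self_eq_norm_sq]
  have h2 : a v v = inner ℝ (ι v) (ι u) := by rw [hv', real_inner_comm]
  -- positivity of the form on `v - κ⁻¹ u`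
  have h3 : 0 ≤ a (v - κ⁻¹ • u) (v - κ⁻¹ • u) := by
    obtain ⟨C, hC, hC'⟩ := ha
    exact (by positivity : 0 ≤ C * ‖v - κ⁻¹ • u‖ * ‖v - κ⁻¹ • u‖).trans (hC' _)
  simp only [map_sub, map_smul, sub_apply, smul_apply, smul_eq_mul] at h3
  rw [hsymm u v, h1, h2] at h3
  rw [hv]
  have h4 : κ⁻¹ * (κ⁻¹ * a u u) ≤ κ⁻¹ * ‖ι u‖ ^ 2 := by
    refine mul_le_mul_of_nonneg_left ?_ (by positivity)
    rwa [inv_mul_le_iff₀ hκ]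
  linarith

end Resolvent

/-! ### Eigenvalues for potentials bounded above -/

section Spectrum

variable {L : ℝ}

instance completeSpace_dirichletSpace : CompleteSpace (dirichletSpace L) :=
  (Submodule.isClosed_topologicalClosure _).completeSpace_coe

/-- The form `K ⟪f, f'⟫ - ⟪(Δ + V) f, f'⟫` on `H¹₀(Q_L)`. -/
def shiftedForm (V : L2Box L) (K : ℝ) : dirichletSpace L →L[ℝ] dirichletSpace L →L[ℝ] ℝ :=
  (K • (innerₗ (L2Box L)).compl₁₂ (dirichletFst L).toLinearMap (dirichletFst L).toLinearMap -
    boxForm V).mkContinuous₂ (|K| * ‖dirichletFst L‖ ^ 2 + (‖dirichletSnd L‖ ^ 2 +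
      ‖V‖ * (‖mulFour L‖ * ‖embedFour L‖ ^ 2))) (by
    intro p q
    have h1 := abs_real_inner_le_norm (dirichletFst L p) (dirichletFst L q)
    have h2 := abs_real_inner_le_norm (dirichletSnd L p) (dirichletSnd L q)
    have h3 := abs_real_inner_le_norm V (mulFour L (embedFour L p) (embedFour L q))
    have h4 := (mulFour L).le_opNorm₂ (embedFour L p) (embedFour L q)
    have ip := (dirichletFst L).le_opNorm p
    have iq := (dirichletFst L).le_opNorm q
    have jp := (dirichletSnd L).le_opNorm p
    have jq := (dirichletSnd L).le_opNorm q
    have kp := (embedFour L).le_opNorm p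
    have kq := (embedFour L).le_opNorm q
    have e : ‖(K • (innerₗ (L2Box L)).compl₁₂ (dirichletFst L).toLinearMap
        (dirichletFst L).toLinearMap - boxForm V) p q‖ =
        |K * inner ℝ (dirichletFst L p) (dirichletFst L q) -
          (-inner ℝ (dirichletSnd L p) (dirichletSnd L q) +
            inner ℝ V (mulFour L (embedFour L p) (embedFour L q)))| := rfl
    rw [e]
    calc _ ≤ |K| * |inner ℝ (dirichletFst L p) (dirichletFst L q)| +
          (|inner ℝ (dirichletSnd L p) (dirichletSnd L q)| +
            |inner ℝ V (mulFour L (embedFour L p) (embedFour L q))|) := by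
          rw [← abs_mul]
          refine (abs_sub _ _).trans (add_le_add le_rfl ?_)
          refine (abs_add_le _ _).trans_eq ?_
          rw [abs_neg]
      _ ≤ |K| * (‖dirichletFst L‖ * ‖p‖ * (‖dirichletFst L‖ * ‖q‖)) +
          (‖dirichletSnd L‖ * ‖p‖ * (‖dirichletSnd L‖ * ‖q‖) +
            ‖V‖ * (‖mulFour L‖ * (‖embedFour L‖ * ‖p‖) * (‖embedFour L‖ * ‖q‖))) := by
          gcongr
          · exact h1.trans (by gcongr)
          · exact h2.trans (by gcongr)
          · exact h3.trans (by gcongr; exact h4.trans (by gcongr))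
      _ = _ := by ring)

lemma shiftedForm_apply (V : L2Box L) (K : ℝ) (p q : dirichletSpace L) :
    shiftedForm V K p q = K * inner ℝ (dirichletFst L p) (dirichletFst L q) - boxForm V p q := rfl

lemma shiftedForm_comm (V : L2Box L) (K : ℝ) (p q : dirichletSpace L) :
    shiftedForm V K p q = shiftedForm V K q p := by
  rw [shiftedForm_apply, shiftedForm_apply, boxForm_comm, real_inner_comm]

/-- If `V ≤ K - 1`, then `K ‖f‖² - ⟪(Δ + V) f, f⟫` dominates the `H¹` norm. -/
lemma isCoercive_shiftedForm {V : L2Box L} {K : ℝ} (hV : ∀ᵐ x ∂(boxMeasure L), V x ≤ K - 1) :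
    IsCoercive (shiftedForm V K) := by
  refine ⟨1, one_pos, fun p => ?_⟩
  have h1 : inner ℝ V (mulFour L (embedFour L p) (embedFour L p)) ≤
      (K - 1) * inner ℝ (dirichletFst L p) (dirichletFst L p) := by
    rw [L2.inner_def, L2.inner_def, ← integral_const_mul]
    refine integral_mono_ae (L2.integrable_inner _ _) ((L2.integrable_inner _ _).const_mul _) ?_
    filter_upwards [hV, coeFn_mulFour (embedFour L p) (embedFour L p), coeFn_embedFour p]
      with x e1 e2 e3
    have e4 : dirichletFst L p x = (p : PairSpace L).fst x := rfl
    rw [e2, e3, e4]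
    simp only [RCLike.inner_apply, conj_trivial]
    nlinarith [mul_self_nonneg ((p : PairSpace L).fst x)]
  have h2 : ‖p‖ ^ 2 = ‖dirichletFst L p‖ ^ 2 + ‖dirichletSnd L p‖ ^ 2 :=
    WithLp.prod_norm_sq_eq_of_L2 (p : PairSpace L)
  rw [shiftedForm_apply, boxForm_apply, real_inner_self_eq_norm_sq (dirichletSnd L p)]
  rw [real_inner_self_eq_norm_sq] at h1 ⊢
  nlinarith

variable {V : L2Box L} {K : ℝ}

/-- The resolvent `(K - (Δ + V))⁻¹` of a potential bounded above by `K - 1`. -/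
def boxResolvent (hV : ∀ᵐ x ∂(boxMeasure L), V x ≤ K - 1) : L2Box L →L[ℝ] L2Box L :=
  formResolvent (isCoercive_shiftedForm hV) (dirichletFst L)

/-- Below `K`, the eigenspace of `Δ + V` to `ν` is that of the resolvent to `(K - ν)⁻¹`. -/
lemma mem_eigenspace_iff (hV : ∀ᵐ x ∂(boxMeasure L), V x ≤ K - 1) {ν : ℝ} (hν : ν < K)
    {f : L2Box L} : f ∈ eigenspace L V ν ↔ boxResolvent hV f = (K - ν)⁻¹ • f := by
  have hκ : K - ν ≠ 0 := (sub_pos.2 hν).ne'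
  rw [eigenspace_eq_map]
  constructor
  · rintro ⟨p, hp, rfl⟩
    have hp' : ∀ q, boxForm V p q = ν * inner ℝ (dirichletFst L p) (dirichletFst L q) := hp
    have : ∀ q, shiftedForm V K ((K - ν)⁻¹ • p) q =
        inner ℝ (dirichletFst L p) (dirichletFst L q) := by
      intro q
      rw [map_smul, smul_apply, shiftedForm_apply, hp', smul_eq_mul, ← sub_mul, ← mul_assoc,
        inv_mul_cancel₀ hκ, one_mul]
    exact (formResolvent_eq_of_form _ _ this).trans (map_smul _ _ _)
  · intro h
    obtain ⟨p, hp, hp'⟩ := exists_formResolvent_eq (isCoercive_shiftedForm hV) (dirichletFst L) f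
    have hf : f = (K - ν) • dirichletFst L p := by
      rw [← hp]
      exact (by rw [h, smul_smul, mul_inv_cancel₀ hκ, one_smul] :
        f = (K - ν) • boxResolvent hV f)
    refine ⟨(K - ν) • p, Submodule.smul_mem _ _ fun q => ?_, by rw [hf]; exact map_smul _ _ _⟩
    have := hp' q
    rw [shiftedForm_apply, hf, inner_smul_left, conj_trivial] at this
    linarith

/-- If `V ≤ K - 1`, there are no eigenvalues `≥ K`. -/
lemma eigenspace_subset_zero (hV : ∀ᵐ x ∂(boxMeasure L), V x ≤ K - 1) {ν : ℝ} (hν : K ≤ ν) :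
    eigenspace L V ν ⊆ {0} := by
  rw [eigenspace_eq_map]
  rintro _ ⟨p, hp, rfl⟩
  have hp' : ∀ q, boxForm V p q = ν * inner ℝ (dirichletFst L p) (dirichletFst L q) := hp
  obtain ⟨C, hC, h⟩ := isCoercive_shiftedForm hV
  have h1 := h p
  rw [shiftedForm_apply, hp', real_inner_self_eq_norm_sq] at h1
  have h2 : C * ‖p‖ * ‖p‖ ≤ 0 := by nlinarith [sq_nonneg ‖dirichletFst L p‖]
  have h3 : ‖p‖ = 0 := by
    by_contra hne
    have : 0 < ‖p‖ := lt_of_le_of_ne (norm_nonneg _) (Ne.symm hne)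
    have : 0 < C * ‖p‖ * ‖p‖ := by positivity
    linarith
  rw [norm_eq_zero.1 h3]
  exact map_zero _

lemma isSymmetric_boxResolvent (hV : ∀ᵐ x ∂(boxMeasure L), V x ≤ K - 1) :
    (boxResolvent hV).IsSymmetric :=
  isSymmetric_formResolvent _ _ (shiftedForm_comm V K)

lemma isCompactOperator_boxResolvent (hV : ∀ᵐ x ∂(boxMeasure L), V x ≤ K - 1) :
    IsCompactOperator (boxResolvent hV) :=
  isCompactOperator_formResolvent _ _ isCompactOperator_dirichletFst

lemma spectralSpan_boxResolvent_le (hV : ∀ᵐ x ∂(boxMeasure L), V x ≤ K - 1) {μ : ℝ} (hμ : μ < K) :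
    spectralSpan (boxResolvent hV) (Ici (K - μ)⁻¹) ≤
      Submodule.span ℝ (⋃ ν ∈ Ici μ, eigenspace L V ν) := by
  refine iSup₂_le fun β hβ f hf => Submodule.subset_span ?_
  have hκ : 0 < K - μ := sub_pos.2 hμ
  have hβ0 : 0 < β := (inv_pos.2 hκ).trans_le hβ
  have hle : β⁻¹ ≤ K - μ := inv_le_of_inv_le₀ hκ hβ
  refine mem_biUnion (x := K - β⁻¹) (by rw [mem_Ici]; linarith) ?_
  rw [mem_eigenspace_iff hV (by linarith [inv_pos.2 hβ0]), sub_sub_cancel, inv_inv]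
  exact Module.End.mem_eigenspace_iff.1 hf

/-- Only finitely many eigenvalues lie above a given number. -/
lemma finite_eigenvalues (hV : ∀ᵐ x ∂(boxMeasure L), V x ≤ K - 1) (μ : ℝ) :
    {ν | μ ≤ ν ∧ ∃ f ∈ eigenspace L V ν, f ≠ 0}.Finite := by
  have hlt : ∀ ν, (∃ f ∈ eigenspace L V ν, f ≠ 0) → ν < K := by
    rintro ν ⟨f, hf, hf0⟩
    by_contra! h
    exact hf0 (eigenspace_subset_zero hV h hf)
  rcases le_or_gt K μ with h | hμ
  · convert finite_empty
    rw [eq_empty_iff_forall_notMem]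
    rintro ν ⟨h1, h2⟩
    linarith [hlt ν h2]
  · have hfin := finite_eigenvalues_ge (isSymmetric_boxResolvent hV)
      (isCompactOperator_boxResolvent hV) (inv_pos.2 (sub_pos.2 hμ))
    refine Finite.of_finite_image (f := fun ν => (K - ν)⁻¹) (hfin.subset ?_) ?_
    · rintro _ ⟨ν, ⟨h1, f, hf, hf0⟩, rfl⟩
      have := hlt ν ⟨f, hf, hf0⟩
      exact ⟨inv_anti₀ (by linarith) (by linarith), f, hf0, (mem_eigenspace_iff hV this).1 hf⟩
    · intro ν _ ν' _ h
      have := inv_injective h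
      linarith

/-- If some number has at least `n` eigenvalues above it, there is a greatest such number. For `n = 0`
this fails, since every number qualifies. -/
lemma exists_isNthEigenvalue (hV : ∀ᵐ x ∂(boxMeasure L), V x ≤ K - 1) {n : ℕ} (hn : 1 ≤ n)
    {μ : ℝ} (hμ : AtLeastEigenvaluesAbove L V n μ) : ∃ x, IsNthEigenvalue L V n x := by
  set E : Set ℝ := {ν | μ ≤ ν ∧ ∃ f ∈ eigenspace L V ν, f ≠ 0} with hE
  have hfin : E.Finite := finite_eigenvalues hV μ
  -- every admissible number is bounded by an admissible eigenvalue
  have key : ∀ s, μ ≤ s → AtLeastEigenvaluesAbove L V n s →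
      ∃ ν ∈ E, s ≤ ν ∧ AtLeastEigenvaluesAbove L V n ν := by
    intro s hμs hs
    have hfin' : (E ∩ Ici s).Finite := hfin.subset inter_subset_left
    have hmem : ∀ ν ∈ Ici s, ∀ f ∈ eigenspace L V ν, f ≠ 0 → ν ∈ E ∩ Ici s :=
      fun ν hν f hf hf0 => ⟨⟨hμs.trans hν, f, hf, hf0⟩, hν⟩
    have hne : (E ∩ Ici s).Nonempty := by
      by_contra hempty
      rw [not_nonempty_iff_eq_empty] at hempty
      have hbot : Submodule.span ℝ (⋃ ν ∈ Ici s, eigenspace L V ν) = ⊥ := by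
        rw [Submodule.span_eq_bot]
        intro f hf
        obtain ⟨ν, hν, hfν⟩ := mem_iUnion₂.1 hf
        by_contra hf0
        have := hmem ν hν f hfν hf0
        rw [hempty] at this
        exact this
      rw [AtLeastEigenvaluesAbove, hbot, rank_bot] at hs
      have : n = 0 := by exact_mod_cast nonpos_iff_eq_zero.1 hs
      omega
    obtain ⟨ν, hν, hmin⟩ := exists_min_image _ id hfin' hne
    refine ⟨ν, hν.1, hν.2, hs.trans (Submodule.rank_mono ?_)⟩
    rw [Submodule.span_le]
    intro f hf
    obtain ⟨ν', hν', hfν'⟩ := mem_iUnion₂.1 hf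
    by_cases hf0 : f = 0
    · rw [hf0]; exact Submodule.zero_mem _
    · exact Submodule.subset_span (mem_biUnion (hmin ν' (hmem ν' hν' f hfν' hf0)) hfν')
  obtain ⟨ν₀, hν₀, _, hν₀'⟩ := key μ le_rfl hμ
  obtain ⟨x, ⟨hx, hx'⟩, hmax⟩ := exists_max_image (E ∩ {ν | AtLeastEigenvaluesAbove L V n ν}) id
    (hfin.subset inter_subset_left) ⟨ν₀, hν₀, hν₀'⟩
  refine ⟨x, hx', fun s hs => ?_⟩
  rcases le_or_gt μ s with h | h
  · obtain ⟨ν, h1, h2, h3⟩ := key s h hs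
    exact h2.trans (hmax ν ⟨h1, h3⟩)
  · exact h.le.trans hx.1

/-- The max-min principle: a space of test functions on which the form of `Δ + V` is at least `μ`
forces eigenvalues above every smaller number. -/
lemma atLeastEigenvaluesAbove_of_le_energy {W : Plane → ℝ} (hW : IsTest W) {n : ℕ} {μ : ℝ}
    (F : Submodule ℝ (Plane → ℝ)) (hF : F ≤ boxTests L) (hrank : Module.rank ℝ F = n)
    (hE : ∀ ψ ∈ F, μ * ∫ x, ψ x ^ 2 ≤ energy W ψ) {μ' : ℝ} (hμ : μ' < μ) :
    AtLeastEigenvaluesAbove L (potBox L hW) n μ' := by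
  obtain ⟨M, hM⟩ := hW.2.exists_bound_of_continuous hW.continuous
  -- `K` has to exceed both `W + 1`, for coercivity, and `μ`.
  set K := max M μ + 1 with hK
  have hMK : M ≤ K - 1 := by rw [hK, add_sub_cancel_right]; exact le_max_left _ _
  have hμK : μ < K := by rw [hK]; linarith [le_max_right M μ]
  have hV : ∀ᵐ x ∂(boxMeasure L), potBox L hW x ≤ K - 1 := by
    filter_upwards [coeFn_potBox (L := L) hW] with x hx
    rw [hx]
    exact ((Real.le_norm_self _).trans (hM x)).trans hMK
  have : Module.Finite ℝ F := Module.finite_of_rank_eq_nat hrank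
  let T : F →ₗ[ℝ] L2Box L :=
    (dirichletFst L).toLinearMap ∘ₗ testPair L ∘ₗ Submodule.inclusion hF
  have hT : ∀ ψ : F, inner ℝ (T ψ) (T ψ) = ∫ x, (ψ : Plane → ℝ) x ^ 2 := fun ψ => by
    simp_rw [pow_two]
    exact inner_testPair_testPair _ _
  have hTinj : Function.Injective T := by
    rw [injective_iff_map_eq_zero]
    intro ψ hψ
    have h0 := hT ψ
    rw [hψ, inner_zero_left] at h0
    exact Subtype.ext ((hF ψ.2).1.eq_zero_of_integral_sq h0.symm)
  have hform : ∀ u ∈ LinearMap.range T,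
      (K - μ)⁻¹ * ‖u‖ ^ 2 ≤ inner ℝ (boxResolvent hV u) u := by
    rintro _ ⟨ψ, rfl⟩
    refine le_inner_formResolvent (isCoercive_shiftedForm hV) (dirichletFst L)
      (shiftedForm_comm _ K) (sub_pos.2 hμK) (u := testPair L (Submodule.inclusion hF ψ)) ?_
    have h1 := hE ψ ψ.2
    have h2 : boxForm (potBox L hW) (testPair L (Submodule.inclusion hF ψ))
        (testPair L (Submodule.inclusion hF ψ)) = energy W ψ := by
      rw [boxForm_potBox_testPair, energyForm, energy]
      refine integral_congr_ae (ae_of_all _ fun x => ?_)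
      simp [pow_two]
    rw [← hT, real_inner_self_eq_norm_sq] at h1
    rw [shiftedForm_apply, h2, real_inner_self_eq_norm_sq]
    have h3 : ‖dirichletFst L (testPair L (Submodule.inclusion hF ψ))‖ = ‖T ψ‖ := rfl
    rw [h3]
    linarith
  have hc0 : 0 < (K - μ')⁻¹ := inv_pos.2 (by linarith)
  have hdim := finrank_le_finrank_spectralSpan (isSymmetric_boxResolvent hV)
    (isCompactOperator_boxResolvent hV) hc0
    ((inv_lt_inv₀ (by linarith) (by linarith)).2 (by linarith)) (LinearMap.range T) hform
  have := finiteDimensional_spectralSpan (isSymmetric_boxResolvent hV)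
    (isCompactOperator_boxResolvent hV) hc0
  rw [LinearMap.finrank_range_of_inj hTinj, Module.finrank_eq_of_rank_eq hrank] at hdim
  calc (n : Cardinal) ≤ Module.finrank ℝ (spectralSpan (boxResolvent hV) (Ici (K - μ')⁻¹)) := by
        exact_mod_cast hdim
    _ = Module.rank ℝ (spectralSpan (boxResolvent hV) (Ici (K - μ')⁻¹)) :=
        Module.finrank_eq_rank _ _
    _ ≤ _ := Submodule.rank_mono (spectralSpan_boxResolvent_le hV (by linarith))

/-- In the same situation, the `n`-th eigenvalue exists and is at least `μ`. -/
lemma exists_le_isNthEigenvalue {W : Plane → ℝ} (hW : IsTest W) {n : ℕ} (hn : 1 ≤ n) {μ : ℝ}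
    (F : Submodule ℝ (Plane → ℝ)) (hF : F ≤ boxTests L) (hrank : Module.rank ℝ F = n)
    (hE : ∀ ψ ∈ F, μ * ∫ x, ψ x ^ 2 ≤ energy W ψ) :
    ∃ x, μ ≤ x ∧ IsNthEigenvalue L (potBox L hW) n x := by
  have h : ∀ μ' < μ, AtLeastEigenvaluesAbove L (potBox L hW) n μ' := fun μ' hμ' =>
    atLeastEigenvaluesAbove_of_le_energy hW F hF hrank hE hμ'
  obtain ⟨M, hM⟩ := hW.2.exists_bound_of_continuous hW.continuous
  have hV : ∀ᵐ x ∂(boxMeasure L), potBox L hW x ≤ M + 1 - 1 := by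
    filter_upwards [coeFn_potBox (L := L) hW] with x hx
    rw [hx, add_sub_cancel_right]
    exact (Real.le_norm_self _).trans (hM x)
  obtain ⟨x, hx⟩ := exists_isNthEigenvalue hV hn (h (μ - 1) (by linarith))
  exact ⟨x, le_of_forall_lt fun μ' hμ' => by
    obtain ⟨s, h1, h2⟩ := exists_between hμ'
    exact h1.trans_le (hx.2 (h s h2)), hx⟩

end Spectrum

/-! ### The variational formula for the rate -/

section Bounds

lemma norm_potBox_sq_le (L : ℝ) {V : Plane → ℝ} (hV : IsTest V) :
    ‖potBox L hV‖ ^ 2 ≤ ∫ x, V x ^ 2 := by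
  have h1 : ‖potBox L hV‖ ^ 2 = ∫ x in box L, V x ^ 2 := by
    rw [← real_inner_self_eq_norm_sq, L2.inner_def]
    refine integral_congr_ae ?_
    filter_upwards [coeFn_potBox (L := L) hV] with x hx
    rw [hx]
    simp [pow_two]
  rw [h1]
  exact setIntegral_le_integral hV.integrable_sq (ae_of_all _ fun x => sq_nonneg _)

lemma rateInf_le_of_trialSpace {L : ℝ} {n : ℕ} (hn : 1 ≤ n) {V : Plane → ℝ}
    {F : Submodule ℝ (Plane → ℝ)} {B : ℝ} (h : TrialSpace n V F B 1) (hF : F ≤ boxTests L) :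
    rateInf L n ≤ ENNReal.ofReal (B / 2) := by
  obtain ⟨x, hx1, hx⟩ :=
    exists_le_isNthEigenvalue h.isTest_potential hn F hF h.rank_eq h.le_energy
  refine (iInf₂_le x hx1).trans ((iInf₂_le (potBox L h.isTest_potential) hx).trans (ENNReal.ofReal_le_ofReal ?_))
  have := (norm_potBox_sq_le L h.isTest_potential).trans h.integral_sq_le
  linarith

/-- The functions in a finite-dimensional space of test functions are supported in a common ball. -/
lemma exists_common_support {F : Submodule ℝ (Plane → ℝ)} (hF : ∀ ψ ∈ F, IsTest ψ)
    [Module.Finite ℝ F] : ∃ R, ∀ ψ ∈ F, ∀ x, R < ‖x‖ → ψ x = 0 := by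
  obtain ⟨s, hs⟩ := (Module.Finite.iff_fg.1 ‹Module.Finite ℝ F› : F.FG)
  have hK : IsCompact (⋃ ψ ∈ s, tsupport ψ) :=
    s.finite_toSet.isCompact_biUnion fun ψ hψ => (hF ψ (hs ▸ Submodule.subset_span hψ)).2
  obtain ⟨R, hR⟩ := hK.isBounded.subset_closedBall 0
  refine ⟨R, fun ψ hψ x hx => ?_⟩
  rw [← hs] at hψ
  induction hψ using Submodule.span_induction with
  | mem φ hφ =>
    refine image_eq_zero_of_notMem_tsupport fun h => ?_
    have := hR (mem_biUnion hφ h)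
    rw [mem_closedBall_zero_iff] at this
    linarith
  | zero => rfl
  | add φ φ' _ _ h h' => rw [Pi.add_apply, h, h', add_zero]
  | smul c φ _ h => rw [Pi.smul_apply, h, smul_zero]

/-- A trial space at level `1` fits, after a translation, into every large box. -/
lemma eventually_exists_trialSpace_le_boxTests {n : ℕ} {V : Plane → ℝ}
    {F : Submodule ℝ (Plane → ℝ)} {B μ : ℝ} (h : TrialSpace n V F B μ) :
    ∀ᶠ L : ℝ in atTop, ∃ V' F', TrialSpace n V' F' B μ ∧ F' ≤ boxTests L := by
  have := Module.finite_of_rank_eq_nat h.rank_eq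
  obtain ⟨R, hR⟩ := exists_common_support h.isTest
  filter_upwards [eventually_gt_atTop (2 * R)] with L hL
  set c : Plane := WithLp.toLp 2 fun _ => L / 2 with hc
  have h' := h.comp_affine one_pos (-c)
  rw [one_pow, one_mul, one_mul] at h'
  refine ⟨_, _, h', fun φ hφ => ⟨h'.isTest φ hφ, ?_⟩⟩
  have hball : Metric.ball c (L / 2) ⊆ interior (box L) := by
    refine interior_maximal (fun x hx i => ?_) Metric.isOpen_ball
    rw [Metric.mem_ball, dist_eq_norm] at hx
    have h1 := (PiLp.norm_apply_le (x - c) i).trans_lt hx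
    have h2 : (x - c) i = x i - L / 2 := rfl
    rw [h2, Real.norm_eq_abs, abs_lt] at h1
    constructor <;> linarith
  have hsub : tsupport φ ⊆ Metric.closedBall c R := by
    refine closure_minimal (fun x hx => ?_) Metric.isClosed_closedBall
    obtain ⟨ψ, hψ, rfl⟩ := hφ
    by_contra hn
    rw [Metric.mem_closedBall, dist_eq_norm, not_le] at hn
    refine hx ?_
    rw [LinearMap.funLeft_apply, one_smul, ← sub_eq_add_neg]
    exact hR ψ hψ _ hn
  exact (hsub.trans (Metric.closedBall_subset_ball (by linarith))).trans hball

/-- A trial space at level `a` for a normalized potential, rescaled to level `1`, costs `1 / (2 a)`. -/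
lemma eventually_rateInf_le {n : ℕ} (hn : 1 ≤ n) {a : ℝ} (ha0 : 0 < a)
    (ha : (a : EReal) < maxMinValue n) :
    ∀ᶠ L : ℝ in atTop, rateInf L n ≤ ENNReal.ofReal (1 / (2 * a)) := by
  obtain ⟨V, F, h⟩ := exists_trialSpace_of_lt_maxMinValue ha
  have ht : 0 < (√a)⁻¹ := inv_pos.2 (Real.sqrt_pos.2 ha0)
  have h' := h.comp_affine ht 0
  rw [inv_pow, Real.sq_sqrt ha0.le, inv_mul_cancel₀ ha0.ne', mul_one] at h'
  filter_upwards [eventually_exists_trialSpace_le_boxTests h'] with L ⟨V', F', h1, h2⟩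
  refine (rateInf_le_of_trialSpace hn h1 h2).trans_eq ?_
  congr 1
  field_simp

lemma coe_toReal_maxMinValue {n : ℕ} (hn : 1 ≤ n) :
    (((maxMinValue n).toReal : ℝ) : EReal) = maxMinValue n :=
  EReal.coe_toReal ((maxMinValue_le_quarticValue hn).trans_lt quarticValue_lt_top).ne
    (ne_bot_of_gt (maxMinValue_pos n))

lemma toReal_maxMinValue_pos {n : ℕ} (hn : 1 ≤ n) : 0 < (maxMinValue n).toReal := by
  have := maxMinValue_pos n
  rw [← coe_toReal_maxMinValue hn] at this
  exact_mod_cast this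

/-- On every box, a potential whose `n`-th eigenvalue is at least `1` satisfies `1 ≤ m ‖V‖²`, where `m`
is the max-min value: its eigenfunctions are approximated by trial spaces on the plane. -/
lemma le_rateInf {n : ℕ} (hn : 1 ≤ n) (L : ℝ) :
    ENNReal.ofReal (1 / (2 * (maxMinValue n).toReal)) ≤ rateInf L n := by
  have hm := toReal_maxMinValue_pos hn
  set m := (maxMinValue n).toReal with hm'
  refine le_iInf₂ fun x hx => le_iInf₂ fun V hV => ENNReal.ofReal_le_ofReal ?_
  have key : 1 ≤ m * ‖V‖ ^ 2 := by
    refine le_of_forall_pos_le_add fun ε hε => ?_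
    -- With this `δ`, `x - δ ≤ m (‖V‖² + δ)` becomes `1 ≤ m ‖V‖² + ε`.
    set δ := ε / (m + 1) with hδ
    have hδ0 : 0 < δ := by positivity
    have hδε : δ * (m + 1) = ε := div_mul_cancel₀ _ (by positivity)
    obtain ⟨W, F, h⟩ := exists_trialSpace_of_atLeastEigenvaluesAbove hV.1 hδ0
    have h1 := h.div_le_maxMinValue (by positivity)
    rw [← coe_toReal_maxMinValue hn, EReal.coe_le_coe_iff, div_le_iff₀ (by positivity)] at h1
    have hx' : 1 ≤ x := hx
    rw [← hm'] at h1
    nlinarith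
  rw [div_le_div_iff₀ (by positivity) (by norm_num)]
  linarith

lemma tendsto_ofReal_half_inv {m : ℝ} (hm : 0 < m) :
    Tendsto (fun a : ℝ => ENNReal.ofReal (1 / (2 * a))) (𝓝[<] m)
      (𝓝 (ENNReal.ofReal (1 / (2 * m)))) := by
  refine ENNReal.tendsto_ofReal ?_
  have : ContinuousAt (fun a : ℝ => 1 / (2 * a)) m :=
    continuousAt_const.div (by fun_prop) (by positivity)
  exact this.tendsto.mono_left nhdsWithin_le_nhds

lemma tendsto_rateInf {n : ℕ} (hn : 1 ≤ n) : Tendsto (fun L : ℝ => rateInf L n) atTop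
    (𝓝 (ENNReal.ofReal (1 / (2 * (maxMinValue n).toReal)))) := by
  have hm := toReal_maxMinValue_pos hn
  refine tendsto_order.2 ⟨fun b hb => Eventually.of_forall fun L => hb.trans_le (le_rateInf hn L),
    fun b hb => ?_⟩
  have h1 := (tendsto_ofReal_half_inv hm).eventually (gt_mem_nhds hb)
  have h2 : ∀ᶠ a in 𝓝[<] (maxMinValue n).toReal, 0 < a :=
    (lt_mem_nhds hm).filter_mono nhdsWithin_le_nhds
  obtain ⟨a, ha1, ha2, ha3⟩ := (h1.and (h2.and self_mem_nhdsWithin)).exists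
  have ha : (a : EReal) < maxMinValue n := by
    rw [← coe_toReal_maxMinValue hn]
    exact EReal.coe_lt_coe_iff.2 ha3
  exact (eventually_rateInf_le hn ha2 ha).mono fun L hL => hL.trans_lt ha1

lemma rho_eq {n : ℕ} (hn : 1 ≤ n) :
    rho n = ENNReal.ofReal (1 / (2 * (maxMinValue n).toReal)) := by
  refine le_antisymm ?_ (le_iInf₂ fun L _ => le_rateInf hn L)
  refine ge_of_tendsto (tendsto_rateInf hn) ?_
  filter_upwards [eventually_gt_atTop 0] with L hL
  exact iInf₂_le L hL

lemma two_div_rho {n : ℕ} (hn : 1 ≤ n) : ((2 / rho n : ℝ≥0∞) : EReal) = 4 * maxMinValue n := by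
  have hm := toReal_maxMinValue_pos hn
  have h1 : (2 : ℝ≥0∞) / rho n = ENNReal.ofReal (4 * (maxMinValue n).toReal) := by
    rw [rho_eq hn, ← ENNReal.ofReal_ofNat 2, ← ENNReal.ofReal_div_of_pos (by positivity)]
    congr 1
    field_simp
    norm_num
  rw [h1, EReal.coe_ennreal_ofReal, max_eq_left (by positivity), EReal.coe_mul,
    coe_toReal_maxMinValue hn]
  rfl

lemma toReal_maxMinValue_le {n : ℕ} (hn : 1 ≤ n) :
    (maxMinValue n).toReal ≤ quarticValue.toReal := by
  have := maxMinValue_le_quarticValue hn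
  rwa [← coe_toReal_maxMinValue hn, ← coe_toReal_quarticValue, EReal.coe_le_coe_iff] at this

end Bounds
end DirichletBox

end

open DirichletBox in
theorem theorem2p6 :
    (∃ C : ℝ, 0 < C ∧ ∀ n : ℕ, 1 ≤ n →
      Tendsto (fun L : ℝ => rateInf L n) atTop (𝓝 (rho n)) ∧
      ENNReal.ofReal C < rho n ∧ rho n < ⊤ ∧
      ((2 / rho n : ℝ≥0∞) : EReal) = 4 * maxMinValue n) ∧
    ∃ χ : ℝ, IsLeast ladyzhenskayaConstants χ ∧
      ((2 / rho 1 : ℝ≥0∞) : EReal) = 4 * quarticValue ∧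
      4 * quarticValue = (χ : EReal) := by
  have hq := toReal_quarticValue_pos
  -- `ϱ_n = 1 / (2 m)` with `m ≤ q`, so that every constant below `1 / (2 q)` is a lower bound.
  refine ⟨⟨1 / (4 * quarticValue.toReal), by positivity, fun n hn => ⟨?_, ?_, ?_, two_div_rho hn⟩⟩,
    4 * quarticValue.toReal, isLeast_ladyzhenskayaConstants, ?_, ?_⟩
  · rw [rho_eq hn]
    exact tendsto_rateInf hn
  · have hm := toReal_maxMinValue_pos hn
    have hle := toReal_maxMinValue_le hn
    rw [rho_eq hn, ENNReal.ofReal_lt_ofReal_iff (by positivity)]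
    exact one_div_lt_one_div_of_lt (by positivity) (by linarith)
  · rw [rho_eq hn]
    exact ENNReal.ofReal_lt_top
  · rw [two_div_rho le_rfl, maxMinValue_one]
  · rw [EReal.coe_mul, coe_toReal_quarticValue]
    rfl
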